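/- **Conventions.** Let $k$ be a field and $(H,\mathcal R)$ a quasitriangular Hopf algebra over $k$ (not necessarily finite-dimensional): $\mathcal R=\mathcal R^{(1)}\otimes\mathcal R^{(2)}\in H\otimes H$ is invertible with $(\Delta\otimes\mathrm{id})\mathcal R=\mathcal R_{13}\mathcal R_{23}$, $(\mathrm{id}\otimes\Delta)\mathcal R=\mathcal R_{13}\mathcal R_{12}$ and $\tau\Delta(h)=\mathcal R\,\Delta(h)\,\mathcal R^{-1}$, where $\tau$ is the flip; write $\mathcal R^{-1}=\mathcal R^{-(1)}\otimes\mathcal R^{-(2)}$. The categories ${}_H\mathcal M$, $\mathcal M_H$ of left and right $H$-modules are braided by $\Psi(v\otimes w)=\mathcal R^{(2)}\triangleright w\otimes\mathcal R^{(1)}\triangleright v$ and $\Psi(v\otimes w)=w\triangleleft\mathcal R^{(1)}\otimes v\triangleleft\mathcal R^{(2)}$ respectively. A *braided group* in such a category means here a Hopf algebra in it: a unital algebra and coalgebra whose coproduct $\underline\Delta$ is an algebra homomorphism into the braided tensor product algebra, whose counit is an algebra homomorphism, with a (braided) antipode $\underline S$, and with all structure maps $H$-linear. Write $\underline\Delta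 b=b_{(1)}\otimes b_{(2)}$, with further indices for iterated coproducts. Let $B$ be a braided group in $\mathcal M_H$ and $D$ a braided group in ${}_H\mathcal M$ whose braided antipode $\underline S_D$ is invertible. Let $\langle\ ,\ \rangle:D\otimes B\to k$ be a duality pairing, i.e. a bilinear form with $\langle cd,b\rangle=\langle c,b_{(1)}\rangle\langle d,b_{(2)}\rangle$, $\langle c,ab\rangle=\langle c_{(1)},a\rangle\langle c_{(2)},b\rangle$, $\langle 1,b\rangle=\underline\epsilon(b)$, $\langle c,1\rangle=\underline\epsilon(c)$ and $\langle h\triangleright c,b\rangle=\langle c,b\triangleleft h\rangle$. Let $\bar H$ be $H$ with the quasitriangular structure $\bar{\mathcal R}=\mathcal R_{21}^{-1}$, and let $\bar C=D^{\underline{\rm cop}}$ be $D$ with the same algebra, unit, counit and action, with coproduct $\bar\Delta=\Psi_{D,D}^{-1}\circ\underline\Delta$ and antipode $\bar S=\underline S_D^{-1}$; write $(\mathrm{id}\otimes\bar\Delta)\bar\Delta c=c_{\bar{(1)}}\otimes c_{\bar{(2)}}\otimes c_{\bar{(3)}}$. The *bosonisation* $H\ltimes B$ is $H\otimes B$ with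 the tensor product unit and counit and $$(h\otimes b)(g\otimes a)=hg_{(1)}\otimes(b\triangleleft g_{(2)})a,\qquad \Delta(h\otimes b)=h_{(1)}\otimes b_{(1)}\triangleleft\mathcal R^{(1)}\otimes h_{(2)}\mathcal R^{(2)}\otimes b_{(2)},$$ $$S(h\otimes b)=S(h_{(2)}\mathcal R^{(2)})\otimes\underline S b\triangleleft(\mathcal R^{(1)}\,v\,Sh_{(1)}),\qquad v=\mathcal R^{(1)}S\mathcal R^{(2)}.$$ The *bosonisation* $\bar C\rtimes\bar H$ is $\bar C\otimes H$ with the tensor product unit and counit and $$(c\otimes h)(d\otimes g)=c\,(h_{(1)}\triangleright d)\otimes h_{(2)}g,\qquad \Delta(c\otimes h)=c_{\bar{(1)}}\otimes\bar{\mathcal R}^{(2)}h_{(1)}\otimes\bar{\mathcal R}^{(1)}\triangleright c_{\bar{(2)}}\otimes h_{(2)},$$ $$S(c\otimes h)=\bigl((Sh_{(2)})\,\bar u\,\bar{\mathcal R}^{(1)}\bigr)\triangleright\bar S c\otimes S(\bar{\mathcal R}^{(2)}h_{(1)}),\qquad \bar u=(S\bar{\mathcal R}^{(2)})\bar{\mathcal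 R}^{(1)}.$$ (Distinct occurrences of $\mathcal R$ or $\bar{\mathcal R}$ denote distinct copies.) **Theorem 3.2.** There is a unique Hopf algebra structure $U=U(\bar C,H,B)$ (product, unit, coproduct, counit and antipode) on the vector space $\bar C\otimes H\otimes B$ such that 1. $\bar C\rtimes\bar H$ and $H\ltimes B$ are sub-Hopf algebras by the canonical inclusions $c\otimes h\mapsto c\otimes h\otimes1$ and $h\otimes b\mapsto1\otimes h\otimes b$; 2. $c\otimes h\otimes b$ is the product $c\cdot h\cdot b$ in $U$ of $c$, $h$, $b$ viewed in $U$; 3. for all $b\in B$ and $c\in\bar C$ viewed in $U$, $$bc=(\mathcal R_1^{(2)}\triangleright c_{\bar{(2)}})\;\mathcal R_2^{(2)}\mathcal R_1^{-(1)}\;(b_{(2)}\triangleleft\mathcal R_2^{-(1)})\;\langle\mathcal R_1^{(1)}\triangleright c_{\bar{(1)}},\,b_{(1)}\triangleleft\mathcal R_2^{(1)}\rangle\;\langle\mathcal R_1^{-(2)}\triangleright\bar S c_{\bar{(3)}},\,b_{(3)}\triangleleft\mathcal R_2^{-(2)}\rangle,$$ where $\mathcal R_1,\mathcal R_2$ and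 $\mathcal R_1^{-1},\mathcal R_2^{-1}$ are distinct copies of $\mathcal R$ and $\mathcal R^{-1}$. -/

import Mathlib

open scoped TensorProduct

noncomputable section

namespace DoubleBosonisation

/-! ### Raw Hopf data and Hopf algebras on a given vector space -/

/-- The structure maps of a would-be Hopf algebra on the vector space `A`. -/
@[ext]
structure HopfData (k A : Type*) [Field k] [AddCommGroup A] [Module k A] where
  mul : A ⊗[k] A →ₗ[k] A
  one : A
  comul : A →ₗ[k] A ⊗[k] A
  counit : A →ₗ[k] k
  antipode : A →ₗ[k] A

section Middle

variable {k M N P Q N' P' : Type*} [Field k]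
  [AddCommGroup M] [Module k M] [AddCommGroup N] [Module k N]
  [AddCommGroup P] [Module k P] [AddCommGroup Q] [Module k Q]
  [AddCommGroup N'] [Module k N'] [AddCommGroup P'] [Module k P']

/-- `id ⊗ f ⊗ id`, for `f` exchanging the two middle factors. -/
def middle (f : N ⊗[k] P →ₗ[k] P' ⊗[k] N') :
    (M ⊗[k] N) ⊗[k] (P ⊗[k] Q) →ₗ[k] (M ⊗[k] P') ⊗[k] (N' ⊗[k] Q) :=
  (TensorProduct.assoc k M P' (N' ⊗[k] Q)).symm.toLinearMap ∘ₗ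
    (((TensorProduct.assoc k P' N' Q).toLinearMap ∘ₗ f.rTensor Q ∘ₗ
      (TensorProduct.assoc k N P Q).symm.toLinearMap).lTensor M) ∘ₗ
    (TensorProduct.assoc k M N (P ⊗[k] Q)).toLinearMap

end Middle

namespace HopfData

variable {k A A' : Type*} [Field k] [AddCommGroup A] [Module k A] [AddCommGroup A'] [Module k A']

/-- The product of the tensor product algebra `A ⊗ A`: `(a ⊗ b)(c ⊗ d) = ac ⊗ bd`. -/
def mulTensor (X : HopfData k A) : (A ⊗[k] A) ⊗[k] (A ⊗[k] A) →ₗ[k] A ⊗[k] A :=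
  TensorProduct.map X.mul X.mul ∘ₗ middle (TensorProduct.comm k A A).toLinearMap

/-- The axioms of a Hopf algebra over `k`. -/
structure IsHopfAlgebra (X : HopfData k A) : Prop where
  mul_assoc : ∀ a b c : A,
    X.mul (X.mul (a ⊗ₜ[k] b) ⊗ₜ[k] c) = X.mul (a ⊗ₜ[k] X.mul (b ⊗ₜ[k] c))
  one_mul : ∀ a : A, X.mul (X.one ⊗ₜ[k] a) = a
  mul_one : ∀ a : A, X.mul (a ⊗ₜ[k] X.one) = a
  coassoc : ∀ a : A,
    TensorProduct.assoc k A A A (X.comul.rTensor A (X.comul a)) = X.comul.lTensor A (X.comul a)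
  counit_comul : ∀ a : A, TensorProduct.lid k A (X.counit.rTensor A (X.comul a)) = a
  comul_counit : ∀ a : A, TensorProduct.rid k A (X.counit.lTensor A (X.comul a)) = a
  comul_mul : ∀ a b : A,
    X.comul (X.mul (a ⊗ₜ[k] b)) = X.mulTensor (X.comul a ⊗ₜ[k] X.comul b)
  comul_one : X.comul X.one = X.one ⊗ₜ[k] X.one
  counit_mul : ∀ a b : A, X.counit (X.mul (a ⊗ₜ[k] b)) = X.counit a * X.counit b
  counit_one : X.counit X.one = 1
  antipode_left : ∀ a : A, X.mul (X.antipode.rTensor A (X.comul a)) = X.counit a • X.one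
  antipode_right : ∀ a : A, X.mul (X.antipode.lTensor A (X.comul a)) = X.counit a • X.one

/-- The linear map `f` identifies `X` with a sub-Hopf algebra of `Y`: it is injective and commutes
with all structure maps. -/
structure IsSubHopfAlgebra (X : HopfData k A) (Y : HopfData k A') (f : A →ₗ[k] A') : Prop where
  injective : Function.Injective f
  map_mul : ∀ a b : A, f (X.mul (a ⊗ₜ[k] b)) = Y.mul (f a ⊗ₜ[k] f b)
  map_one : f X.one = Y.one
  map_comul : ∀ a : A, Y.comul (f a) = TensorProduct.map f f (X.comul a)
  map_counit : ∀ a : A, Y.counit (f a) = X.counit a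
  map_antipode : ∀ a : A, f (X.antipode a) = Y.antipode (f a)

end HopfData

/-! ### Quasitriangular structures -/

section Quasitriangular

variable {k H : Type*} [Field k] [Ring H] [HopfAlgebra k H]

/-- `R` is a quasitriangular structure on `H`: it is an invertible element of `H ⊗ H` with
`(Δ ⊗ id) R = R₁₃ R₂₃`, `(id ⊗ Δ) R = R₁₃ R₁₂` and `τ (Δ h) = R (Δ h) R⁻¹`. -/
structure IsQuasitriangular (R : (H ⊗[k] H)ˣ) : Prop where
  comul_id :
    TensorProduct.assoc k H H H
        ((Coalgebra.comul (R := k) (A := H)).rTensor H (R : H ⊗[k] H)) =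
      ((TensorProduct.mk k H H 1).lTensor H (R : H ⊗[k] H)) *
        ((1 : H) ⊗ₜ[k] (R : H ⊗[k] H))
  id_comul :
    (Coalgebra.comul (R := k) (A := H)).lTensor H (R : H ⊗[k] H) =
      ((TensorProduct.mk k H H 1).lTensor H (R : H ⊗[k] H)) *
        (((TensorProduct.mk k H H).flip 1).lTensor H (R : H ⊗[k] H))
  comm_comul : ∀ h : H,
    TensorProduct.comm k H H (Coalgebra.comul (R := k) h) =
      (R : H ⊗[k] H) * Coalgebra.comul (R := k) h * ((R⁻¹ : (H ⊗[k] H)ˣ) : H ⊗[k] H)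

/-- The inverse-transposed element `R̄ = R₂₁⁻¹`. -/
def conjR (R : (H ⊗[k] H)ˣ) : H ⊗[k] H :=
  TensorProduct.comm k H H ((R⁻¹ : (H ⊗[k] H)ˣ) : H ⊗[k] H)

end Quasitriangular

/-! ### Actions and braidings -/

section Actions

variable (k H : Type*) [Field k] [Ring H] [HopfAlgebra k H]

/-- The left action `h ↦ (v ↦ h ▷ v)` as a linear map. -/
def leftAct (V : Type*) [AddCommGroup V] [Module k V] [Module H V] [IsScalarTower k H V] :
    H →ₗ[k] V →ₗ[k] V :=
  (Algebra.lsmul k k V : H →ₐ[k] Module.End k V).toLinearMap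

/-- The right action `h ↦ (v ↦ v ◁ h)` as a linear map. -/
def rightAct (V : Type*) [AddCommGroup V] [Module k V] [Module Hᵐᵒᵖ V]
    [IsScalarTower k Hᵐᵒᵖ V] : H →ₗ[k] V →ₗ[k] V :=
  (Algebra.lsmul k k V : Hᵐᵒᵖ →ₐ[k] Module.End k V).toLinearMap ∘ₗ
    (MulOpposite.opLinearEquiv k : H ≃ₗ[k] Hᵐᵒᵖ).toLinearMap

/-- Left multiplication `h ↦ (g ↦ h g)`. -/
def leftMul : H →ₗ[k] H →ₗ[k] H := LinearMap.mul k H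

/-- Right multiplication `h ↦ (g ↦ g h)`. -/
def rightMul : H →ₗ[k] H →ₗ[k] H := (LinearMap.mul k H).flip

variable {k H}

/-- Given linear maps `ρ : H → End V` and `σ : H → End W`, the element `∑ h ⊗ g` of `H ⊗ H` acts on
`V ⊗ W` by `v ⊗ w ↦ ∑ ρ(h) v ⊗ σ(g) w`. -/
def tensorAct {V W : Type*} [AddCommGroup V] [Module k V] [AddCommGroup W] [Module k W]
    (ρ : H →ₗ[k] V →ₗ[k] V) (σ : H →ₗ[k] W →ₗ[k] W) :
    H ⊗[k] H →ₗ[k] (V ⊗[k] W →ₗ[k] V ⊗[k] W) :=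
  TensorProduct.homTensorHomMap (RingHom.id k) V W V W ∘ₗ TensorProduct.map ρ σ

variable (V W : Type*) [AddCommGroup V] [Module k V] [AddCommGroup W] [Module k W]

/-- The braiding of left modules, `Ψ(v ⊗ w) = R⁽²⁾ ▷ w ⊗ R⁽¹⁾ ▷ v`. -/
def leftBraiding [Module H V] [IsScalarTower k H V] [Module H W] [IsScalarTower k H W]
    (R : H ⊗[k] H) : V ⊗[k] W →ₗ[k] W ⊗[k] V :=
  (TensorProduct.comm k V W).toLinearMap ∘ₗ tensorAct (leftAct k H V) (leftAct k H W) R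

/-- The braiding of right modules, `Ψ(v ⊗ w) = w ◁ R⁽¹⁾ ⊗ v ◁ R⁽²⁾`. -/
def rightBraiding [Module Hᵐᵒᵖ V] [IsScalarTower k Hᵐᵒᵖ V] [Module Hᵐᵒᵖ W]
    [IsScalarTower k Hᵐᵒᵖ W] (R : H ⊗[k] H) : V ⊗[k] W →ₗ[k] W ⊗[k] V :=
  tensorAct (rightAct k H W) (rightAct k H V) R ∘ₗ (TensorProduct.comm k V W).toLinearMap

end Actions

/-! ### Braided groups -/

section BraidedGroups

variable {k H : Type*} [Field k] [Ring H] [HopfAlgebra k H]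

/-- The axioms relating an algebra and coalgebra `A` with an antipode `S` that make it a Hopf
algebra with respect to a braiding `Ψ` of `A` with itself. -/
structure IsBraidedHopf {A : Type*} [Ring A] [Algebra k A] [Coalgebra k A]
    (Ψ : A ⊗[k] A →ₗ[k] A ⊗[k] A) (S : A →ₗ[k] A) : Prop where
  comul_mul : ∀ a b : A, Coalgebra.comul (R := k) (a * b) =
    TensorProduct.map (LinearMap.mul' k A) (LinearMap.mul' k A)
      (middle Ψ (Coalgebra.comul (R := k) a ⊗ₜ[k] Coalgebra.comul (R := k) b))
  comul_one : Coalgebra.comul (R := k) (1 : A) = 1 ⊗ₜ[k] 1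
  counit_mul : ∀ a b : A, Coalgebra.counit (R := k) (a * b) =
    Coalgebra.counit (R := k) a * Coalgebra.counit (R := k) b
  counit_one : Coalgebra.counit (R := k) (1 : A) = 1
  antipode_left : ∀ a : A, LinearMap.mul' k A (S.rTensor A (Coalgebra.comul (R := k) a)) =
    algebraMap k A (Coalgebra.counit (R := k) a)
  antipode_right : ∀ a : A, LinearMap.mul' k A (S.lTensor A (Coalgebra.comul (R := k) a)) =
    algebraMap k A (Coalgebra.counit (R := k) a)

/-- `D` with braided antipode `S` is a braided group (a Hopf algebra) in the category of left
`H`-modules, with the braiding defined by `R`: all structure maps intertwine the action. -/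
structure IsLeftBraidedGroup (R : H ⊗[k] H) {D : Type*} [Ring D] [Algebra k D] [Coalgebra k D]
    [Module H D] [IsScalarTower k H D] (S : D →ₗ[k] D) : Prop
    extends IsBraidedHopf (leftBraiding D D R) S where
  act_mul : ∀ (h : H) (c d : D), h • (c * d) = LinearMap.mul' k D
    (tensorAct (leftAct k H D) (leftAct k H D) (Coalgebra.comul (R := k) h) (c ⊗ₜ[k] d))
  act_one : ∀ h : H, h • (1 : D) = algebraMap k D (Coalgebra.counit (R := k) h)
  comul_act : ∀ (h : H) (c : D), Coalgebra.comul (R := k) (h • c) =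
    tensorAct (leftAct k H D) (leftAct k H D) (Coalgebra.comul (R := k) h)
      (Coalgebra.comul (R := k) c)
  counit_act : ∀ (h : H) (c : D), Coalgebra.counit (R := k) (h • c) =
    Coalgebra.counit (R := k) h * Coalgebra.counit (R := k) c
  antipode_act : ∀ (h : H) (c : D), S (h • c) = h • S c

/-- `B` with braided antipode `S` is a braided group (a Hopf algebra) in the category of right
`H`-modules, with the braiding defined by `R`; `b ◁ h` is `MulOpposite.op h • b`. -/
structure IsRightBraidedGroup (R : H ⊗[k] H) {B : Type*} [Ring B] [Algebra k B] [Coalgebra k B]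
    [Module Hᵐᵒᵖ B] [IsScalarTower k Hᵐᵒᵖ B] (S : B →ₗ[k] B) : Prop
    extends IsBraidedHopf (rightBraiding B B R) S where
  act_mul : ∀ (h : H) (a b : B), MulOpposite.op h • (a * b) = LinearMap.mul' k B
    (tensorAct (rightAct k H B) (rightAct k H B) (Coalgebra.comul (R := k) h) (a ⊗ₜ[k] b))
  act_one : ∀ h : H, MulOpposite.op h • (1 : B) = algebraMap k B (Coalgebra.counit (R := k) h)
  comul_act : ∀ (h : H) (b : B), Coalgebra.comul (R := k) (MulOpposite.op h • b) =
    tensorAct (rightAct k H B) (rightAct k H B) (Coalgebra.comul (R := k) h)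
      (Coalgebra.comul (R := k) b)
  counit_act : ∀ (h : H) (b : B), Coalgebra.counit (R := k) (MulOpposite.op h • b) =
    Coalgebra.counit (R := k) b * Coalgebra.counit (R := k) h
  antipode_act : ∀ (h : H) (b : B), S (MulOpposite.op h • b) = MulOpposite.op h • S b

/-- An (ordinary) duality pairing `⟨ , ⟩` of a left-covariant `D` with a right-covariant `B`:
`⟨cd, b⟩ = ⟨c, b₍₁₎⟩⟨d, b₍₂₎⟩`, `⟨c, ab⟩ = ⟨c₍₁₎, a⟩⟨c₍₂₎, b⟩`, `⟨1, b⟩ = ε(b)`, `⟨c, 1⟩ = ε(c)`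
and `⟨h ▷ c, b⟩ = ⟨c, b ◁ h⟩`. -/
structure IsDualPairing (H : Type*) [Ring H] [HopfAlgebra k H]
    {D B : Type*} [Ring D] [Algebra k D] [Coalgebra k D] [Module H D]
    [Ring B] [Algebra k B] [Coalgebra k B] [Module Hᵐᵒᵖ B]
    (pair : D →ₗ[k] B →ₗ[k] k) : Prop where
  mul_left : ∀ (c d : D) (b : B), pair (c * d) b =
    LinearMap.mul' k k (TensorProduct.map (pair c) (pair d) (Coalgebra.comul (R := k) b))
  mul_right : ∀ (c : D) (a b : B), pair c (a * b) =
    LinearMap.mul' k k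
      (TensorProduct.map (pair.flip a) (pair.flip b) (Coalgebra.comul (R := k) c))
  one_left : ∀ b : B, pair 1 b = Coalgebra.counit (R := k) b
  one_right : ∀ c : D, pair c 1 = Coalgebra.counit (R := k) c
  act : ∀ (h : H) (c : D) (b : B), pair (h • c) b = pair c (MulOpposite.op h • b)

/-- The coproduct `Δ̄ = Ψ⁻¹ ∘ Δ` of `D^cop`, where `Ψ⁻¹(x ⊗ y) = R⁻⁽¹⁾ ▷ y ⊗ R⁻⁽²⁾ ▷ x` is the inverse
of the braiding of `D` with itself. The algebra, unit and counit of `D^cop` are those of `D` and its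
antipode is the inverse of that of `D`. -/
def copComul (R : (H ⊗[k] H)ˣ) (D : Type*) [Ring D] [Algebra k D] [Coalgebra k D] [Module H D]
    [IsScalarTower k H D] : D →ₗ[k] D ⊗[k] D :=
  tensorAct (leftAct k H D) (leftAct k H D) ((R⁻¹ : (H ⊗[k] H)ˣ) : H ⊗[k] H) ∘ₗ
    (TensorProduct.comm k D D).toLinearMap ∘ₗ Coalgebra.comul

end BraidedGroups

/-! ### Bosonisations -/

section Bosonisation

variable {k H : Type*} [Field k] [Ring H] [HopfAlgebra k H]

/-- `h ⊗ c ↦ h₍₁₎ ▷ c ⊗ h₍₂₎`. -/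
def leftCross (D : Type*) [AddCommGroup D] [Module k D] [Module H D] [IsScalarTower k H D] :
    H ⊗[k] D →ₗ[k] D ⊗[k] H :=
  (TensorProduct.lift (leftAct k H D)).rTensor H ∘ₗ
    (TensorProduct.rightComm k H H D).toLinearMap ∘ₗ
    (Coalgebra.comul (R := k) (A := H)).rTensor D

/-- `b ⊗ h ↦ h₍₁₎ ⊗ b ◁ h₍₂₎`. -/
def rightCross (B : Type*) [AddCommGroup B] [Module k B] [Module Hᵐᵒᵖ B]
    [IsScalarTower k Hᵐᵒᵖ B] : B ⊗[k] H →ₗ[k] H ⊗[k] B :=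
  (TensorProduct.lift (rightAct k H B).flip).lTensor H ∘ₗ
    (TensorProduct.leftComm k B H H).toLinearMap ∘ₗ
    (Coalgebra.comul (R := k) (A := H)).lTensor B

/-- The element `u = (S R⁽²⁾) R⁽¹⁾` of `H`. -/
def elemU (R : H ⊗[k] H) : H :=
  LinearMap.mul' k H ((HopfAlgebra.antipode k (A := H)).rTensor H (TensorProduct.comm k H H R))

/-- The element `v = R⁽¹⁾ (S R⁽²⁾)` of `H`. -/
def elemV (R : H ⊗[k] H) : H :=
  LinearMap.mul' k H ((HopfAlgebra.antipode k (A := H)).lTensor H R)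

/-- The map `c ⊗ h ↦ (u R⁽¹⁾) ▷ c ⊗ S(R⁽²⁾ h)`. -/
def leftAntipodeAux (R : H ⊗[k] H) (D : Type*) [AddCommGroup D] [Module k D] [Module H D]
    [IsScalarTower k H D] : D ⊗[k] H →ₗ[k] D ⊗[k] H :=
  TensorProduct.map (leftAct k H D (elemU R)) (HopfAlgebra.antipode k (A := H)) ∘ₗ
    tensorAct (leftAct k H D) (leftMul k H) R

/-- The map `h ⊗ b ↦ S(h R⁽²⁾) ⊗ b ◁ (R⁽¹⁾ v)`. -/
def rightAntipodeAux (R : H ⊗[k] H) (B : Type*) [AddCommGroup B] [Module k B] [Module Hᵐᵒᵖ B]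
    [IsScalarTower k Hᵐᵒᵖ B] : H ⊗[k] B →ₗ[k] H ⊗[k] B :=
  TensorProduct.map (HopfAlgebra.antipode k (A := H)) (rightAct k H B (elemV R)) ∘ₗ
    tensorAct (rightMul k H) (rightAct k H B) (TensorProduct.comm k H H R)

/-- The bosonisation on `C ⊗ H` of a braided group `C` in the category of left `H`-modules with
quasitriangular structure `R`. The coproduct `Δ` and antipode `S` of `C` are explicit arguments, the
algebra and counit being the given ones:
`(b ⊗ h)(c ⊗ g) = b (h₍₁₎ ▷ c) ⊗ h₍₂₎ g`,
`Δ(b ⊗ h) = b₍₁₎ ⊗ R⁽²⁾ h₍₁₎ ⊗ R⁽¹⁾ ▷ b₍₂₎ ⊗ h₍₂₎`,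
`S(b ⊗ h) = ((S h₍₂₎) u R⁽¹⁾) ▷ S b ⊗ S(R⁽²⁾ h₍₁₎)`,
with the tensor product unit and counit. -/
def leftBosonisation (R : H ⊗[k] H) {C : Type*} [Ring C] [Algebra k C] [Module H C]
    [IsScalarTower k H C] (Δ : C →ₗ[k] C ⊗[k] C) (ε : C →ₗ[k] k) (S : C →ₗ[k] C) :
    HopfData k (C ⊗[k] H) where
  mul := TensorProduct.map (LinearMap.mul' k C) (LinearMap.mul' k H) ∘ₗ middle (leftCross C)
  one := 1 ⊗ₜ[k] 1
  comul :=
    middle ((TensorProduct.comm k C H).toLinearMap ∘ₗ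
      tensorAct (leftAct k H C) (leftMul k H) R) ∘ₗ
      TensorProduct.map Δ (Coalgebra.comul (R := k) (A := H))
  counit := LinearMap.mul' k k ∘ₗ TensorProduct.map ε (Coalgebra.counit (R := k) (A := H))
  antipode :=
    (TensorProduct.lift
        ((leftAct k H C) ∘ₗ HopfAlgebra.antipode k (A := H)).flip).rTensor H ∘ₗ
      (TensorProduct.rightComm k C H H).toLinearMap ∘ₗ
      (leftAntipodeAux R C).rTensor H ∘ₗ
      (TensorProduct.assoc k C H H).symm.toLinearMap ∘ₗ
      TensorProduct.map S (Coalgebra.comul (R := k) (A := H))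

/-- The bosonisation on `H ⊗ B` of a braided group `B` in the category of right `H`-modules with
quasitriangular structure `R`:
`(h ⊗ b)(g ⊗ c) = h g₍₁₎ ⊗ (b ◁ g₍₂₎) c`,
`Δ(h ⊗ b) = h₍₁₎ ⊗ b₍₁₎ ◁ R⁽¹⁾ ⊗ h₍₂₎ R⁽²⁾ ⊗ b₍₂₎`,
`S(h ⊗ b) = S(h₍₂₎ R⁽²⁾) ⊗ S b ◁ (R⁽¹⁾ v S h₍₁₎)`,
with the tensor product unit and counit. -/
def rightBosonisation (R : H ⊗[k] H) {B : Type*} [Ring B] [Algebra k B] [Coalgebra k B]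
    [Module Hᵐᵒᵖ B] [IsScalarTower k Hᵐᵒᵖ B] (S : B →ₗ[k] B) :
    HopfData k (H ⊗[k] B) where
  mul := TensorProduct.map (LinearMap.mul' k H) (LinearMap.mul' k B) ∘ₗ middle (rightCross B)
  one := 1 ⊗ₜ[k] 1
  comul :=
    middle (tensorAct (rightAct k H B) (rightMul k H) R ∘ₗ
      (TensorProduct.comm k H B).toLinearMap) ∘ₗ
      TensorProduct.map (Coalgebra.comul (R := k) (A := H)) (Coalgebra.comul (R := k) (A := B))
  counit := LinearMap.mul' k k ∘ₗ
    TensorProduct.map (Coalgebra.counit (R := k) (A := H)) (Coalgebra.counit (R := k) (A := B))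
  antipode :=
    (TensorProduct.lift ((rightAct k H B) ∘ₗ HopfAlgebra.antipode k (A := H))).lTensor H ∘ₗ
      (TensorProduct.leftComm k H H B).toLinearMap ∘ₗ
      (rightAntipodeAux R B).lTensor H ∘ₗ
      (TensorProduct.assoc k H H B).toLinearMap ∘ₗ
      TensorProduct.map (Coalgebra.comul (R := k) (A := H)) S

end Bosonisation

/-! ### The double-bosonisation -/

section Double

variable (k C H B : Type*) [Field k] [Ring H] [HopfAlgebra k H]
  [Ring C] [Algebra k C] [Ring B] [Algebra k B]

/-- The canonical inclusion `c ⊗ h ↦ c ⊗ h ⊗ 1`. -/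
def inclCH : C ⊗[k] H →ₗ[k] C ⊗[k] (H ⊗[k] B) :=
  ((TensorProduct.mk k H B).flip 1).lTensor C

/-- The canonical inclusion `h ⊗ b ↦ 1 ⊗ h ⊗ b`. -/
def inclHB : H ⊗[k] B →ₗ[k] C ⊗[k] (H ⊗[k] B) :=
  TensorProduct.mk k C (H ⊗[k] B) 1

variable {k C H B}

/-- Elements `c ⊗ h ⊗ b` of `C ⊗ H ⊗ B` are the products `c h b` of `c`, `h`, `b` viewed in `U`. -/
def IsTriangular (U : HopfData k (C ⊗[k] (H ⊗[k] B))) : Prop :=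
  ∀ (c : C) (h : H) (b : B),
    U.mul (U.mul ((c ⊗ₜ[k] ((1 : H) ⊗ₜ[k] (1 : B))) ⊗ₜ[k] ((1 : C) ⊗ₜ[k] (h ⊗ₜ[k] (1 : B)))) ⊗ₜ[k]
      ((1 : C) ⊗ₜ[k] ((1 : H) ⊗ₜ[k] b))) = c ⊗ₜ[k] (h ⊗ₜ[k] b)

/-- The cross relation
`b c = (R₁⁽²⁾ ▷ c₍₂₎) R₂⁽²⁾ R₁⁻⁽¹⁾ (b₍₂₎ ◁ R₂⁻⁽¹⁾)
  ⟨R₁⁽¹⁾ ▷ c₍₁₎, b₍₁₎ ◁ R₂⁽¹⁾⟩ ⟨R₁⁻⁽²⁾ ▷ S c₍₃₎, b₍₃₎ ◁ R₂⁻⁽²⁾⟩`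
in `C ⊗ H ⊗ B`, where `c₍₁₎ ⊗ c₍₂₎ ⊗ c₍₃₎` is the iterated coproduct `(id ⊗ Δ)Δ c` for the given
coproduct `Δ` of `C`, and `S` is the given antipode of `C`. Sweedler sums are spelt out through
arbitrary expressions of the tensors as finite sums of pure tensors: `R = ∑ r i ⊗ r' i` and
`R⁻¹ = ∑ s i ⊗ s' i`. -/
def CrossRelation (R : (H ⊗[k] H)ˣ) [Module H C] [Coalgebra k B] [Module Hᵐᵒᵖ B]
    (Δ : C →ₗ[k] C ⊗[k] C) (S : C →ₗ[k] C) (pair : C →ₗ[k] B →ₗ[k] k)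
    (U : HopfData k (C ⊗[k] (H ⊗[k] B))) : Prop :=
  ∀ (b : B) (c : C) (l m p q : ℕ) (r r' : Fin l → H) (s s' : Fin m → H)
    (c₁ c₂ c₃ : Fin p → C) (b₁ b₂ b₃ : Fin q → B),
    (R : H ⊗[k] H) = ∑ i, r i ⊗ₜ[k] r' i →
    ((R⁻¹ : (H ⊗[k] H)ˣ) : H ⊗[k] H) = ∑ j, s j ⊗ₜ[k] s' j →
    Δ.lTensor C (Δ c) = ∑ x, c₁ x ⊗ₜ[k] (c₂ x ⊗ₜ[k] c₃ x) →
    (Coalgebra.comul (R := k) (A := B)).lTensor B (Coalgebra.comul (R := k) b) =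
      ∑ y, b₁ y ⊗ₜ[k] (b₂ y ⊗ₜ[k] b₃ y) →
    U.mul (((1 : C) ⊗ₜ[k] ((1 : H) ⊗ₜ[k] b)) ⊗ₜ[k] (c ⊗ₜ[k] ((1 : H) ⊗ₜ[k] (1 : B)))) =
      ∑ i₁, ∑ i₂, ∑ j₁, ∑ j₂, ∑ x, ∑ y,
        (pair (r i₁ • c₁ x) (MulOpposite.op (r i₂) • b₁ y) *
          pair (s' j₁ • S (c₃ x)) (MulOpposite.op (s' j₂) • b₃ y)) •
        ((r' i₁ • c₂ x) ⊗ₜ[k]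
          ((r' i₂ * s j₁) ⊗ₜ[k] (MulOpposite.op (s j₂) • b₂ y)))

/-- `U` is a double-bosonisation `U(C̄, H, B)` with `C̄ = D^cop`: a Hopf algebra structure on the
vector space `C̄ ⊗ H ⊗ B`, in which `c ⊗ h ⊗ b` is the product `c h b`, that contains the
bosonisation of `C̄` over `(H, R₂₁⁻¹)` and the bosonisation of `B` over `(H, R)` as sub-Hopf algebras
by the canonical inclusions and satisfies the cross relation. `SD`, `SB` are the braided antipodes
of `D` and `B`. -/
structure IsDoubleBosonisation (R : (H ⊗[k] H)ˣ)
    {D : Type*} [Ring D] [Algebra k D] [Coalgebra k D] [Module H D] [IsScalarTower k H D]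
    [Coalgebra k B] [Module Hᵐᵒᵖ B] [IsScalarTower k Hᵐᵒᵖ B]
    (SD : D ≃ₗ[k] D) (SB : B →ₗ[k] B) (pair : D →ₗ[k] B →ₗ[k] k)
    (U : HopfData k (D ⊗[k] (H ⊗[k] B))) : Prop where
  isHopfAlgebra : U.IsHopfAlgebra
  isTriangular : IsTriangular U
  left_sub : HopfData.IsSubHopfAlgebra
    (leftBosonisation (conjR R) (copComul R D) Coalgebra.counit SD.symm.toLinearMap) U
    (inclCH k D H B)
  right_sub : HopfData.IsSubHopfAlgebra (rightBosonisation (R : H ⊗[k] H) SB) U (inclHB k D H B)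
  cross : CrossRelation R (copComul R D) SD.symm.toLinearMap pair U

end Double

end DoubleBosonisation

end

/-! Existence is obtained without verifying associativity of the stated product by hand. The
difficult relation is the one for bc, so it is first replaced by bc = cb. Together with hc = (h₍₁₎ ▷
c) h₍₂₎ and bh = h₍₁₎ (b ◁ h₍₂₎) this gives an algebra on D ⊗ H ⊗ B, realised by operators in End D
⊗ H ⊗ (End B)ᵒᵖ (`exists_crossedTriple`). It carries the coproduct d ↦ R⁻¹(1 ⊗ d₍₁₎)R(d₍₂₎ ⊗ 1), b ↦
R⁻¹(b₍₁₎ ⊗ 1)R(1 ⊗ b₍₂₎). Conjugation by R makes the two legs commute up to the braiding, so a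
coproduct that is multiplicative for the braided tensor product becomes multiplicative for the
ordinary one (`comul_isCrossedTriple`). Coassociativity is then the quantum Yang-Baxter equation
(`yangBaxter_conj`).

The true product is a cocycle twist of this one. The maps β : dhb ↦ ε(d)ε(h)b and γ : dhb ↦ d
ε(h)ε(b) are coalgebra maps onto B and onto D with the coproduct Δ̄, and the pairing axioms make σ(u
⊗ v) = ⟨γ(v), β(u)⟩ a two-cocycle (`form_cocycle`). Its convolution inverse is ⟨S̄γ(v), β(u)⟩ with
S̄ the inverse of the braided antipode of D, because S̄ is an antipode for Δ̄
(`mul_antipode_copComul`); this rests on the braided antimultiplicativity of the antipode. The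
twisted product σ(u₍₁₎, v₍₁₎) u₍₂₎v₍₂₎ σ⁻¹(u₍₃₎, v₍₃₎) is automatically associative and compatible
with the old coproduct (`twistMul_assoc`, `twistMulHom`). Since σ is trivial when its first argument
lies in DH or its second in HB, both bosonisations and the decomposition chb survive the twist
(`twistMul_left`, `twistMul_right`). On b ⊗ c the twist produces exactly the required cross relation
(`twistMul_right_left`).

The antipode is S(dhb) = S(b)S(h)S(d), with values on D and B read off from the bosonisations. In
the antipode axioms the factors of Δ(dhb) collapse one subalgebra at a time, so the cross relation
is not needed. The bialgebra is finally carried to D ⊗ H ⊗ B along d ⊗ h ⊗ b ↦ dhb.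

Uniqueness holds because (chb)(c'h'b') = (ch)((bc')(h'b')): every product in this expression is
prescribed by a sub-Hopf algebra, by the decomposition or by the cross relation. Coproduct and
counit are multiplicative, hence determined by their values on ch and b, and an antipode is a
convolution inverse (`IsDoubleBosonisation.unique`). -/

open scoped TensorProduct

set_option linter.unusedSectionVars false
set_option linter.unusedSimpArgs false

noncomputable section

namespace DoubleBosonisation

/-! ### Legs of tensors -/

section Legs

variable (k : Type*) {X Y : Type*} [Field k] [Ring X] [Algebra k X] [Ring Y] [Algebra k Y]

/-- `x ⊗ y ↦ x ⊗ y ⊗ 1`. -/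
def leg12 (X : Type*) [Ring X] [Algebra k X] : X ⊗[k] X →ₐ[k] X ⊗[k] (X ⊗[k] X) :=
  Algebra.TensorProduct.map (AlgHom.id k X) Algebra.TensorProduct.includeLeft

/-- `x ⊗ y ↦ x ⊗ 1 ⊗ y`. -/
def leg13 (X : Type*) [Ring X] [Algebra k X] : X ⊗[k] X →ₐ[k] X ⊗[k] (X ⊗[k] X) :=
  Algebra.TensorProduct.map (AlgHom.id k X) Algebra.TensorProduct.includeRight

/-- `x ⊗ y ↦ 1 ⊗ x ⊗ y`. -/
def leg23 (X : Type*) [Ring X] [Algebra k X] : X ⊗[k] X →ₐ[k] X ⊗[k] (X ⊗[k] X) :=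
  Algebra.TensorProduct.includeRight

/-- `f ⊗ id`, with the target reassociated. -/
def expandLeft (f : X →ₐ[k] X ⊗[k] X) : X ⊗[k] X →ₐ[k] X ⊗[k] (X ⊗[k] X) :=
  (Algebra.TensorProduct.assoc k k k X X X).toAlgHom.comp
    (Algebra.TensorProduct.map f (AlgHom.id k X))

/-- `id ⊗ f`. -/
def expandRight (f : X →ₐ[k] X ⊗[k] X) : X ⊗[k] X →ₐ[k] X ⊗[k] (X ⊗[k] X) :=
  Algebra.TensorProduct.map (AlgHom.id k X) f

@[simp] lemma leg12_tmul (x y : X) : leg12 k X (x ⊗ₜ y) = x ⊗ₜ (y ⊗ₜ 1) := rfl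
@[simp] lemma leg13_tmul (x y : X) : leg13 k X (x ⊗ₜ y) = x ⊗ₜ (1 ⊗ₜ y) := rfl
@[simp] lemma leg23_apply (z : X ⊗[k] X) : leg23 k X z = 1 ⊗ₜ z := rfl
@[simp] lemma expandRight_tmul (f : X →ₐ[k] X ⊗[k] X) (x y : X) :
    expandRight k f (x ⊗ₜ y) = x ⊗ₜ f y := rfl
lemma expandLeft_tmul (f : X →ₐ[k] X ⊗[k] X) (x y : X) :
    expandLeft k f (x ⊗ₜ y) = TensorProduct.assoc k X X X (f x ⊗ₜ y) := rfl

end Legs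

/-! ### The antipode reverses the coproduct. -/

section HopfFacts

variable {k H : Type*} [Field k] [Ring H] [HopfAlgebra k H]

open Coalgebra HopfAlgebra

/-- Both sides are convolution inverses of Δ in Hom(H, H ⊗ H). Indeed Δ is the convolution product
of h ↦ h ⊗ 1 and h ↦ 1 ⊗ h, and an algebra map i has convolution inverse i ∘ S. The formula is used
to move S(h) past D and B when the antipodes of the bosonisations are compared. -/
lemma comul_antipode (h : H) :
    comul (R := k) (antipode k h) =
      TensorProduct.map (antipode k) (antipode k) (TensorProduct.comm k H H (comul (R := k) h)) := by
  let i₁ : H →ₐ[k] H ⊗[k] H := Algebra.TensorProduct.includeLeft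
  let i₂ : H →ₐ[k] H ⊗[k] H := Algebra.TensorProduct.includeRight
  have split : WithConv.toConv (comul (R := k) (A := H)) =
      WithConv.toConv i₁.toLinearMap * WithConv.toConv i₂.toLinearMap := by
    ext h
    rw [(ℛ k h).convMul_apply]
    simp [i₁, i₂, (ℛ k h).eq]
  have split' : WithConv.toConv (TensorProduct.map (antipode k) (antipode k) ∘ₗ
        (TensorProduct.comm k H H).toLinearMap ∘ₗ comul (R := k) (A := H)) =
      WithConv.toConv (i₂.toLinearMap ∘ₗ antipode k) *
        WithConv.toConv (i₁.toLinearMap ∘ₗ antipode k) := by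
    ext h
    rw [(ℛ k h).convMul_apply]
    simp [i₁, i₂, ← (ℛ k h).eq]
  have inv (i : H →ₐ[k] H ⊗[k] H) : WithConv.toConv (i.toLinearMap ∘ₗ antipode k) *
      WithConv.toConv i.toLinearMap = 1 := by
    have := LinearMap.algHom_comp_convMul_distrib i (WithConv.toConv (antipode k (A := H)))
      (WithConv.toConv LinearMap.id)
    rw [LinearMap.antipode_mul_id] at this
    apply WithConv.ext
    simp only [LinearMap.comp_id] at this
    rw [← this]
    ext x
    simp [LinearMap.convOne_def]
  have key := left_inv_eq_right_inv (a := WithConv.toConv (comul (R := k) (A := H)))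
    (b := WithConv.toConv (TensorProduct.map (antipode k) (antipode k) ∘ₗ
        (TensorProduct.comm k H H).toLinearMap ∘ₗ comul (R := k) (A := H)))
    (by rw [split, split', mul_assoc, ← mul_assoc (WithConv.toConv (i₁.toLinearMap ∘ₗ _)), inv,
          one_mul, inv]) LinearMap.comul_right_inv
  exact congrArg (fun f ↦ f.ofConv h) key.symm

end HopfFacts

/-! ### Consequences of quasitriangularity -/

namespace IsQuasitriangular

variable {k H : Type*} [Field k] [Ring H] [HopfAlgebra k H] {R : (H ⊗[k] H)ˣ}

open Coalgebra HopfAlgebra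

local notation "Δ₁" => expandLeft k (Bialgebra.comulAlgHom k H)
local notation "Δ₂" => expandRight k (Bialgebra.comulAlgHom k H)

lemma expandLeft_eq (hR : IsQuasitriangular R) :
    Δ₁ (R : H ⊗[k] H) = leg13 k H R * leg23 k H R :=
  hR.comul_id

lemma expandRight_eq (hR : IsQuasitriangular R) :
    Δ₂ (R : H ⊗[k] H) = leg13 k H R * leg12 k H R :=
  hR.id_comul

lemma map_inv_eq {X Y : Type*} [Ring X] [Ring Y] [Algebra k X] [Algebra k Y]
    (f g h : X →ₐ[k] Y) (u : Xˣ) (e : f u = g u * h u) :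
    f (u⁻¹ : Xˣ) = h (u⁻¹ : Xˣ) * g (u⁻¹ : Xˣ) := by
  have : Units.map (f : X →* Y) u = Units.map (g : X →* Y) u * Units.map (h : X →* Y) u :=
    Units.ext e
  simpa using congrArg (fun v : Yˣ ↦ ((v⁻¹ : Yˣ) : Y)) this

lemma expandLeft_inv (hR : IsQuasitriangular R) :
    Δ₁ ((R⁻¹ : (H ⊗[k] H)ˣ) : H ⊗[k] H) =
      leg23 k H ((R⁻¹ : (H ⊗[k] H)ˣ) : H ⊗[k] H) * leg13 k H ((R⁻¹ : (H ⊗[k] H)ˣ) : H ⊗[k] H) :=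
  map_inv_eq Δ₁ (leg13 k H) (leg23 k H) R hR.expandLeft_eq

lemma expandRight_inv (hR : IsQuasitriangular R) :
    Δ₂ ((R⁻¹ : (H ⊗[k] H)ˣ) : H ⊗[k] H) =
      leg12 k H ((R⁻¹ : (H ⊗[k] H)ˣ) : H ⊗[k] H) * leg13 k H ((R⁻¹ : (H ⊗[k] H)ˣ) : H ⊗[k] H) :=
  map_inv_eq Δ₂ (leg13 k H) (leg12 k H) R hR.expandRight_eq

/-- The quantum Yang--Baxter equation. -/
lemma yangBaxter (hR : IsQuasitriangular R) :
    leg12 k H R * leg13 k H R * leg23 k H R =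
      leg23 k H R * leg13 k H R * leg12 k H (R : H ⊗[k] H) := by
  let sw : H ⊗[k] (H ⊗[k] H) →ₐ[k] H ⊗[k] (H ⊗[k] H) :=
    (Algebra.TensorProduct.leftComm k H H H).toAlgHom
  have h1 : ∀ x : H ⊗[k] H, sw (leg13 k H x) = leg23 k H x := fun x ↦ by
    induction x with
    | zero => simp
    | add x y hx hy => simp only [map_add, hx, hy]
    | tmul x y => simp [sw]
  have h2 : ∀ x : H ⊗[k] H, sw (leg23 k H x) = leg13 k H x := fun x ↦ by
    induction x with
    | zero => simp
    | add x y hx hy => simp only [map_add, hx, hy]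
    | tmul x y => simp [sw]
  -- Flipping the first two legs of (Δ ⊗ id)x is conjugation by R₁₂. For x = R, with (Δ ⊗ id)R =
  -- R₁₃R₂₃, this is the Yang-Baxter equation.
  have h3 : ∀ x : H ⊗[k] H, sw (Δ₁ x) * leg12 k H R = leg12 k H R * Δ₁ x := fun x ↦ by
    induction x with
    | zero => simp
    | add x y hx hy => simp only [map_add, add_mul, mul_add, hx, hy]
    | tmul x y =>
      have e1 : ∀ z : H ⊗[k] H, sw (TensorProduct.assoc k H H H (z ⊗ₜ y)) =
          leg12 k H (TensorProduct.comm k H H z) * (1 ⊗ₜ (1 ⊗ₜ y)) := fun z ↦ by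
        induction z with
        | zero => simp
        | add x y hx hy => simp only [map_add, add_mul, TensorProduct.add_tmul, hx, hy]
        | tmul z w => simp [sw]
      have e2 : ∀ z : H ⊗[k] H, TensorProduct.assoc k H H H (z ⊗ₜ y) =
          leg12 k H z * (1 ⊗ₜ (1 ⊗ₜ y)) := fun z ↦ by
        induction z with
        | zero => simp
        | add x y hx hy => simp only [map_add, add_mul, TensorProduct.add_tmul, hx, hy]
        | tmul z w => simp
      have e3 : ∀ z : H ⊗[k] H, (1 ⊗ₜ (1 ⊗ₜ y)) * leg12 k H z = leg12 k H z * (1 ⊗ₜ (1 ⊗ₜ y)) :=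
        fun z ↦ by
        induction z with
        | zero => simp
        | add x y hx hy => simp only [map_add, add_mul, mul_add, hx, hy]
        | tmul z w => simp
      rw [expandLeft_tmul, e1, e2, Bialgebra.comulAlgHom_apply, hR.comm_comul, mul_assoc, e3,
        ← mul_assoc, ← map_mul, mul_assoc, Units.inv_mul, mul_one, ← mul_assoc, map_mul]
  have := h3 R
  rw [hR.expandLeft_eq, map_mul, h1, h2] at this
  rw [this, mul_assoc]

/-- Applying ε to the first leg of (Δ ⊗ id)R = R₁₃R₂₃ gives R = (1 ⊗ (ε ⊗ id)R) R, and R is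
invertible. -/
lemma counit_left (hR : IsQuasitriangular R) :
    TensorProduct.lid k H ((counit (R := k) (A := H)).rTensor H (R : H ⊗[k] H)) = 1 := by
  let f : H ⊗[k] (H ⊗[k] H) →ₐ[k] H ⊗[k] H :=
    (Algebra.TensorProduct.lid k (H ⊗[k] H)).toAlgHom.comp
      (Algebra.TensorProduct.map (Bialgebra.counitAlgHom k H) (AlgHom.id k _))
  have h1 : ∀ x : H ⊗[k] H, f (Δ₁ x) = x := fun x ↦ by
    induction x with
    | zero => simp
    | add x y hx hy => simp only [map_add, hx, hy]
    | tmul x y =>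
      have : ∀ z : H ⊗[k] H, f (TensorProduct.assoc k H H H (z ⊗ₜ y)) =
          (TensorProduct.lid k H ((counit (R := k) (A := H)).rTensor H z)) ⊗ₜ y := fun z ↦ by
        induction z with
        | zero => simp
        | add x y hx hy => simp only [map_add, TensorProduct.add_tmul, hx, hy]
        | tmul z w => simp [f, TensorProduct.smul_tmul']
      rw [expandLeft_tmul, this]
      simp
  have h2 : ∀ x : H ⊗[k] H, f (leg23 k H x) = x := fun x ↦ by simp [f]
  have h3 : ∀ x : H ⊗[k] H, f (leg13 k H x) =
      1 ⊗ₜ (TensorProduct.lid k H ((counit (R := k) (A := H)).rTensor H x)) := fun x ↦ by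
    induction x with
    | zero => simp
    | add x y hx hy => simp only [map_add, TensorProduct.tmul_add, hx, hy]
    | tmul x y => simp [f]
  have := congrArg f hR.expandLeft_eq
  rw [map_mul, h1, h2, h3] at this
  have h4 := congrArg (fun z ↦ z * ((R⁻¹ : (H ⊗[k] H)ˣ) : H ⊗[k] H)) this
  simp only [mul_assoc, Units.mul_inv, mul_one] at h4
  have h5 := congrArg (fun z ↦ TensorProduct.lid k H ((counit (R := k) (A := H)).rTensor H z)) h4
  simpa [Algebra.TensorProduct.one_def] using h5.symm

lemma counit_right (hR : IsQuasitriangular R) :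
    TensorProduct.rid k H ((counit (R := k) (A := H)).lTensor H (R : H ⊗[k] H)) = 1 := by
  let f : H ⊗[k] (H ⊗[k] H) →ₐ[k] H ⊗[k] H :=
    Algebra.TensorProduct.map (AlgHom.id k H)
      ((Algebra.TensorProduct.lid k H).toAlgHom.comp
        (Algebra.TensorProduct.map (Bialgebra.counitAlgHom k H) (AlgHom.id k _)))
  have h1 : ∀ x : H ⊗[k] H, f (Δ₂ x) = x := fun x ↦ by
    induction x with
    | zero => simp
    | add x y hx hy => simp only [map_add, hx, hy]
    | tmul x y =>
      have : ∀ z : H ⊗[k] H, f (x ⊗ₜ z) =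
          x ⊗ₜ (TensorProduct.lid k H ((counit (R := k) (A := H)).rTensor H z)) := fun z ↦ by
        induction z with
        | zero => simp
        | add x y hx hy => simp only [map_add, TensorProduct.tmul_add, hx, hy]
        | tmul z w => simp [f]
      rw [expandRight_tmul, this]
      simp
  have h2 : ∀ x : H ⊗[k] H, f (leg13 k H x) = x := fun x ↦ by
    induction x with
    | zero => simp
    | add x y hx hy => simp only [map_add, hx, hy]
    | tmul x y => simp [f]
  have h3 : ∀ x : H ⊗[k] H, f (leg12 k H x) =
      (TensorProduct.rid k H ((counit (R := k) (A := H)).lTensor H x)) ⊗ₜ 1 := fun x ↦ by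
    induction x with
    | zero => simp
    | add x y hx hy => simp only [map_add, TensorProduct.add_tmul, hx, hy]
    | tmul x y => simp [f, TensorProduct.smul_tmul']
  have := congrArg f hR.expandRight_eq
  rw [map_mul, h1, h2, h3] at this
  have h4 := congrArg (fun z ↦ ((R⁻¹ : (H ⊗[k] H)ˣ) : H ⊗[k] H) * z) this
  simp only [← mul_assoc, Units.inv_mul, one_mul] at h4
  have h5 := congrArg (fun z ↦ TensorProduct.rid k H ((counit (R := k) (A := H)).lTensor H z)) h4
  simpa [Algebra.TensorProduct.one_def] using h5.symm

lemma counit_left_inv (hR : IsQuasitriangular R) :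
    TensorProduct.lid k H ((counit (R := k) (A := H)).rTensor H
      ((R⁻¹ : (H ⊗[k] H)ˣ) : H ⊗[k] H)) = 1 := by
  let f : H ⊗[k] H →ₐ[k] H := (Algebra.TensorProduct.lid k H).toAlgHom.comp
    (Algebra.TensorProduct.map (Bialgebra.counitAlgHom k H) (AlgHom.id k H))
  have h1 : f R = 1 := hR.counit_left
  have h2 := congrArg f (Units.inv_mul R)
  rw [map_mul, h1, mul_one, map_one] at h2
  exact h2

lemma counit_right_inv (hR : IsQuasitriangular R) :
    TensorProduct.rid k H ((counit (R := k) (A := H)).lTensor H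
      ((R⁻¹ : (H ⊗[k] H)ˣ) : H ⊗[k] H)) = 1 := by
  let f : H ⊗[k] H →ₐ[k] H := (Algebra.TensorProduct.rid k k H).toAlgHom.comp
    (Algebra.TensorProduct.map (AlgHom.id k H) (Bialgebra.counitAlgHom k H))
  have h1 : f R = 1 := hR.counit_right
  have h2 := congrArg f (Units.inv_mul R)
  rw [map_mul, h1, mul_one, map_one] at h2
  exact h2

section Sums

variable {ι κ : Type*} [Fintype ι] [Fintype κ] {r r' : ι → H} {s s' : κ → H}

lemma sum_counit_left (hR : IsQuasitriangular R) (hr : (R : H ⊗[k] H) = ∑ i, r i ⊗ₜ[k] r' i) :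
    ∑ i, counit (R := k) (r i) • r' i = 1 := by
  simpa [hr] using hR.counit_left

lemma sum_counit_right (hR : IsQuasitriangular R) (hr : (R : H ⊗[k] H) = ∑ i, r i ⊗ₜ[k] r' i) :
    ∑ i, counit (R := k) (r' i) • r i = 1 := by
  simpa [hr] using hR.counit_right

lemma sum_inv_counit_left (hR : IsQuasitriangular R)
    (hs : ((R⁻¹ : (H ⊗[k] H)ˣ) : H ⊗[k] H) = ∑ i, s i ⊗ₜ[k] s' i) :
    ∑ i, counit (R := k) (s i) • s' i = 1 := by
  simpa [hs] using hR.counit_left_inv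

lemma sum_inv_counit_right (hR : IsQuasitriangular R)
    (hs : ((R⁻¹ : (H ⊗[k] H)ˣ) : H ⊗[k] H) = ∑ i, s i ⊗ₜ[k] s' i) :
    ∑ i, counit (R := k) (s' i) • s i = 1 := by
  simpa [hs] using hR.counit_right_inv

/-- The quasitriangularity axioms are put in the form of finite sums so that applying a linear map
on H ⊗ H ⊗ H to both sides, by `congrArg`, yields the Sweedler identities needed later. -/
lemma sum_expandLeft (hR : IsQuasitriangular R) (hr : (R : H ⊗[k] H) = ∑ i, r i ⊗ₜ[k] r' i) :
    ∑ i, TensorProduct.assoc k H H H (comul (R := k) (r i) ⊗ₜ r' i) =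
      ∑ i, ∑ j, r i ⊗ₜ[k] (r j ⊗ₜ[k] (r' i * r' j)) := by
  simpa [hr, expandLeft_tmul, Finset.sum_mul_sum, TensorProduct.tmul_sum] using hR.expandLeft_eq

lemma sum_expandRight (hR : IsQuasitriangular R) (hr : (R : H ⊗[k] H) = ∑ i, r i ⊗ₜ[k] r' i) :
    ∑ i, r i ⊗ₜ[k] comul (R := k) (r' i) =
      ∑ i, ∑ j, (r i * r j) ⊗ₜ[k] (r' j ⊗ₜ[k] r' i) := by
  simpa [hr, Finset.sum_mul_sum] using hR.expandRight_eq

lemma sum_expandLeft_inv (hR : IsQuasitriangular R)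
    (hs : ((R⁻¹ : (H ⊗[k] H)ˣ) : H ⊗[k] H) = ∑ i, s i ⊗ₜ[k] s' i) :
    ∑ i, TensorProduct.assoc k H H H (comul (R := k) (s i) ⊗ₜ s' i) =
      ∑ j, ∑ i, s i ⊗ₜ[k] (s j ⊗ₜ[k] (s' j * s' i)) := by
  simpa [hs, expandLeft_tmul, Finset.sum_mul_sum, TensorProduct.tmul_sum] using hR.expandLeft_inv

lemma sum_expandRight_inv (hR : IsQuasitriangular R)
    (hs : ((R⁻¹ : (H ⊗[k] H)ˣ) : H ⊗[k] H) = ∑ i, s i ⊗ₜ[k] s' i) :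
    ∑ i, s i ⊗ₜ[k] comul (R := k) (s' i) =
      ∑ i, ∑ j, (s i * s j) ⊗ₜ[k] (s' i ⊗ₜ[k] s' j) := by
  simpa [hs, Finset.sum_mul_sum] using hR.expandRight_inv

/-- Obtained from (id ⊗ Δ)R by contracting the last two legs with S ⊗ id. It says that (id ⊗ S)R is
a right inverse of R in H ⊗ Hᵒᵖ, and serves the antipode axiom on B. -/
lemma sum_antipode_mul (hR : IsQuasitriangular R)
    (hr : (R : H ⊗[k] H) = ∑ i, r i ⊗ₜ[k] r' i) :
    ∑ i, ∑ j, (r i * r j) ⊗ₜ[k] (antipode k (r' j) * r' i) = 1 := by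
  have h := congrArg ((LinearMap.mul' k H ∘ₗ (antipode k).rTensor H).lTensor H)
    (hR.sum_expandRight hr)
  simp only [map_sum, LinearMap.lTensor_tmul, LinearMap.comp_apply, LinearMap.rTensor_tmul,
    LinearMap.mul'_apply, mul_antipode_rTensor_comul_apply] at h
  rw [← h]
  calc _ = (∑ i, counit (R := k) (r' i) • r i) ⊗ₜ[k] (1 : H) := by
        simp [Algebra.algebraMap_eq_smul_one, TensorProduct.smul_tmul', TensorProduct.sum_tmul]
    _ = 1 := by rw [hR.sum_counit_right hr, Algebra.TensorProduct.one_def]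

/-- The counterpart for R⁻¹, from contracting the first two legs of (Δ ⊗ id)R⁻¹ with id ⊗ S; it
serves the antipode axiom on D. -/
lemma sum_mul_antipode_inv (hR : IsQuasitriangular R)
    (hs : ((R⁻¹ : (H ⊗[k] H)ˣ) : H ⊗[k] H) = ∑ i, s i ⊗ₜ[k] s' i) :
    ∑ j, ∑ i, (s i * antipode k (s j)) ⊗ₜ[k] (s' j * s' i) = 1 := by
  have h := congrArg ((LinearMap.mul' k H ∘ₗ (antipode k).lTensor H).rTensor H ∘ₗ
    (TensorProduct.assoc k H H H).symm.toLinearMap) (hR.sum_expandLeft_inv hs)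
  simp only [map_sum, LinearMap.rTensor_tmul, LinearMap.comp_apply, LinearMap.lTensor_tmul,
    LinearEquiv.coe_coe, TensorProduct.assoc_symm_tmul, LinearEquiv.symm_apply_apply,
    LinearMap.mul'_apply, mul_antipode_lTensor_comul_apply] at h
  rw [← h]
  calc _ = (1 : H) ⊗ₜ[k] (∑ i, counit (R := k) (s i) • s' i) := by
        simp [Algebra.algebraMap_eq_smul_one, TensorProduct.smul_tmul, TensorProduct.tmul_sum]
    _ = 1 := by rw [hR.sum_inv_counit_left hs, Algebra.TensorProduct.one_def]

end Sums

end IsQuasitriangular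

/-! ### Twisting the product of a bialgebra by a two-cocycle -/

section Convolution

open WithConv Coalgebra

variable {k C X Y : Type*} [Field k] [AddCommGroup C] [Module k C] [Coalgebra k C]
  [Ring X] [Algebra k X] [Ring Y] [Algebra k Y]

/-- A scalar-valued linear map on a coalgebra, with values viewed in an algebra. -/
def scalarConv (X : Type*) [Ring X] [Algebra k X] (f : C →ₗ[k] k) : WithConv (C →ₗ[k] X) :=
  toConv (Algebra.linearMap k X ∘ₗ f)

/-- A scalar-valued convolution factor passes through any linear map, multiplicative or not. This
makes calculations with twisted products formal. -/
lemma toConv_comp_mul_scalarConv (L : X →ₗ[k] Y) (g : WithConv (C →ₗ[k] X)) (f : C →ₗ[k] k) :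
    toConv (L ∘ₗ (g * scalarConv X f).ofConv) = toConv (L ∘ₗ g.ofConv) * scalarConv Y f := by
  ext c
  rw [(ℛ k c).convMul_apply]
  change L ((g * scalarConv X f) c) = _
  rw [(ℛ k c).convMul_apply]
  simp [scalarConv, Algebra.algebraMap_eq_smul_one]

lemma toConv_comp_scalarConv_mul (L : X →ₗ[k] Y) (g : WithConv (C →ₗ[k] X)) (f : C →ₗ[k] k) :
    toConv (L ∘ₗ (scalarConv X f * g).ofConv) = scalarConv Y f * toConv (L ∘ₗ g.ofConv) := by
  ext c
  rw [(ℛ k c).convMul_apply]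
  change L ((scalarConv X f * g) c) = _
  rw [(ℛ k c).convMul_apply]
  simp [scalarConv, Algebra.algebraMap_eq_smul_one]

lemma scalarConv_mul (f g : WithConv (C →ₗ[k] k)) :
    scalarConv X (f * g).ofConv = scalarConv X f.ofConv * scalarConv X g.ofConv :=
  WithConv.ext (LinearMap.algHom_comp_convMul_distrib (Algebra.ofId k X) f g)

lemma scalarConv_one : scalarConv X (1 : WithConv (C →ₗ[k] k)).ofConv = 1 := rfl

lemma scalarConv_self (f : C →ₗ[k] k) : scalarConv k f = toConv f := rfl

/-- `(g ⊗ g) ∘ Δ` as a convolution product. -/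
lemma toConv_map_comp_comul (g : C →ₗ[k] X) :
    toConv (TensorProduct.map g g ∘ₗ comul (R := k) (A := C)) =
      toConv ((Algebra.TensorProduct.includeLeft : X →ₐ[k] X ⊗[k] X).toLinearMap ∘ₗ g) *
        toConv ((Algebra.TensorProduct.includeRight : X →ₐ[k] X ⊗[k] X).toLinearMap ∘ₗ g) := by
  ext c
  rw [(ℛ k c).convMul_apply]
  simp [← (ℛ k c).eq]

end Convolution

section Twist

open WithConv Coalgebra

variable {k U : Type*} [Field k] [Ring U] [Bialgebra k U]

/-- The product `u ⊗ v ↦ σ(u₍₁₎, v₍₁₎) u₍₂₎ v₍₂₎ σ'(u₍₃₎, v₍₃₎)`. -/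
def twistMul (σ σ' : U ⊗[k] U →ₗ[k] k) : U ⊗[k] U →ₗ[k] U :=
  (scalarConv U σ * toConv (LinearMap.mul' k U) * scalarConv U σ').ofConv

variable (k U) in
/-- `u ⊗ v ⊗ w ↦ u ⊗ v ε(w)`. -/
def dropRight : U ⊗[k] (U ⊗[k] U) →ₗc[k] U ⊗[k] U :=
  Coalgebra.TensorProduct.map (CoalgHom.id k U)
    ((Coalgebra.TensorProduct.rid k k U).toCoalgHom.comp
      (Coalgebra.TensorProduct.map (CoalgHom.id k U) (Coalgebra.counitCoalgHom k U)))

variable (k U) in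
/-- `u ⊗ v ⊗ w ↦ ε(u) v ⊗ w`. -/
def dropLeft : U ⊗[k] (U ⊗[k] U) →ₗc[k] U ⊗[k] U :=
  (Coalgebra.TensorProduct.lid k (U ⊗[k] U)).toCoalgHom.comp
    (Coalgebra.TensorProduct.map (Coalgebra.counitCoalgHom k U) (CoalgHom.id k (U ⊗[k] U)))

/-- `u ⊗ v ⊗ w ↦ m(u ⊗ v) ⊗ w`. -/
def applyLeft (m : U ⊗[k] U →ₗc[k] U) : U ⊗[k] (U ⊗[k] U) →ₗc[k] U ⊗[k] U :=
  (Coalgebra.TensorProduct.map m (CoalgHom.id k U)).comp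
    (Coalgebra.TensorProduct.assoc k k U U U).symm.toCoalgHom

/-- `u ⊗ v ⊗ w ↦ u ⊗ m(v ⊗ w)`. -/
def applyRight (m : U ⊗[k] U →ₗc[k] U) : U ⊗[k] (U ⊗[k] U) →ₗc[k] U ⊗[k] U :=
  Coalgebra.TensorProduct.map (CoalgHom.id k U) m

@[simp] lemma dropRight_tmul (u v w : U) :
    dropRight k U (u ⊗ₜ (v ⊗ₜ w)) = counit (R := k) w • u ⊗ₜ v := by
  simp [dropRight]

@[simp] lemma dropLeft_tmul (u : U) (v : U ⊗[k] U) :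
    dropLeft k U (u ⊗ₜ v) = counit (R := k) u • v := by
  simp [dropLeft]

@[simp] lemma applyLeft_tmul (m : U ⊗[k] U →ₗc[k] U) (u v w : U) :
    applyLeft m (u ⊗ₜ (v ⊗ₜ w)) = m (u ⊗ₜ v) ⊗ₜ w := rfl

@[simp] lemma applyRight_tmul (m : U ⊗[k] U →ₗc[k] U) (u : U) (v : U ⊗[k] U) :
    applyRight m (u ⊗ₜ v) = u ⊗ₜ m v := rfl

/-- `σ` is a normalised two-cocycle with convolution inverse `σ'`. -/
structure IsTwoCocycle (σ σ' : U ⊗[k] U →ₗ[k] k) : Prop where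
  mul_inv : toConv σ * toConv σ' = 1
  inv_mul : toConv σ' * toConv σ = 1
  cocycle : toConv (σ ∘ₗ (dropRight k U).toLinearMap) *
      toConv (σ ∘ₗ (applyLeft (Bialgebra.mulCoalgHom k U)).toLinearMap) =
    toConv (σ ∘ₗ (dropLeft k U).toLinearMap) *
      toConv (σ ∘ₗ (applyRight (Bialgebra.mulCoalgHom k U)).toLinearMap)

namespace IsTwoCocycle

variable {σ σ' : U ⊗[k] U →ₗ[k] k}

lemma scalar_inv_mul (hσ : IsTwoCocycle σ σ') {X : Type*} [Ring X] [Algebra k X] :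
    scalarConv X σ' * scalarConv X σ = 1 := by
  rw [← scalarConv_one, ← hσ.inv_mul, scalarConv_mul]

/-- The twisted product is a morphism of coalgebras. -/
def twistMulHom (hσ : IsTwoCocycle σ σ') : U ⊗[k] U →ₗc[k] U where
  toLinearMap := twistMul σ σ'
  counit_comp := by
    apply toConv_injective
    rw [twistMul, toConv_comp_mul_scalarConv, toConv_comp_scalarConv_mul]
    have : toConv (counit (R := k) ∘ₗ (toConv (LinearMap.mul' k U)).ofConv) = 1 := by
      apply WithConv.ext
      ext a b
      simp [LinearMap.convOne_def, mul_comm]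
    rw [this, mul_one, scalarConv_self, scalarConv_self, hσ.mul_inv]
    rfl
  map_comp_comul := by
    apply toConv_injective
    rw [toConv_map_comp_comul]
    conv_rhs => rw [twistMul, toConv_comp_mul_scalarConv, toConv_comp_scalarConv_mul]
    have : comul (R := k) ∘ₗ (toConv (LinearMap.mul' k U)).ofConv =
        TensorProduct.map (LinearMap.mul' k U) (LinearMap.mul' k U) ∘ₗ
          comul (R := k) (A := U ⊗[k] U) :=
      (Bialgebra.mulCoalgHom k U).map_comp_comul.symm
    rw [this, toConv_map_comp_comul, twistMul]
    simp only [toConv_comp_mul_scalarConv, toConv_comp_scalarConv_mul]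
    simp only [mul_assoc]
    -- The σ' closing the first leg of the coproduct stands next to the σ opening the second leg,
    -- and the two cancel.
    rw [← mul_assoc (scalarConv _ σ') (scalarConv _ σ), hσ.scalar_inv_mul, one_mul]

lemma comp_toConv_mul {C E X : Type*} [AddCommGroup C] [Module k C] [Coalgebra k C]
    [AddCommGroup E] [Module k E] [Coalgebra k E] [Ring X] [Algebra k X]
    (f g : WithConv (C →ₗ[k] X)) (h : E →ₗc[k] C) :
    toConv ((f * g).ofConv ∘ₗ h.toLinearMap) =
      toConv (f.ofConv ∘ₗ h.toLinearMap) * toConv (g.ofConv ∘ₗ h.toLinearMap) :=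
  WithConv.ext (LinearMap.convMul_comp_coalgHom_distrib f g h)

/-- Convolution of tensor products of maps is computed factor by factor, so (σ * m * σ') ⊗ id is the
convolution of σ ⊗ 1, m ⊗ id and σ' ⊗ 1. The convolution unit 1 applies the counit to the third
argument, which is the effect of `dropRight`. -/
lemma toConv_applyLeft (hσ : IsTwoCocycle σ σ') :
    toConv (applyLeft hσ.twistMulHom).toLinearMap =
      scalarConv _ (σ ∘ₗ (dropRight k U).toLinearMap) *
        toConv (applyLeft (Bialgebra.mulCoalgHom k U)).toLinearMap *
        scalarConv _ (σ' ∘ₗ (dropRight k U).toLinearMap) := by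
  let g : U ⊗[k] (U ⊗[k] U) →ₗc[k] (U ⊗[k] U) ⊗[k] U :=
    (Coalgebra.TensorProduct.assoc k k U U U).symm.toCoalgHom
  have sc (f : U ⊗[k] U →ₗ[k] k) : scalarConv (U ⊗[k] U) (f ∘ₗ (dropRight k U).toLinearMap) =
      toConv ((toConv (TensorProduct.map (scalarConv U f).ofConv
        (1 : WithConv (U →ₗ[k] U)).ofConv)).ofConv ∘ₗ g.toLinearMap) := by
    apply WithConv.ext
    ext a b c
    have hg : g (a ⊗ₜ (b ⊗ₜ c)) = (a ⊗ₜ b) ⊗ₜ c := rfl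
    simp [scalarConv, LinearMap.convOne_def, hg, Algebra.algebraMap_eq_smul_one,
      ← TensorProduct.smul_tmul', TensorProduct.tmul_smul, Algebra.TensorProduct.one_def,
      smul_smul, mul_comm]
  have mid : toConv (applyLeft (Bialgebra.mulCoalgHom k U)).toLinearMap =
      toConv ((toConv (TensorProduct.map (toConv (LinearMap.mul' k U)).ofConv
        (toConv (LinearMap.id : U →ₗ[k] U)).ofConv)).ofConv ∘ₗ g.toLinearMap) := rfl
  rw [sc, sc, mid, ← comp_toConv_mul, ← comp_toConv_mul, TensorProduct.map_convMul_map,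
    TensorProduct.map_convMul_map, one_mul, mul_one]
  rfl

lemma toConv_applyRight (hσ : IsTwoCocycle σ σ') :
    toConv (applyRight hσ.twistMulHom).toLinearMap =
      scalarConv _ (σ ∘ₗ (dropLeft k U).toLinearMap) *
        toConv (applyRight (Bialgebra.mulCoalgHom k U)).toLinearMap *
        scalarConv _ (σ' ∘ₗ (dropLeft k U).toLinearMap) := by
  have sc (f : U ⊗[k] U →ₗ[k] k) : scalarConv (U ⊗[k] U) (f ∘ₗ (dropLeft k U).toLinearMap) =
      toConv (TensorProduct.map (1 : WithConv (U →ₗ[k] U)).ofConv (scalarConv U f).ofConv) := by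
    apply WithConv.ext
    ext a b c
    simp [scalarConv, LinearMap.convOne_def, Algebra.algebraMap_eq_smul_one,
      ← TensorProduct.smul_tmul', TensorProduct.tmul_smul, Algebra.TensorProduct.one_def,
      smul_smul, mul_comm]
  have mid : toConv (applyRight (Bialgebra.mulCoalgHom k U)).toLinearMap =
      toConv (TensorProduct.map (toConv (LinearMap.id : U →ₗ[k] U)).ofConv
        (toConv (LinearMap.mul' k U)).ofConv) := rfl
  rw [sc, sc, mid, TensorProduct.map_convMul_map, TensorProduct.map_convMul_map, one_mul, mul_one]
  rfl

/-- Pulling each of σ, the product and σ' back along h gives a * (pullback along m) * a'. In the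
convolution of the three the inner pairs a' * a cancel, and only the outermost a and a' remain. -/
lemma twistMul_comp {h m : U ⊗[k] (U ⊗[k] U) →ₗc[k] U ⊗[k] U}
    {a a' : U ⊗[k] (U ⊗[k] U) →ₗ[k] k} (inv : toConv a' * toConv a = 1)
    (e : toConv h.toLinearMap = scalarConv _ a * toConv m.toLinearMap * scalarConv _ a') :
    toConv (twistMul σ σ' ∘ₗ h.toLinearMap) =
      scalarConv U (toConv a * toConv (σ ∘ₗ m.toLinearMap)).ofConv *
        toConv (LinearMap.mul' k U ∘ₗ m.toLinearMap) *
        scalarConv U (toConv (σ' ∘ₗ m.toLinearMap) * toConv a').ofConv := by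
  have key {Z : Type _} [Ring Z] [Algebra k Z] (L : U ⊗[k] U →ₗ[k] Z) :
      toConv (L ∘ₗ h.toLinearMap) =
        scalarConv _ a * toConv (L ∘ₗ m.toLinearMap) * scalarConv _ a' := by
    have := congrArg (fun f ↦ toConv (L ∘ₗ f.ofConv)) e
    simpa only [toConv_comp_mul_scalarConv, toConv_comp_scalarConv_mul, ofConv_toConv] using this
  have inv' : scalarConv U a' * scalarConv U a = 1 := by
    rw [← scalarConv_one, ← inv, scalarConv_mul]
  have sc (f : U ⊗[k] U →ₗ[k] k) : toConv ((scalarConv U f).ofConv ∘ₗ h.toLinearMap) =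
      scalarConv U a * scalarConv U (f ∘ₗ m.toLinearMap) * scalarConv U a' :=
    key (Algebra.linearMap k U ∘ₗ f)
  rw [twistMul, comp_toConv_mul, comp_toConv_mul, sc, sc, ofConv_toConv, key,
    scalarConv_mul, scalarConv_mul]
  simp only [mul_assoc]
  rw [← mul_assoc (scalarConv U a') (scalarConv U a), inv', one_mul,
    ← mul_assoc (scalarConv U a') (scalarConv U a), inv', one_mul]

/-- Either bracketing has the form X * (triple product) * Y with scalar-valued X and Y. The cocycle
condition identifies the two X, and each Y is the convolution inverse of its X, so the Y agree as
well. -/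
lemma twistMul_assoc (hσ : IsTwoCocycle σ σ') (a b c : U) :
    twistMul σ σ' (twistMul σ σ' (a ⊗ₜ b) ⊗ₜ c) = twistMul σ σ' (a ⊗ₜ twistMul σ σ' (b ⊗ₜ c)) := by
  have inv (d : U ⊗[k] (U ⊗[k] U) →ₗc[k] U ⊗[k] U) :
      toConv (σ ∘ₗ d.toLinearMap) * toConv (σ' ∘ₗ d.toLinearMap) = 1 ∧
      toConv (σ' ∘ₗ d.toLinearMap) * toConv (σ ∘ₗ d.toLinearMap) = 1 := by
    have one : toConv ((1 : WithConv (U ⊗[k] U →ₗ[k] k)).ofConv ∘ₗ d.toLinearMap) = 1 := by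
      apply WithConv.ext
      rw [LinearMap.convOne_def, LinearMap.convOne_def]
      simp
    constructor
    · have := comp_toConv_mul (toConv σ) (toConv σ') d
      rwa [hσ.mul_inv, one, eq_comm] at this
    · have := comp_toConv_mul (toConv σ') (toConv σ) d
      rwa [hσ.inv_mul, one, eq_comm] at this
  have h1 := twistMul_comp (σ := σ) (σ' := σ') (inv (dropRight k U)).2 hσ.toConv_applyLeft
  have h2 := twistMul_comp (σ := σ) (σ' := σ') (inv (dropLeft k U)).2 hσ.toConv_applyRight
  have hinv : toConv (σ' ∘ₗ (applyLeft (Bialgebra.mulCoalgHom k U)).toLinearMap) *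
      toConv (σ' ∘ₗ (dropRight k U).toLinearMap) =
      toConv (σ' ∘ₗ (applyRight (Bialgebra.mulCoalgHom k U)).toLinearMap) *
      toConv (σ' ∘ₗ (dropLeft k U).toLinearMap) := by
    apply left_inv_eq_right_inv (a := toConv (σ ∘ₗ (dropRight k U).toLinearMap) *
      toConv (σ ∘ₗ (applyLeft (Bialgebra.mulCoalgHom k U)).toLinearMap))
    · rw [mul_assoc, ← mul_assoc _ _ (toConv (σ ∘ₗ (applyLeft _).toLinearMap)), (inv _).2, one_mul,
        (inv _).2]
    · rw [hσ.cocycle, mul_assoc, ← mul_assoc _ _ (toConv (σ' ∘ₗ (dropLeft _ _).toLinearMap)),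
        (inv _).1, one_mul, (inv _).1]
  have hmul : LinearMap.mul' k U ∘ₗ (applyLeft (Bialgebra.mulCoalgHom k U)).toLinearMap =
      LinearMap.mul' k U ∘ₗ (applyRight (Bialgebra.mulCoalgHom k U)).toLinearMap := by
    ext a b c
    simp [mul_assoc]
  rw [hσ.cocycle, hinv, hmul, ← h2] at h1
  exact congrArg (fun f ↦ f.ofConv (a ⊗ₜ (b ⊗ₜ c))) h1

lemma comul_twistMul (hσ : IsTwoCocycle σ σ') (z : U ⊗[k] U) :
    comul (R := k) (twistMul σ σ' z) =
      TensorProduct.map (twistMul σ σ') (twistMul σ σ') (comul (R := k) z) :=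
  (LinearMap.congr_fun hσ.twistMulHom.map_comp_comul z).symm

lemma counit_twistMul (hσ : IsTwoCocycle σ σ') (a b : U) :
    counit (R := k) (twistMul σ σ' (a ⊗ₜ b)) = counit (R := k) a * counit (R := k) b :=
  (LinearMap.congr_fun hσ.twistMulHom.counit_comp (a ⊗ₜ b)).trans (by simp [mul_comm])

end IsTwoCocycle

end Twist

/-! ### Algebras with a triangular decomposition -/

section TripleMap

variable {k H B D U : Type*} [Field k] [Ring H] [Algebra k H] [Ring B] [Algebra k B]
  [Ring D] [Algebra k D] [Ring U] [Algebra k U]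

/-- `c ⊗ h ⊗ b ↦ c h b`. -/
def tripleMap (iD : D →ₗ[k] U) (iH : H →ₗ[k] U) (iB : B →ₗ[k] U) : D ⊗[k] (H ⊗[k] B) →ₗ[k] U :=
  LinearMap.mul' k U ∘ₗ TensorProduct.map iD (LinearMap.mul' k U ∘ₗ TensorProduct.map iH iB)

@[simp] lemma tripleMap_tmul (iD : D →ₗ[k] U) (iH : H →ₗ[k] U) (iB : B →ₗ[k] U)
    (d : D) (h : H) (b : B) :
    tripleMap iD iH iB (d ⊗ₜ (h ⊗ₜ b)) = iD d * (iH h * iB b) := rfl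

lemma algHom_ext_of_tripleMap {iD : D →ₐ[k] U} {iH : H →ₐ[k] U} {iB : B →ₐ[k] U}
    {X : Type*} [Ring X] [Algebra k X]
    (surj : Function.Surjective (tripleMap iD.toLinearMap iH.toLinearMap iB.toLinearMap))
    {f g : U →ₐ[k] X} (hD : ∀ d, f (iD d) = g (iD d)) (hH : ∀ h, f (iH h) = g (iH h))
    (hB : ∀ b, f (iB b) = g (iB b)) : f = g := by
  ext u
  obtain ⟨x, rfl⟩ := surj u
  induction x with
  | zero => simp
  | add x y hx hy => simp only [map_add, hx, hy]
  | tmul d x =>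
    induction x with
    | zero => simp
    | add x y hx hy => simp only [map_add, TensorProduct.tmul_add, hx, hy]
    | tmul h b => simp [hD, hH, hB]

end TripleMap

section Triple

open Coalgebra MulOpposite

variable {k H B D U : Type*} [Field k] [Ring H] [HopfAlgebra k H]
  [Ring B] [Algebra k B] [Module Hᵐᵒᵖ B] [IsScalarTower k Hᵐᵒᵖ B]
  [Ring D] [Algebra k D] [Module H D] [IsScalarTower k H D]
  [Ring U] [Algebra k U]

@[simp] lemma leftAct_apply (h : H) (d : D) : leftAct k H D h d = h • d := rfl
@[simp] lemma rightAct_apply (h : H) (b : B) : rightAct k H B h b = op h • b := rfl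
@[simp] lemma tensorAct_tmul {V W : Type*} [AddCommGroup V] [Module k V] [AddCommGroup W]
    [Module k W] (ρ : H →ₗ[k] V →ₗ[k] V) (σ : H →ₗ[k] W →ₗ[k] W) (h g : H) (v : V) (w : W) :
    tensorAct ρ σ (h ⊗ₜ g) (v ⊗ₜ w) = ρ h v ⊗ₜ σ g w := rfl

@[simp] lemma middle_tmul {M N P Q N' P' : Type*}
    [AddCommGroup M] [Module k M] [AddCommGroup N] [Module k N]
    [AddCommGroup P] [Module k P] [AddCommGroup Q] [Module k Q]
    [AddCommGroup N'] [Module k N'] [AddCommGroup P'] [Module k P']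
    (f : N ⊗[k] P →ₗ[k] P' ⊗[k] N') (m : M) (n : N) (p : P) (q : Q) :
    middle f ((m ⊗ₜ n) ⊗ₜ (p ⊗ₜ q)) = (TensorProduct.assoc k M P' (N' ⊗[k] Q)).symm
      (m ⊗ₜ TensorProduct.assoc k P' N' Q (f (n ⊗ₜ p) ⊗ₜ q)) := rfl

/-- `x ⊗ y ↦ (x ▷ d) y`. -/
def pushLeft (iD : D →ₗ[k] U) (iH : H →ₗ[k] U) (d : D) : H ⊗[k] H →ₗ[k] U :=
  LinearMap.mul' k U ∘ₗ TensorProduct.map (iD ∘ₗ (leftAct k H D).flip d) iH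

/-- `x ⊗ y ↦ x (b ◁ y)`. -/
def pushRight (iH : H →ₗ[k] U) (iB : B →ₗ[k] U) (b : B) : H ⊗[k] H →ₗ[k] U :=
  LinearMap.mul' k U ∘ₗ TensorProduct.map iH (iB ∘ₗ (rightAct k H B).flip b)

@[simp] lemma pushLeft_tmul (iD : D →ₗ[k] U) (iH : H →ₗ[k] U) (d : D) (x y : H) :
    pushLeft iD iH d (x ⊗ₜ y) = iD (x • d) * iH y := rfl
@[simp] lemma pushRight_tmul (iH : H →ₗ[k] U) (iB : B →ₗ[k] U) (b : B) (x y : H) :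
    pushRight iH iB b (x ⊗ₜ y) = iH x * iB (op y • b) := rfl

/-- The relations `h d = (h₍₁₎ ▷ d) h₍₂₎`, `b h = h₍₁₎ (b ◁ h₍₂₎)` and `b d = d b`. -/
structure IsCrossedTriple (iD : D →ₐ[k] U) (iH : H →ₐ[k] U) (iB : B →ₐ[k] U) : Prop where
  hd : ∀ h d, iH h * iD d = pushLeft iD.toLinearMap iH.toLinearMap d (comul (R := k) h)
  bh : ∀ b h, iB b * iH h = pushRight iH.toLinearMap iB.toLinearMap b (comul (R := k) h)
  bd : ∀ b d, iB b * iD d = iD d * iB b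

/-- The product of two elements of `D ⊗ H ⊗ B` in an algebra with the relations of a crossed
triple. -/
def tripleMul (d : D) (h : H) (b : B) (d' : D) (h' : H) (b' : B) : D ⊗[k] (H ⊗[k] B) :=
  ∑ i ∈ (ℛ k h).index, ∑ j ∈ (ℛ k h').index,
    (d * ((ℛ k h).left i • d')) ⊗ₜ (((ℛ k h).right i * (ℛ k h').left j) ⊗ₜ
      ((op ((ℛ k h').right j) • b) * b'))

namespace IsCrossedTriple

variable {iD : D →ₐ[k] U} {iH : H →ₐ[k] U} {iB : B →ₐ[k] U}

lemma tripleMap_mul (t : IsCrossedTriple iD iH iB) (d : D) (h : H) (b : B) (d' : D) (h' : H)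
    (b' : B) :
    tripleMap iD.toLinearMap iH.toLinearMap iB.toLinearMap (d ⊗ₜ (h ⊗ₜ b)) *
      tripleMap iD.toLinearMap iH.toLinearMap iB.toLinearMap (d' ⊗ₜ (h' ⊗ₜ b')) =
    tripleMap iD.toLinearMap iH.toLinearMap iB.toLinearMap (tripleMul d h b d' h' b') := by
  have e1 := t.hd h d'
  have e2 := t.bh b h'
  rw [← (ℛ k h).eq] at e1
  rw [← (ℛ k h').eq] at e2
  simp only [map_sum, pushLeft_tmul, pushRight_tmul, AlgHom.toLinearMap_apply] at e1 e2
  calc _ = iD d * (iH h * iD d') * (iB b * iH h') * iB b' := by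
        simp only [tripleMap_tmul, AlgHom.toLinearMap_apply, mul_assoc]
        rw [← mul_assoc (iB b) (iD d'), t.bd, mul_assoc]
    _ = _ := by
        rw [e1, e2]
        simp only [tripleMul, map_sum, tripleMap_tmul, AlgHom.toLinearMap_apply, Finset.mul_sum,
          Finset.sum_mul, map_mul, mul_assoc]
        rw [Finset.sum_comm]

variable {X : Type*} [Ring X] [Algebra k X] {jD : D →ₐ[k] X} {jH : H →ₐ[k] X} {jB : B →ₐ[k] X}

/-- The point is that one z serves both algebras, because reordering uses the relations only. This
gives multiplicativity of `lift` and closure of the span of the dhb, without proving that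
`tripleMul`, which is defined through chosen representations, is linear in h and h'. -/
lemma exists_tripleMap_mul (t : IsCrossedTriple iD iH iB) (s : IsCrossedTriple jD jH jB)
    (x y : D ⊗[k] (H ⊗[k] B)) : ∃ z,
      tripleMap iD.toLinearMap iH.toLinearMap iB.toLinearMap x *
        tripleMap iD.toLinearMap iH.toLinearMap iB.toLinearMap y =
        tripleMap iD.toLinearMap iH.toLinearMap iB.toLinearMap z ∧
      tripleMap jD.toLinearMap jH.toLinearMap jB.toLinearMap x *
        tripleMap jD.toLinearMap jH.toLinearMap jB.toLinearMap y =
        tripleMap jD.toLinearMap jH.toLinearMap jB.toLinearMap z := by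
  induction x with
  | zero => exact ⟨0, by simp, by simp⟩
  | add x₁ x₂ h₁ h₂ =>
    obtain ⟨z₁, h₁, h₁'⟩ := h₁
    obtain ⟨z₂, h₂, h₂'⟩ := h₂
    exact ⟨z₁ + z₂, by simp only [map_add, add_mul, *], by simp only [map_add, add_mul, *]⟩
  | tmul d x =>
  induction x with
  | zero => exact ⟨0, by simp, by simp⟩
  | add x₁ x₂ h₁ h₂ =>
    obtain ⟨z₁, h₁, h₁'⟩ := h₁
    obtain ⟨z₂, h₂, h₂'⟩ := h₂
    exact ⟨z₁ + z₂, by simp only [map_add, add_mul, TensorProduct.tmul_add, *],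
      by simp only [map_add, add_mul, TensorProduct.tmul_add, *]⟩
  | tmul h b =>
  induction y with
  | zero => exact ⟨0, by simp, by simp⟩
  | add x₁ x₂ h₁ h₂ =>
    obtain ⟨z₁, h₁, h₁'⟩ := h₁
    obtain ⟨z₂, h₂, h₂'⟩ := h₂
    exact ⟨z₁ + z₂, by simp only [map_add, mul_add, *], by simp only [map_add, mul_add, *]⟩
  | tmul d' y =>
  induction y with
  | zero => exact ⟨0, by simp, by simp⟩
  | add x₁ x₂ h₁ h₂ =>
    obtain ⟨z₁, h₁, h₁'⟩ := h₁
    obtain ⟨z₂, h₂, h₂'⟩ := h₂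
    exact ⟨z₁ + z₂, by simp only [map_add, mul_add, TensorProduct.tmul_add, *],
      by simp only [map_add, mul_add, TensorProduct.tmul_add, *]⟩
  | tmul h' b' => exact ⟨_, t.tripleMap_mul d h b d' h' b', s.tripleMap_mul d h b d' h' b'⟩

/-- The universal property of an algebra with a triangular decomposition. -/
def lift (t : IsCrossedTriple iD iH iB)
    (bij : Function.Bijective (tripleMap iD.toLinearMap iH.toLinearMap iB.toLinearMap))
    (s : IsCrossedTriple jD jH jB) : U →ₐ[k] X :=
  AlgHom.ofLinearMap (tripleMap jD.toLinearMap jH.toLinearMap jB.toLinearMap ∘ₗ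
      (LinearEquiv.ofBijective _ bij).symm.toLinearMap)
    (by
      have : (LinearEquiv.ofBijective _ bij) ((1 : D) ⊗ₜ[k] ((1 : H) ⊗ₜ[k] (1 : B))) = 1 := by
        simp [tripleMap]
      rw [LinearMap.comp_apply, LinearEquiv.coe_coe, (LinearEquiv.symm_apply_eq _).2 this.symm]
      simp)
    (by
      intro u v
      obtain ⟨x, rfl⟩ := bij.2 u
      obtain ⟨y, rfl⟩ := bij.2 v
      obtain ⟨z, h₁, h₂⟩ := t.exists_tripleMap_mul s x y
      rw [h₁]
      simp only [LinearMap.comp_apply, LinearEquiv.coe_coe, LinearEquiv.ofBijective_symm_apply_apply]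
      exact h₂.symm)

variable (t : IsCrossedTriple iD iH iB)
  (bij : Function.Bijective (tripleMap iD.toLinearMap iH.toLinearMap iB.toLinearMap))
  (s : IsCrossedTriple jD jH jB)

lemma lift_tripleMap (x : D ⊗[k] (H ⊗[k] B)) :
    t.lift bij s (tripleMap iD.toLinearMap iH.toLinearMap iB.toLinearMap x) =
      tripleMap jD.toLinearMap jH.toLinearMap jB.toLinearMap x := by
  simp [lift]

@[simp] lemma lift_left (d : D) : t.lift bij s (iD d) = jD d := by
  simpa using t.lift_tripleMap bij s (d ⊗ₜ (1 ⊗ₜ 1))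
@[simp] lemma lift_mid (h : H) : t.lift bij s (iH h) = jH h := by
  simpa using t.lift_tripleMap bij s (1 ⊗ₜ (h ⊗ₜ 1))
@[simp] lemma lift_right (b : B) : t.lift bij s (iB b) = jB b := by
  simpa using t.lift_tripleMap bij s (1 ⊗ₜ (1 ⊗ₜ b))

end IsCrossedTriple

/-! ### Existence of the crossed triple algebra -/

section Existence

variable (k H) in
/-- The right action of `H` as a homomorphism to the opposite of the endomorphism algebra. -/
def rightActHom (B : Type*) [Ring B] [Algebra k B] [Module Hᵐᵒᵖ B] [IsScalarTower k Hᵐᵒᵖ B] :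
    H →ₐ[k] (Module.End k B)ᵐᵒᵖ :=
  AlgHom.ofLinearMap ((opLinearEquiv k).toLinearMap ∘ₗ rightAct k H B)
    (by simp only [LinearMap.comp_apply]; exact congrArg op (LinearMap.ext fun b ↦ by simp))
    (fun x y ↦ congrArg op (LinearMap.ext fun b ↦ by simp [mul_smul]))

variable (k) in
/-- Right multiplication as a homomorphism to the opposite of the endomorphism algebra. -/
def rightMulHom (B : Type*) [Ring B] [Algebra k B] : B →ₐ[k] (Module.End k B)ᵐᵒᵖ :=
  AlgHom.ofLinearMap ((opLinearEquiv k).toLinearMap ∘ₗ (LinearMap.mul k B).flip)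
    (congrArg op (LinearMap.ext fun b ↦ by simp))
    (fun x y ↦ congrArg op (LinearMap.ext fun b ↦ by simp [mul_assoc]))

@[simp] lemma unop_rightActHom (h : H) (b : B) : unop (rightActHom k H B h) b = op h • b := rfl

@[simp] lemma unop_rightMulHom (b c : B) : unop (rightMulHom k B b) c = c * b := rfl

/-- The module algebra axiom of D, read as an identity between operators on D. -/
lemma lmul_lsmul_pushLeft
    (hD : ∀ (h : H) (c d : D), h • (c * d) = LinearMap.mul' k D
      (tensorAct (leftAct k H D) (leftAct k H D) (comul (R := k) h) (c ⊗ₜ[k] d))) (h : H) (d : D) :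
    Algebra.lsmul k k D h * Algebra.lmul k D d =
      pushLeft (Algebra.lmul k D).toLinearMap (Algebra.lsmul k k D : H →ₐ[k] _).toLinearMap d
        (comul (R := k) h) := by
  ext c
  have : ∀ z : H ⊗[k] H, LinearMap.mul' k D
      (tensorAct (leftAct k H D) (leftAct k H D) z (d ⊗ₜ[k] c)) =
      pushLeft (Algebra.lmul k D).toLinearMap (Algebra.lsmul k k D : H →ₐ[k] _).toLinearMap d
        z c := fun z ↦ by
    induction z with
    | zero => simp
    | add x y hx hy => simp only [map_add, LinearMap.add_apply, hx, hy]
    | tmul x y => simp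
  rw [← this, ← hD]
  rfl

/-- The same for B. Right actions and right multiplications compose in reverse order, hence the
opposite endomorphism algebra. -/
lemma rightMulHom_rightActHom_pushRight
    (hB : ∀ (h : H) (a b : B), op h • (a * b) = LinearMap.mul' k B
      (tensorAct (rightAct k H B) (rightAct k H B) (comul (R := k) h) (a ⊗ₜ[k] b))) (b : B)
    (h : H) :
    rightMulHom k B b * rightActHom k H B h =
      pushRight (rightActHom k H B).toLinearMap (rightMulHom k B).toLinearMap b
        (comul (R := k) h) := by
  apply unop_injective
  ext c
  have : ∀ z : H ⊗[k] H, LinearMap.mul' k B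
      (tensorAct (rightAct k H B) (rightAct k H B) z (c ⊗ₜ[k] b)) =
      unop (pushRight (rightActHom k H B).toLinearMap (rightMulHom k B).toLinearMap b z) c :=
      fun z ↦ by
    induction z with
    | zero => simp
    | add x y hx hy => simp only [map_add, LinearMap.add_apply, hx, hy, unop_add]
    | tmul x y => simp
  rw [← this, ← hB]
  rfl

/-- By coassociativity, the relation bh = h₍₁₎ (b ◁ h₍₂₎) persists when h is replaced by a(h₍₁₎) ⊗
g(h₍₂₎) and b is placed in the last leg. Two applications reach the three-legged `operatorMid`. -/
lemma pushRight_comul_tensor {X Y : Type*} [Ring X] [Algebra k X] [Ring Y] [Algebra k Y]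
    (a : H →ₗ[k] X) (g : H →ₗ[k] Y) (f : B →ₗ[k] Y) (b : B)
    (e : ∀ h, f b * g h = pushRight g f b (comul (R := k) h)) (h : H) :
    (1 : X) ⊗ₜ f b * TensorProduct.map a g (comul (R := k) h) =
      pushRight (TensorProduct.map a g ∘ₗ comul) (TensorProduct.mk k X Y 1 ∘ₗ f) b
        (comul (R := k) h) := by
  have e1 : ∀ z : H ⊗[k] H, (1 : X) ⊗ₜ f b * TensorProduct.map a g z =
      TensorProduct.map a (pushRight g f b) ((comul (R := k) (A := H)).lTensor H z) := fun z ↦ by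
    induction z with
    | zero => simp
    | add x y hx hy => simp only [map_add, mul_add, hx, hy]
    | tmul x y => simp [e]
  have e2 : ∀ z : H ⊗[k] H, pushRight (TensorProduct.map a g ∘ₗ comul)
      (TensorProduct.mk k X Y 1 ∘ₗ f) b z = TensorProduct.map a (pushRight g f b)
      (TensorProduct.assoc k H H H ((comul (R := k) (A := H)).rTensor H z)) := fun z ↦ by
    induction z with
    | zero => simp
    | add x y hx hy => simp only [map_add, hx, hy]
    | tmul x y =>
      have : ∀ z : H ⊗[k] H, TensorProduct.map a g z * ((1 : X) ⊗ₜ[k] f (op y • b)) =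
          TensorProduct.map a (pushRight g f b) (TensorProduct.assoc k H H H (z ⊗ₜ y)) := fun z ↦ by
        induction z with
        | zero => simp
        | add x y hx hy => simp only [map_add, add_mul, TensorProduct.add_tmul, hx, hy]
        | tmul x y => simp
      simpa using this (comul (R := k) x)
  rw [e1, e2, coassoc_apply]

section Operators

variable {E F : Type*} [Ring E] [Algebra k E] [Ring F] [Algebra k F]
  (lam : D →ₐ[k] E) (rho : H →ₐ[k] E) (rho' : H →ₐ[k] F) (mu : B →ₐ[k] F)

variable (H F) in
/-- `d ↦ λ(d) ⊗ 1 ⊗ 1`. -/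
def operatorLeft : D →ₐ[k] E ⊗[k] (H ⊗[k] F) :=
  Algebra.TensorProduct.includeLeft.comp lam

/-- `h ↦ h₍₁₎ ⊗ ρ'(h₍₂₎)`. -/
def operatorMidRight : H →ₐ[k] H ⊗[k] F :=
  (Algebra.TensorProduct.map (AlgHom.id k H) rho').comp (Bialgebra.comulAlgHom k H)

/-- `h ↦ ρ(h₍₁₎) ⊗ h₍₂₎ ⊗ ρ'(h₍₃₎)`. -/
def operatorMid : H →ₐ[k] E ⊗[k] (H ⊗[k] F) :=
  (Algebra.TensorProduct.map rho (operatorMidRight rho')).comp (Bialgebra.comulAlgHom k H)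

variable (H E) in
/-- `b ↦ 1 ⊗ 1 ⊗ μ(b)`. -/
def operatorRight : B →ₐ[k] E ⊗[k] (H ⊗[k] F) :=
  Algebra.TensorProduct.includeRight.comp (Algebra.TensorProduct.includeRight.comp mu)

variable {lam rho rho' mu}

/-- D occupies the first leg and B the last, so they commute. H is spread over all three legs by the
iterated coproduct and meets D only through its first leg and B only through its last. -/
lemma operator_isCrossedTriple
    (hD : ∀ h d, rho h * lam d = pushLeft lam.toLinearMap rho.toLinearMap d (comul (R := k) h))
    (hB : ∀ b h, mu b * rho' h = pushRight rho'.toLinearMap mu.toLinearMap b (comul (R := k) h)) :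
    IsCrossedTriple (operatorLeft H F lam) (operatorMid rho rho') (operatorRight H E mu) where
  hd h d := by
    let L : H ⊗[k] (H ⊗[k] H) →ₗ[k] E ⊗[k] (H ⊗[k] F) :=
      LinearMap.mul' k _ ∘ₗ TensorProduct.map
        ((operatorLeft H F lam).toLinearMap ∘ₗ (leftAct k H D).flip d)
        (TensorProduct.map rho.toLinearMap (operatorMidRight rho').toLinearMap)
    have e1 : ∀ z : H ⊗[k] H, Algebra.TensorProduct.map rho (operatorMidRight rho') z *
        operatorLeft H F lam d =
        L (TensorProduct.assoc k H H H ((comul (R := k) (A := H)).rTensor H z)) := fun z ↦ by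
      induction z with
      | zero => simp
      | add x y hx hy => simp only [map_add, add_mul, hx, hy]
      | tmul x y =>
        have e' : ∀ z : H ⊗[k] H, L (TensorProduct.assoc k H H H (z ⊗ₜ y)) =
            pushLeft lam.toLinearMap rho.toLinearMap d z ⊗ₜ operatorMidRight rho' y := fun z ↦ by
          induction z with
          | zero => simp
          | add x y hx hy => simp only [map_add, TensorProduct.add_tmul, hx, hy]
          | tmul x y => simp [L, operatorLeft]
        rw [LinearMap.rTensor_tmul, e', ← hD]
        simp [operatorLeft]
    have e2 : ∀ z : H ⊗[k] H, pushLeft (operatorLeft H F lam).toLinearMap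
        (operatorMid rho rho').toLinearMap d z = L ((comul (R := k) (A := H)).lTensor H z) :=
        fun z ↦ by
      induction z with
      | zero => simp
      | add x y hx hy => simp only [map_add, hx, hy]
      | tmul x y => rfl
    rw [e2, ← coassoc_apply, ← e1]
    rfl
  bh b h := by
    have e1 := pushRight_comul_tensor (AlgHom.id k H).toLinearMap rho'.toLinearMap mu.toLinearMap b
      (hB b)
    exact pushRight_comul_tensor rho.toLinearMap (operatorMidRight rho').toLinearMap
      (TensorProduct.mk k H _ 1 ∘ₗ mu.toLinearMap) b e1 h
  bd b d := by simp [operatorLeft, operatorRight]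

/-- In the application `evD` and `evB` evaluate operators at the units of D and B, where H acts by
its counit. The outer legs of the iterated coproduct of h then disappear and d ⊗ h ⊗ b is recovered,
so `tripleMap` has a left inverse. -/
lemma operatorEval_tripleMap (evD : E →ₗ[k] D) (evB : F →ₗ[k] B)
    (hD : ∀ h d, evD (lam d * rho h) = counit (R := k) h • d)
    (hB : ∀ h b, evB (rho' h * mu b) = counit (R := k) h • b)
    (x : D ⊗[k] (H ⊗[k] B)) :
    TensorProduct.map evD (evB.lTensor H) (tripleMap (operatorLeft H F lam).toLinearMap
      (operatorMid rho rho').toLinearMap (operatorRight H E mu).toLinearMap x) = x := by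
  induction x with
  | zero => simp
  | add x y hx hy => simp only [map_add, hx, hy]
  | tmul d x =>
    induction x with
    | zero => simp
    | add x y hx hy => simp only [map_add, TensorProduct.tmul_add, hx, hy]
    | tmul h b =>
      have e1 : ∀ z : H ⊗[k] H, TensorProduct.map evD (evB.lTensor H) (operatorLeft H F lam d *
          (Algebra.TensorProduct.map rho (operatorMidRight rho') z * operatorRight H E mu b)) =
          d ⊗ₜ (TensorProduct.lid k H ((counit (R := k) (A := H)).rTensor H z) ⊗ₜ b) := fun z ↦ by
        induction z with
        | zero => simp
        | add x y hx hy =>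
          rw [map_add, add_mul, mul_add, map_add, hx, hy]
          simp only [map_add, TensorProduct.tmul_add, TensorProduct.add_tmul]
        | tmul x y =>
          have e2 : ∀ z : H ⊗[k] H, evB.lTensor H
              (Algebra.TensorProduct.map (AlgHom.id k H) rho' z * ((1 : H) ⊗ₜ mu b)) =
              TensorProduct.rid k H ((counit (R := k) (A := H)).lTensor H z) ⊗ₜ b := fun z ↦ by
            induction z with
            | zero => simp
            | add x y hx hy =>
              simp only [map_add, add_mul, TensorProduct.add_tmul, hx, hy]
            | tmul x y => simp [hB, TensorProduct.smul_tmul']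
          have e3 := e2 (comul (R := k) y)
          simp only [lTensor_counit_comul, TensorProduct.rid_tmul, one_smul] at e3
          simp only [operatorLeft, operatorRight, operatorMidRight, AlgHom.comp_apply,
            Algebra.TensorProduct.map_tmul, Algebra.TensorProduct.includeLeft_apply,
            Algebra.TensorProduct.includeRight_apply, Algebra.TensorProduct.tmul_mul_tmul,
            one_mul, TensorProduct.map_tmul, Bialgebra.comulAlgHom_apply, e3, mul_one, hD,
            LinearMap.rTensor_tmul, TensorProduct.lid_tmul]
          rw [TensorProduct.smul_tmul, TensorProduct.smul_tmul']
      have := e1 (comul (R := k) h)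
      rw [rTensor_counit_comul, TensorProduct.lid_tmul, one_smul] at this
      exact this

/-- The subalgebra spanned by the products `d h b`. -/
def _root_.DoubleBosonisation.IsCrossedTriple.range {iD : D →ₐ[k] U} {iH : H →ₐ[k] U}
    {iB : B →ₐ[k] U} (t : IsCrossedTriple iD iH iB) : Subalgebra k U where
  carrier := Set.range (tripleMap iD.toLinearMap iH.toLinearMap iB.toLinearMap)
  mul_mem' := by
    rintro _ _ ⟨x, rfl⟩ ⟨y, rfl⟩
    exact (t.exists_tripleMap_mul t x y).imp fun z hz ↦ hz.1.symm
  add_mem' := by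
    rintro _ _ ⟨x, rfl⟩ ⟨y, rfl⟩
    exact ⟨x + y, map_add _ _ _⟩
  algebraMap_mem' c := ⟨c • (1 ⊗ₜ (1 ⊗ₜ 1)), by simp [Algebra.algebraMap_eq_smul_one]⟩

lemma IsCrossedTriple.exists_bijective {iD : D →ₐ[k] U} {iH : H →ₐ[k] U} {iB : B →ₐ[k] U}
    (t : IsCrossedTriple iD iH iB)
    (inj : Function.Injective (tripleMap iD.toLinearMap iH.toLinearMap iB.toLinearMap)) :
    ∃ (jD : D →ₐ[k] t.range) (jH : H →ₐ[k] t.range) (jB : B →ₐ[k] t.range),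
      IsCrossedTriple jD jH jB ∧
      Function.Bijective (tripleMap jD.toLinearMap jH.toLinearMap jB.toLinearMap) := by
  let jD : D →ₐ[k] t.range := iD.codRestrict t.range fun d ↦ ⟨d ⊗ₜ (1 ⊗ₜ 1), by simp⟩
  let jH : H →ₐ[k] t.range := iH.codRestrict t.range fun h ↦ ⟨1 ⊗ₜ (h ⊗ₜ 1), by simp⟩
  let jB : B →ₐ[k] t.range := iB.codRestrict t.range fun b ↦ ⟨1 ⊗ₜ (1 ⊗ₜ b), by simp⟩
  have hval : ∀ x, (tripleMap jD.toLinearMap jH.toLinearMap jB.toLinearMap x : U) =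
      tripleMap iD.toLinearMap iH.toLinearMap iB.toLinearMap x := fun x ↦ by
    induction x with
    | zero => simp
    | add x y hx hy => simp only [map_add, Subalgebra.coe_add, hx, hy]
    | tmul d x =>
      induction x with
      | zero => simp
      | add x y hx hy => simp only [map_add, TensorProduct.tmul_add, Subalgebra.coe_add, hx, hy]
      | tmul h b => rfl
  refine ⟨jD, jH, jB, ⟨fun h d ↦ Subtype.ext ?_, fun b h ↦ Subtype.ext ?_, fun b d ↦
    Subtype.ext (t.bd b d)⟩, ?_, ?_⟩
  · refine (t.hd h d).trans ?_
    induction comul (R := k) h with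
    | zero => simp
    | add x y hx hy => simp only [map_add, Subalgebra.coe_add, hx, hy]
    | tmul x y => rfl
  · refine (t.bh b h).trans ?_
    induction comul (R := k) h with
    | zero => simp
    | add x y hx hy => simp only [map_add, Subalgebra.coe_add, hx, hy]
    | tmul x y => rfl
  · exact fun x y e ↦ inj ((hval x).symm.trans ((congrArg Subtype.val e).trans (hval y)))
  · rintro ⟨_, x, rfl⟩
    exact ⟨x, Subtype.ext (hval x)⟩

end Operators

end Existence

end Triple

universe uk uH uB uD

open Coalgebra MulOpposite in
/-- There is an algebra with the relations of a crossed triple that is `D ⊗ H ⊗ B` as a vector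
space. -/
theorem exists_crossedTriple (k : Type uk) (H : Type uH) (B : Type uB) (D : Type uD) [Field k]
    [Ring H] [HopfAlgebra k H] [Ring B] [Algebra k B] [Module Hᵐᵒᵖ B] [IsScalarTower k Hᵐᵒᵖ B]
    [Ring D] [Algebra k D] [Module H D] [IsScalarTower k H D]
    (hD : ∀ (h : H) (c d : D), h • (c * d) = LinearMap.mul' k D
      (tensorAct (leftAct k H D) (leftAct k H D) (comul (R := k) h) (c ⊗ₜ[k] d)))
    (hB : ∀ (h : H) (a b : B), op h • (a * b) = LinearMap.mul' k B
      (tensorAct (rightAct k H B) (rightAct k H B) (comul (R := k) h) (a ⊗ₜ[k] b)))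
    (hD1 : ∀ h : H, h • (1 : D) = algebraMap k D (counit (R := k) h))
    (hB1 : ∀ h : H, op h • (1 : B) = algebraMap k B (counit (R := k) h)) :
    ∃ (U : Type (max uH uB uD)) (_ : Ring U) (_ : Algebra k U) (iD : D →ₐ[k] U) (iH : H →ₐ[k] U)
      (iB : B →ₐ[k] U), IsCrossedTriple iD iH iB ∧
      Function.Bijective (tripleMap iD.toLinearMap iH.toLinearMap iB.toLinearMap) := by
  have t := operator_isCrossedTriple (lmul_lsmul_pushLeft hD) (rightMulHom_rightActHom_pushRight hB)
  have inj := Function.LeftInverse.injective (operatorEval_tripleMap (H := H)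
    (lam := Algebra.lmul k D) (rho := Algebra.lsmul k k D) (rho' := rightActHom k H B)
    (mu := rightMulHom k B)
    (LinearMap.applyₗ (1 : D)) (LinearMap.applyₗ (1 : B) ∘ₗ (opLinearEquiv k).symm.toLinearMap)
    (fun h d ↦ by simp [hD1, Algebra.algebraMap_eq_smul_one])
    (fun h b ↦ by
      simp [hB1, Algebra.algebraMap_eq_smul_one]))
  exact ⟨t.range, inferInstance, inferInstance, IsCrossedTriple.exists_bijective t inj⟩

/-! ### Commutation relations of a module with a coproduct -/

section Relations

open Coalgebra

variable {k H M N X Y : Type*} [Field k] [Ring H] [HopfAlgebra k H]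
  [AddCommGroup M] [Module k M] [AddCommGroup N] [Module k N]
  [Ring X] [Algebra k X] [Ring Y] [Algebra k Y]

/-- The relation `h m = (h₍₁₎ ▷ m) h₍₂₎` in an algebra. -/
def LeftRel (α : H →ₗ[k] M →ₗ[k] M) (f : M →ₗ[k] Y) (g : H →ₗ[k] Y) : Prop :=
  ∀ h m, g h * f m = LinearMap.mul' k Y (TensorProduct.map (f ∘ₗ α.flip m) g (comul (R := k) h))

/-- The relation `m h = h₍₁₎ (m ◁ h₍₂₎)` in an algebra. -/
def RightRel (α : H →ₗ[k] M →ₗ[k] M) (f : M →ₗ[k] Y) (g : H →ₗ[k] Y) : Prop :=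
  ∀ h m, f m * g h = LinearMap.mul' k Y (TensorProduct.map g (f ∘ₗ α.flip m) (comul (R := k) h))

variable {α : H →ₗ[k] M →ₗ[k] M} {β : H →ₗ[k] N →ₗ[k] N} {f : M →ₗ[k] Y} {f' : N →ₗ[k] Y}
  {g : H →ₗ[k] Y}

lemma LeftRel.repr (r : LeftRel α f g) {ι : Type*} {h : H} (𝓡 : Repr k h ι) (m : M) :
    g h * f m = ∑ i ∈ 𝓡.index, f (α (𝓡.left i) m) * g (𝓡.right i) := by
  rw [r, ← 𝓡.eq]
  simp

lemma RightRel.repr (r : RightRel α f g) {ι : Type*} {h : H} (𝓡 : Repr k h ι) (m : M) :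
    f m * g h = ∑ i ∈ 𝓡.index, g (𝓡.left i) * f (α (𝓡.right i) m) := by
  rw [r, ← 𝓡.eq]
  simp

/-- The relation passes to products with the diagonal action by coassociativity. Combined with
`tensor`, `conj` and `comp` below, it yields the relation between Δ(h) and Δ(d) from that between h
and d, since Δ(d) is a product of two such maps composed with the H-linear coproduct of D. -/
lemma LeftRel.mul (r : LeftRel α f g) (r' : LeftRel β f' g) :
    LeftRel (tensorAct α β ∘ₗ comul) (LinearMap.mul' k Y ∘ₗ TensorProduct.map f f') g := by
  intro h z
  induction z with
  | zero => simp
  | add x y hx hy => simp only [map_add, mul_add, hx, hy, LinearMap.comp_add,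
      TensorProduct.map_add_left, LinearMap.add_apply]
  | tmul x y =>
    have := congrArg (LinearMap.mul' k Y ∘ₗ TensorProduct.map (f ∘ₗ α.flip x)
      (LinearMap.mul' k Y ∘ₗ TensorProduct.map (f' ∘ₗ β.flip y) g))
      (sum_tmul_tmul_eq (ℛ k h) (fun i ↦ ℛ k ((ℛ k h).left i)) (fun i ↦ ℛ k ((ℛ k h).right i)))
    simp only [map_sum, LinearMap.comp_apply, TensorProduct.map_tmul, LinearMap.mul'_apply,
      LinearMap.flip_apply] at this
    calc _ = ∑ i ∈ (ℛ k h).index, f (α ((ℛ k h).left i) x) * (g ((ℛ k h).right i) * f' y) := by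
          simp [← mul_assoc, r.repr (ℛ k h), Finset.sum_mul]
      _ = _ := by
          simp_rw [r'.repr (ℛ k _), Finset.mul_sum]
          rw [← this, ← (ℛ k h).eq]
          simp only [map_sum, TensorProduct.map_tmul, LinearMap.mul'_apply, LinearMap.comp_apply,
            LinearMap.flip_apply]
          refine Finset.sum_congr rfl fun i _ ↦ ?_
          conv_rhs => rw [← (ℛ k ((ℛ k h).left i)).eq]
          simp [Finset.sum_mul, mul_assoc]

lemma RightRel.mul (r : RightRel α f g) (r' : RightRel β f' g) :
    RightRel (tensorAct α β ∘ₗ comul) (LinearMap.mul' k Y ∘ₗ TensorProduct.map f f') g := by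
  intro h z
  induction z with
  | zero => simp
  | add x y hx hy => simp only [map_add, add_mul, hx, hy, LinearMap.comp_add,
      TensorProduct.map_add_right, LinearMap.add_apply]
  | tmul x y =>
    have := congrArg (LinearMap.mul' k Y ∘ₗ TensorProduct.map g
      (LinearMap.mul' k Y ∘ₗ TensorProduct.map (f ∘ₗ α.flip x) (f' ∘ₗ β.flip y)))
      (sum_tmul_tmul_eq (ℛ k h) (fun i ↦ ℛ k ((ℛ k h).left i)) (fun i ↦ ℛ k ((ℛ k h).right i)))
    simp only [map_sum, LinearMap.comp_apply, TensorProduct.map_tmul, LinearMap.mul'_apply,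
      LinearMap.flip_apply] at this
    calc _ = ∑ i ∈ (ℛ k h).index, f x * g ((ℛ k h).left i) * f' (β ((ℛ k h).right i) y) := by
          simp [mul_assoc, r'.repr (ℛ k h), Finset.mul_sum]
      _ = _ := by
          simp_rw [r.repr (ℛ k _), Finset.sum_mul, mul_assoc]
          rw [this, ← (ℛ k h).eq]
          simp only [map_sum, TensorProduct.map_tmul, LinearMap.mul'_apply, LinearMap.comp_apply,
            LinearMap.flip_apply]
          refine Finset.sum_congr rfl fun i _ ↦ ?_
          conv_rhs => rw [← (ℛ k ((ℛ k h).right i)).eq]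
          simp [Finset.mul_sum]

lemma LeftRel.tensor (r : LeftRel α f g) (a : H →ₗ[k] X) :
    LeftRel α ((Algebra.TensorProduct.includeLeft : Y →ₐ[k] Y ⊗[k] X).toLinearMap ∘ₗ f)
      (TensorProduct.map g a ∘ₗ comul) := by
  intro h m
  have := congrArg (TensorProduct.map (LinearMap.mul' k Y) LinearMap.id ∘ₗ
      (TensorProduct.assoc k Y Y X).symm.toLinearMap ∘ₗ
      TensorProduct.map (f ∘ₗ α.flip m) (TensorProduct.map g a))
    (sum_tmul_tmul_eq (ℛ k h) (fun i ↦ ℛ k ((ℛ k h).left i)) (fun i ↦ ℛ k ((ℛ k h).right i)))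
  simp only [map_sum, LinearMap.comp_apply, TensorProduct.map_tmul, LinearMap.mul'_apply,
    LinearMap.flip_apply, LinearEquiv.coe_coe, TensorProduct.assoc_symm_tmul,
    LinearMap.id_coe, id_eq] at this
  calc _ = ∑ i ∈ (ℛ k h).index, (g ((ℛ k h).left i) * f m) ⊗ₜ[k] a ((ℛ k h).right i) := by
        rw [LinearMap.comp_apply, ← (ℛ k h).eq]
        simp [Finset.sum_mul]
    _ = _ := by
        simp_rw [r.repr (ℛ k _), TensorProduct.sum_tmul]
        rw [this]
        conv_rhs => rw [← (ℛ k h).eq]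
        simp only [map_sum, TensorProduct.map_tmul, LinearMap.mul'_apply, LinearMap.comp_apply,
          LinearMap.flip_apply]
        refine Finset.sum_congr rfl fun i _ ↦ ?_
        rw [← (ℛ k ((ℛ k h).right i)).eq]
        simp [Finset.mul_sum]

lemma RightRel.tensor (r : RightRel α f g) (a : H →ₗ[k] X) :
    RightRel α ((Algebra.TensorProduct.includeRight : Y →ₐ[k] X ⊗[k] Y).toLinearMap ∘ₗ f)
      (TensorProduct.map a g ∘ₗ comul) := by
  intro h m
  have := congrArg (TensorProduct.map LinearMap.id (LinearMap.mul' k Y) ∘ₗ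
      TensorProduct.map a (TensorProduct.map g (f ∘ₗ α.flip m)))
    (sum_tmul_tmul_eq (ℛ k h) (fun i ↦ ℛ k ((ℛ k h).left i)) (fun i ↦ ℛ k ((ℛ k h).right i)))
  simp only [map_sum, LinearMap.comp_apply, TensorProduct.map_tmul, LinearMap.mul'_apply,
    LinearMap.flip_apply, LinearMap.id_coe, id_eq] at this
  calc _ = ∑ i ∈ (ℛ k h).index, a ((ℛ k h).left i) ⊗ₜ[k] (f m * g ((ℛ k h).right i)) := by
        rw [LinearMap.comp_apply, LinearMap.comp_apply, ← (ℛ k h).eq]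
        simp [Finset.mul_sum]
    _ = _ := by
        simp_rw [r.repr (ℛ k _), TensorProduct.tmul_sum]
        rw [← this]
        conv_rhs => rw [← (ℛ k h).eq]
        simp only [map_sum, TensorProduct.map_tmul, LinearMap.mul'_apply, LinearMap.comp_apply,
          LinearMap.flip_apply]
        refine Finset.sum_congr rfl fun i _ ↦ ?_
        rw [← (ℛ k ((ℛ k h).left i)).eq]
        simp [Finset.sum_mul]

lemma LeftRel.comp_algHom (r : LeftRel α f g) (φ : Y →ₐ[k] X) :
    LeftRel α (φ.toLinearMap ∘ₗ f) (φ.toLinearMap ∘ₗ g) := by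
  intro h m
  simp only [LinearMap.comp_apply, AlgHom.toLinearMap_apply, ← map_mul, r h m]
  induction comul (R := k) h with
  | zero => simp
  | add x y hx hy => simp only [map_add, hx, hy]
  | tmul x y => simp

lemma RightRel.comp_algHom (r : RightRel α f g) (φ : Y →ₐ[k] X) :
    RightRel α (φ.toLinearMap ∘ₗ f) (φ.toLinearMap ∘ₗ g) := by
  intro h m
  simp only [LinearMap.comp_apply, AlgHom.toLinearMap_apply, ← map_mul, r h m]
  induction comul (R := k) h with
  | zero => simp
  | add x y hx hy => simp only [map_add, hx, hy]
  | tmul x y => simp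

/-- Used with u = R, conjugation by which turns the opposite coproduct of H into the coproduct. -/
lemma LeftRel.conj (r : LeftRel α f g) (u : Yˣ) {f₁ : M →ₗ[k] Y} {g₁ : H →ₗ[k] Y}
    (hf : ∀ m, u * f₁ m = f m * u) (hg : ∀ h, u * g₁ h = g h * u) : LeftRel α f₁ g₁ := by
  intro h m
  rw [← Units.mul_right_inj u, ← mul_assoc, hg, mul_assoc, hf, ← mul_assoc, r]
  induction comul (R := k) h with
  | zero => simp
  | add x y hx hy => simp only [map_add, add_mul, mul_add, hx, hy]
  | tmul x y =>
    simp only [TensorProduct.map_tmul, LinearMap.mul'_apply, LinearMap.comp_apply, mul_assoc]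
    rw [← hg, ← mul_assoc, ← hf, mul_assoc]

lemma RightRel.conj (r : RightRel α f g) (u : Yˣ) {f₁ : M →ₗ[k] Y} {g₁ : H →ₗ[k] Y}
    (hf : ∀ m, u * f₁ m = f m * u) (hg : ∀ h, u * g₁ h = g h * u) : RightRel α f₁ g₁ := by
  intro h m
  rw [← Units.mul_right_inj u, ← mul_assoc, hf, mul_assoc, hg, ← mul_assoc, r]
  induction comul (R := k) h with
  | zero => simp
  | add x y hx hy => simp only [map_add, add_mul, mul_add, hx, hy]
  | tmul x y =>
    simp only [TensorProduct.map_tmul, LinearMap.mul'_apply, LinearMap.comp_apply, mul_assoc]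
    rw [← hf, ← mul_assoc, ← hg, mul_assoc]

lemma LeftRel.comp (r : LeftRel α f g) {p : N →ₗ[k] M} (hp : ∀ h n, p (β h n) = α h (p n)) :
    LeftRel β (f ∘ₗ p) g := by
  intro h n
  rw [LinearMap.comp_apply, r]
  congr 3
  ext x
  simp [hp]

lemma RightRel.comp (r : RightRel α f g) {p : N →ₗ[k] M} (hp : ∀ h n, p (β h n) = α h (p n)) :
    RightRel β (f ∘ₗ p) g := by
  intro h n
  rw [LinearMap.comp_apply, r]
  congr 3
  ext x
  simp [hp]

end Relations

/-! ### The coproduct on the crossed triple algebra -/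

section Coproduct

open Coalgebra MulOpposite

variable {k H B D U : Type*} [Field k] [Ring H] [HopfAlgebra k H]
  [Ring B] [Algebra k B] [Module Hᵐᵒᵖ B] [IsScalarTower k Hᵐᵒᵖ B]
  [Ring D] [Algebra k D] [Module H D] [IsScalarTower k H D]
  [Ring U] [Algebra k U] {R : (H ⊗[k] H)ˣ}

section

variable (iD : D →ₐ[k] U) (iH : H →ₐ[k] U) (iB : B →ₐ[k] U)

/-- The image of a quasitriangular structure. -/
def unitR (iH : H →ₐ[k] U) (R : (H ⊗[k] H)ˣ) : (U ⊗[k] U)ˣ :=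
  Units.map (Algebra.TensorProduct.map iH iH : H ⊗[k] H →* U ⊗[k] U) R

lemma coe_unitR : (unitR iH R : U ⊗[k] U) = Algebra.TensorProduct.map iH iH (R : H ⊗[k] H) := rfl

lemma coe_unitR_inv : (((unitR iH R)⁻¹ : (U ⊗[k] U)ˣ) : U ⊗[k] U) =
    Algebra.TensorProduct.map iH iH ((R⁻¹ : (H ⊗[k] H)ˣ) : H ⊗[k] H) := rfl

variable (R) in
/-- `d ↦ R⁻¹ (1 ⊗ d) R`. -/
def adjLeft : D →ₗ[k] U ⊗[k] U :=
  LinearMap.mulLeft k (((unitR iH R)⁻¹ : (U ⊗[k] U)ˣ) : U ⊗[k] U) ∘ₗ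
    LinearMap.mulRight k (unitR iH R : U ⊗[k] U) ∘ₗ
    (Algebra.TensorProduct.includeRight : U →ₐ[k] U ⊗[k] U).toLinearMap ∘ₗ iD.toLinearMap

variable (R) in
/-- `b ↦ R⁻¹ (b ⊗ 1) R`. -/
def adjRight : B →ₗ[k] U ⊗[k] U :=
  LinearMap.mulLeft k (((unitR iH R)⁻¹ : (U ⊗[k] U)ˣ) : U ⊗[k] U) ∘ₗ
    LinearMap.mulRight k (unitR iH R : U ⊗[k] U) ∘ₗ
    (Algebra.TensorProduct.includeLeft : U →ₐ[k] U ⊗[k] U).toLinearMap ∘ₗ iB.toLinearMap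

lemma adjLeft_apply (d : D) : adjLeft R iD iH d =
    (((unitR iH R)⁻¹ : (U ⊗[k] U)ˣ) : U ⊗[k] U) * ((1 : U) ⊗ₜ[k] iD d) * (unitR iH R : U ⊗[k] U) := by
  simp [adjLeft, mul_assoc]

lemma adjRight_apply (b : B) : adjRight R iH iB b =
    (((unitR iH R)⁻¹ : (U ⊗[k] U)ˣ) : U ⊗[k] U) * (iB b ⊗ₜ[k] (1 : U)) * (unitR iH R : U ⊗[k] U) := by
  simp [adjRight, mul_assoc]

lemma unitR_mul_adjLeft (d : D) : (unitR iH R : U ⊗[k] U) * adjLeft R iD iH d =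
    ((1 : U) ⊗ₜ[k] iD d) * (unitR iH R : U ⊗[k] U) := by
  simp [adjLeft_apply, ← mul_assoc]

lemma unitR_mul_adjRight (b : B) : (unitR iH R : U ⊗[k] U) * adjRight R iH iB b =
    (iB b ⊗ₜ[k] (1 : U)) * (unitR iH R : U ⊗[k] U) := by
  simp [adjRight_apply, ← mul_assoc]

lemma adjLeft_mul (c d : D) :
    adjLeft R iD iH (c * d) = adjLeft R iD iH c * adjLeft R iD iH d := by
  rw [← Units.mul_right_inj (unitR iH R), ← mul_assoc, unitR_mul_adjLeft, unitR_mul_adjLeft,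
    mul_assoc, unitR_mul_adjLeft, ← mul_assoc]
  simp

lemma adjRight_mul (a b : B) :
    adjRight R iH iB (a * b) = adjRight R iH iB a * adjRight R iH iB b := by
  rw [← Units.mul_right_inj (unitR iH R), ← mul_assoc, unitR_mul_adjRight, unitR_mul_adjRight,
    mul_assoc, unitR_mul_adjRight, ← mul_assoc]
  simp

lemma adjLeft_one : adjLeft R iD iH 1 = 1 := by
  simp [adjLeft_apply, ← Algebra.TensorProduct.one_def]

lemma adjRight_one : adjRight R iH iB 1 = 1 := by
  simp [adjRight_apply, ← Algebra.TensorProduct.one_def]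

end

section Sums

variable {iD : D →ₐ[k] U} {iH : H →ₐ[k] U} {iB : B →ₐ[k] U}
  {ι κ : Type*} [Fintype ι] [Fintype κ] {r r' : ι → H} {s s' : κ → H}

lemma IsCrossedTriple.leftRel (t : IsCrossedTriple iD iH iB) :
    LeftRel (leftAct k H D) iD.toLinearMap iH.toLinearMap := t.hd

lemma IsCrossedTriple.rightRel (t : IsCrossedTriple iD iH iB) :
    RightRel (rightAct k H B) iB.toLinearMap iH.toLinearMap := fun h b ↦ t.bh b h

/-- Moving d to the left through the second leg of R⁻¹ brings in (id ⊗ Δ)R⁻¹ = R₁₂⁻¹R₁₃⁻¹. One copy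
acts on d and the other is the R⁻¹ that cancels. -/
lemma adjLeft_eq_sum (t : IsCrossedTriple iD iH iB) (hR : IsQuasitriangular R)
    (hs : ((R⁻¹ : (H ⊗[k] H)ˣ) : H ⊗[k] H) = ∑ i, s i ⊗ₜ[k] s' i) (d : D) :
    adjLeft R iD iH d = ∑ i, iH (s i) ⊗ₜ[k] iD (s' i • d) := by
  rw [← Units.mul_left_inj (unitR iH R)⁻¹, adjLeft_apply, mul_assoc, Units.mul_inv, mul_one,
    coe_unitR_inv, hs]
  have h := congrArg (TensorProduct.map iH.toLinearMap
    (pushLeft iD.toLinearMap iH.toLinearMap d)) (hR.sum_expandRight_inv hs)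
  simp only [map_sum, TensorProduct.map_tmul, pushLeft_tmul, AlgHom.toLinearMap_apply,
    Algebra.TensorProduct.map_tmul, Finset.sum_mul, Finset.mul_sum, ← t.hd, map_mul,
    Algebra.TensorProduct.tmul_mul_tmul, mul_one] at h ⊢
  rw [h, Finset.sum_comm]

/-- Moving b to the right through the first leg of R brings in (Δ ⊗ id)R = R₁₃R₂₃. One copy is the R
on the left and the other acts on b. -/
lemma adjRight_eq_sum (t : IsCrossedTriple iD iH iB) (hR : IsQuasitriangular R)
    (hr : (R : H ⊗[k] H) = ∑ i, r i ⊗ₜ[k] r' i) (b : B) :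
    adjRight R iH iB b = ∑ i, iB (op (r i) • b) ⊗ₜ[k] iH (r' i) := by
  rw [← Units.mul_right_inj (unitR iH R), unitR_mul_adjRight, coe_unitR, hr]
  have h := congrArg (TensorProduct.map (pushRight iH.toLinearMap iB.toLinearMap b)
    iH.toLinearMap ∘ₗ (TensorProduct.assoc k H H H).symm.toLinearMap) (hR.sum_expandLeft hr)
  simp only [map_sum, LinearMap.comp_apply, LinearEquiv.coe_coe, TensorProduct.assoc_symm_tmul,
    LinearEquiv.symm_apply_apply, TensorProduct.map_tmul, pushRight_tmul,
    AlgHom.toLinearMap_apply, Algebra.TensorProduct.map_tmul, Finset.sum_mul, Finset.mul_sum,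
    ← t.bh, map_mul, Algebra.TensorProduct.tmul_mul_tmul, one_mul] at h ⊢
  rw [h, Finset.sum_comm]

/-- In U ⊗ U the copies D ⊗ 1 and R⁻¹(1 ⊗ D)R commute by the braiding. They therefore realise the
braided tensor product D ⊗ D inside an ordinary tensor product algebra. The inner R and R⁻¹ cancel
after (Δ ⊗ id)R⁻¹ has been expanded. -/
lemma tmul_one_mul_adjLeft (t : IsCrossedTriple iD iH iB) (hR : IsQuasitriangular R)
    (hr : (R : H ⊗[k] H) = ∑ i, r i ⊗ₜ[k] r' i) (c d : D) :
    (iD c ⊗ₜ[k] (1 : U)) * adjLeft R iD iH d =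
      ∑ i, adjLeft R iD iH (r' i • d) * (iD (r i • c) ⊗ₜ[k] (1 : U)) := by
  obtain ⟨n, s, s', hs⟩ := TensorProduct.exists_sum_tmul_eq
    ((R⁻¹ : (H ⊗[k] H)ˣ) : H ⊗[k] H)
  have h1 (i) := congrArg (TensorProduct.map (pushLeft iD.toLinearMap iH.toLinearMap (r i • c))
    (iD.toLinearMap ∘ₗ (leftAct k H D).flip (r' i • d)) ∘ₗ
    (TensorProduct.assoc k H H H).symm.toLinearMap) (hR.sum_expandLeft_inv hs)
  simp only [map_sum, LinearMap.comp_apply, LinearEquiv.coe_coe, TensorProduct.assoc_symm_tmul,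
    LinearEquiv.symm_apply_apply, TensorProduct.map_tmul, pushLeft_tmul, LinearMap.flip_apply,
    leftAct_apply, AlgHom.toLinearMap_apply, ← t.hd] at h1
  have h2 : ∑ l, ∑ i, (s l * r i) ⊗ₜ[k] (s' l * r' i) = 1 := by
    rw [← Units.inv_mul R, hs, hr]
    simp [Finset.sum_mul_sum]
  have h3 (j) := congrArg (TensorProduct.map
    (LinearMap.mulRight k (iH (s j)) ∘ₗ iD.toLinearMap ∘ₗ (leftAct k H D).flip c)
    (iD.toLinearMap ∘ₗ leftAct k H D (s' j) ∘ₗ (leftAct k H D).flip d)) h2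
  simp only [map_sum, LinearMap.comp_apply, TensorProduct.map_tmul, LinearMap.flip_apply,
    leftAct_apply, AlgHom.toLinearMap_apply, Algebra.TensorProduct.one_def,
    LinearMap.mulRight_apply, one_smul] at h3
  simp only [adjLeft_eq_sum t hR hs, Finset.mul_sum, Finset.sum_mul,
    Algebra.TensorProduct.tmul_mul_tmul, one_mul, mul_one, h1]
  simp only [← h3]
  conv_rhs => rw [Finset.sum_comm]
  refine Finset.sum_congr rfl fun j _ ↦ ?_
  rw [Finset.sum_comm]
  simp only [mul_smul]

lemma one_tmul_mul_adjRight (t : IsCrossedTriple iD iH iB) (hR : IsQuasitriangular R)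
    (hr : (R : H ⊗[k] H) = ∑ i, r i ⊗ₜ[k] r' i) (a b : B) :
    ((1 : U) ⊗ₜ[k] iB a) * adjRight R iH iB b =
      ∑ i, adjRight R iH iB (op (r i) • b) * ((1 : U) ⊗ₜ[k] iB (op (r' i) • a)) := by
  have h := congrArg (TensorProduct.map (iB.toLinearMap ∘ₗ (rightAct k H B).flip b)
    (pushRight iH.toLinearMap iB.toLinearMap a)) (hR.sum_expandRight hr)
  simp only [map_sum, TensorProduct.map_tmul, pushRight_tmul, LinearMap.comp_apply,
    LinearMap.flip_apply, rightAct_apply, AlgHom.toLinearMap_apply, ← t.bh] at h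
  simp only [adjRight_eq_sum t hR hr, Finset.mul_sum, Finset.sum_mul,
    Algebra.TensorProduct.tmul_mul_tmul, one_mul, mul_one]
  rw [h]
  simp only [op_mul, mul_smul]

end Sums

end Coproduct

/-! ### The bialgebra structure on the crossed triple algebra -/


section Coproduct

open Coalgebra MulOpposite

section BraidedHom

variable {k A Y : Type*} [Field k] [Ring A] [Algebra k A] [Coalgebra k A] [Ring Y] [Algebra k Y]
  {Ψ : A ⊗[k] A →ₗ[k] A ⊗[k] A} {S : A →ₗ[k] A} {f g : A →ₗ[k] Y}

/-- `a ↦ f(a₍₁₎) g(a₍₂₎)`. -/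
def convComul (f g : A →ₗ[k] Y) : A →ₗ[k] Y :=
  LinearMap.mul' k Y ∘ₗ TensorProduct.map f g ∘ₗ comul

lemma convComul_apply {ι : Type*} {a : A} (𝓡 : Repr k a ι) :
    convComul f g a = ∑ i ∈ 𝓡.index, f (𝓡.left i) * g (𝓡.right i) := by
  simp [convComul, ← 𝓡.eq]

/-- The coproduct of A is multiplicative for the braided tensor product, and `hgf` says that x ⊗ y ↦
f(x)g(y) is an algebra map on that product. -/
lemma IsBraidedHopf.convComul_mul (h : IsBraidedHopf Ψ S) (hf : ∀ a b, f (a * b) = f a * f b)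
    (hg : ∀ a b, g (a * b) = g a * g b)
    (hgf : ∀ a b, g a * f b = LinearMap.mul' k Y (TensorProduct.map f g (Ψ (a ⊗ₜ[k] b))))
    (a b : A) : convComul f g (a * b) = convComul f g a * convComul f g b := by
  simp only [convComul, LinearMap.comp_apply, h.comul_mul]
  induction comul (R := k) a with
  | zero => simp
  | add x y hx hy => simp only [TensorProduct.add_tmul, map_add, add_mul, hx, hy]
  | tmul x x' =>
    induction comul (R := k) b with
    | zero => simp
    | add x y hx hy => simp only [TensorProduct.tmul_add, map_add, mul_add, hx, hy]
    | tmul y y' =>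
      rw [middle_tmul, TensorProduct.map_tmul, TensorProduct.map_tmul, LinearMap.mul'_apply,
        LinearMap.mul'_apply, mul_assoc, ← mul_assoc (g x'), hgf]
      induction Ψ (x' ⊗ₜ y) with
      | zero => simp
      | add x y hx hy => simp only [map_add, TensorProduct.add_tmul, TensorProduct.tmul_add, hx, hy,
          add_mul, mul_add]
      | tmul u v => simp [hf, hg, mul_assoc]

lemma IsBraidedHopf.convComul_one (h : IsBraidedHopf Ψ S) (hf : f 1 = 1) (hg : g 1 = 1) :
    convComul f g (1 : A) = 1 := by
  simp [convComul, h.comul_one, hf, hg]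

end BraidedHom

variable {k H B D U : Type*} [Field k] [Ring H] [HopfAlgebra k H]
  [Ring B] [Algebra k B] [Coalgebra k B] [Module Hᵐᵒᵖ B] [IsScalarTower k Hᵐᵒᵖ B]
  [Ring D] [Algebra k D] [Coalgebra k D] [Module H D] [IsScalarTower k H D]
  [Ring U] [Algebra k U] {R : (H ⊗[k] H)ˣ}
  {SB : B →ₗ[k] B} {SD : D →ₗ[k] D}
  {iD : D →ₐ[k] U} {iH : H →ₐ[k] U} {iB : B →ₐ[k] U}

variable (t : IsCrossedTriple iD iH iB) (hR : IsQuasitriangular R)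

/-- `d ↦ R⁻¹ (1 ⊗ d₍₁₎) R (d₍₂₎ ⊗ 1)`. -/
def comulLeft (hD : IsLeftBraidedGroup (R : H ⊗[k] H) SD) : D →ₐ[k] U ⊗[k] U :=
  AlgHom.ofLinearMap (convComul (adjLeft R iD iH)
      ((Algebra.TensorProduct.includeLeft : U →ₐ[k] U ⊗[k] U).comp iD).toLinearMap)
    (hD.convComul_one (adjLeft_one _ _) (by simp [Algebra.TensorProduct.one_def]))
    (hD.convComul_mul (adjLeft_mul _ _) (by simp) fun c d ↦ by
      obtain ⟨n, r, r', hr⟩ := TensorProduct.exists_sum_tmul_eq (R : H ⊗[k] H)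
      simpa [hr, leftBraiding] using tmul_one_mul_adjLeft t hR hr c d)

/-- `b ↦ R⁻¹ (b₍₁₎ ⊗ 1) R (1 ⊗ b₍₂₎)`. -/
def comulRight (hB : IsRightBraidedGroup (R : H ⊗[k] H) SB) : B →ₐ[k] U ⊗[k] U :=
  AlgHom.ofLinearMap (convComul (adjRight R iH iB)
      ((Algebra.TensorProduct.includeRight : U →ₐ[k] U ⊗[k] U).comp iB).toLinearMap)
    (hB.convComul_one (adjRight_one _ _) (by simp [Algebra.TensorProduct.one_def]))
    (hB.convComul_mul (adjRight_mul _ _) (by simp) fun c d ↦ by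
      obtain ⟨n, r, r', hr⟩ := TensorProduct.exists_sum_tmul_eq (R : H ⊗[k] H)
      simpa [hr, rightBraiding] using one_tmul_mul_adjRight t hR hr c d)

/-- `h ↦ h₍₁₎ ⊗ h₍₂₎`. -/
def comulMid (iH : H →ₐ[k] U) : H →ₐ[k] U ⊗[k] U :=
  (Algebra.TensorProduct.map iH iH).comp (Bialgebra.comulAlgHom k H)

-- The relation holds for 1 ⊗ d and the flipped coproduct of h, by `LeftRel.tensor` and the flip of
-- U ⊗ U. Conjugation by R replaces 1 ⊗ d by `adjLeft` and the flipped coproduct by Δ(h).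
include t hR in
lemma leftRel_adjLeft : LeftRel (leftAct k H D) (adjLeft R iD iH) (comulMid iH).toLinearMap := by
  refine LeftRel.conj ((t.leftRel.tensor iH.toLinearMap).comp_algHom
    (Algebra.TensorProduct.comm k U U : U ⊗[k] U →ₐ[k] U ⊗[k] U)) (unitR iH R) ?_ ?_
  · intro d
    simpa using unitR_mul_adjLeft iD iH d
  · intro h
    have := congrArg (Algebra.TensorProduct.map iH iH) (hR.comm_comul h)
    rw [map_mul, map_mul, ← coe_unitR, ← coe_unitR_inv, Units.eq_mul_inv_iff_mul_eq] at this
    simp only [comulMid, AlgHom.toLinearMap_apply, AlgHom.comp_apply, Bialgebra.comulAlgHom_apply,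
      LinearMap.comp_apply]
    rw [← this]
    congr 1
    induction comul (R := k) h with
    | zero => simp
    | add x y hx hy => simp only [map_add, hx, hy]
    | tmul x y => simp

include t hR in
lemma rightRel_adjRight : RightRel (rightAct k H B) (adjRight R iH iB)
    (comulMid iH).toLinearMap := by
  refine RightRel.conj ((t.rightRel.tensor iH.toLinearMap).comp_algHom
    (Algebra.TensorProduct.comm k U U : U ⊗[k] U →ₐ[k] U ⊗[k] U)) (unitR iH R) ?_ ?_
  · intro d
    simpa using unitR_mul_adjRight iH iB d
  · intro h
    have := congrArg (Algebra.TensorProduct.map iH iH) (hR.comm_comul h)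
    rw [map_mul, map_mul, ← coe_unitR, ← coe_unitR_inv, Units.eq_mul_inv_iff_mul_eq] at this
    simp only [comulMid, AlgHom.toLinearMap_apply, AlgHom.comp_apply, Bialgebra.comulAlgHom_apply,
      LinearMap.comp_apply]
    rw [← this]
    congr 1
    induction comul (R := k) h with
    | zero => simp
    | add x y hx hy => simp only [map_add, hx, hy]
    | tmul x y => simp

include t hR in
lemma commute_adj (b : B) (d : D) : Commute (adjRight R iH iB b) (adjLeft R iD iH d) := by
  have h : Commute (iB b ⊗ₜ[k] (1 : U)) ((1 : U) ⊗ₜ[k] iD d) := by simp [Commute, SemiconjBy]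
  rw [Commute, SemiconjBy, ← Units.mul_right_inj (unitR iH R), ← mul_assoc, unitR_mul_adjRight,
    mul_assoc, unitR_mul_adjLeft, ← mul_assoc, ← mul_assoc, unitR_mul_adjLeft, mul_assoc _ _
    (adjRight _ _ _ _), unitR_mul_adjRight, ← mul_assoc, h.eq]

include t hR in
lemma commute_adjRight_tmul_one (b : B) (d : D) :
    Commute (adjRight R iH iB b) (iD d ⊗ₜ[k] (1 : U)) := by
  obtain ⟨n, r, r', hr⟩ := TensorProduct.exists_sum_tmul_eq (R : H ⊗[k] H)
  rw [adjRight_eq_sum t hR hr]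
  exact Commute.sum_left _ _ _ fun i _ ↦ by simp [Commute, SemiconjBy, t.bd]

include t hR in
lemma commute_one_tmul_adjLeft (b : B) (d : D) :
    Commute ((1 : U) ⊗ₜ[k] iB b) (adjLeft R iD iH d) := by
  obtain ⟨n, s, s', hs⟩ := TensorProduct.exists_sum_tmul_eq ((R⁻¹ : (H ⊗[k] H)ˣ) : H ⊗[k] H)
  rw [adjLeft_eq_sum t hR hs]
  exact Commute.sum_right _ _ _ fun i _ ↦ by simp [Commute, SemiconjBy, t.bd]

/-- Δ(b) and Δ(d) have two factors each, and all four cross pairs commute. Those conjugated by R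
commute because b ⊗ 1 and 1 ⊗ d do. A conjugated factor and a plain one meet only in a leg where b
and d commute in U, and the plain factors lie in different legs. -/
lemma comul_isCrossedTriple (hD : IsLeftBraidedGroup (R : H ⊗[k] H) SD)
    (hB : IsRightBraidedGroup (R : H ⊗[k] H) SB) :
    IsCrossedTriple (comulLeft t hR hD) (comulMid iH) (comulRight t hR hB) where
  hd h d := by
    exact (((leftRel_adjLeft t hR).mul (t.leftRel.tensor iH.toLinearMap)).comp
      (p := comul) hD.comul_act) h d
  bh b h := by
    exact (((rightRel_adjRight t hR).mul (t.rightRel.tensor iH.toLinearMap)).comp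
      (p := comul) hB.comul_act) h b
  bd b d := by
    change Commute (convComul _ _ b) (convComul _ _ d)
    rw [convComul_apply (ℛ k b), convComul_apply (ℛ k d)]
    refine Commute.sum_left _ _ _ fun i _ ↦ Commute.sum_right _ _ _ fun j _ ↦ ?_
    refine Commute.mul_left ((commute_adj t hR _ _).mul_right (commute_adjRight_tmul_one t hR _ _))
      ((commute_one_tmul_adjLeft t hR _ _).mul_right ?_)
    simp [Commute, SemiconjBy]

end Coproduct

/-! ### Coassociativity from the Yang-Baxter equation. -/

section Bialgebra

open Coalgebra MulOpposite

/-- With a = R₁₂, b = R₁₃, c = R₂₃ and X, Y, Z in the three successive legs, the left side is a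
summand of (Δ ⊗ id)Δ on B and the right side the corresponding summand of (id ⊗ Δ)Δ. For D the roles
of R₁₂ and R₂₃ are exchanged. -/
lemma yangBaxter_conj {M : Type*} [Monoid M] {a b c : Mˣ} (e : a * b * c = c * b * a) {X Y Z : M}
    (hX : Commute (c : M) X) (hY : Commute (b : M) Y) :
    (↑(b * c)⁻¹ : M) * (↑a⁻¹ * X * a * Y) * ↑(b * c) * Z =
      (↑(b * a)⁻¹ : M) * X * ↑(b * a) * (↑c⁻¹ * Y * c * Z) := by
  have h1 : (b * c)⁻¹ * a⁻¹ = (b * a)⁻¹ * c⁻¹ := by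
    rw [← mul_inv_rev, ← mul_inv_rev, ← mul_assoc, ← mul_assoc, e]
  have h2 : c⁻¹ * a * b = b * a * c⁻¹ := by
    rw [eq_mul_inv_iff_mul_eq, mul_assoc, mul_assoc, ← mul_assoc a, e]
    group
  have h1' := congrArg (fun u : Mˣ ↦ (u : M)) h1
  have h2' := congrArg (fun u : Mˣ ↦ (u : M)) h2
  simp only [Units.val_mul] at h1' h2'
  calc _ = ((↑(b * c)⁻¹ : M) * ↑a⁻¹) * X * a * (Y * b) * c * Z := by
        simp only [Units.val_mul, mul_assoc]
    _ = (↑(b * a)⁻¹ : M) * (↑c⁻¹ * X) * a * (b * Y) * c * Z := by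
        rw [h1', hY.eq]
        simp only [mul_assoc]
    _ = (↑(b * a)⁻¹ : M) * X * (↑c⁻¹ * a * b) * Y * c * Z := by
        rw [hX.units_inv_left.eq]
        simp only [mul_assoc]
    _ = _ := by
        rw [h2']
        simp only [Units.val_mul, mul_assoc]

variable {k H B D U : Type*} [Field k] [Ring H] [HopfAlgebra k H]
  [Ring B] [Algebra k B] [Coalgebra k B] [Module Hᵐᵒᵖ B] [IsScalarTower k Hᵐᵒᵖ B]
  [Ring D] [Algebra k D] [Coalgebra k D] [Module H D] [IsScalarTower k H D]
  [Ring U] [Algebra k U] {R : (H ⊗[k] H)ˣ}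
  {SB : B →ₗ[k] B} {SD : D →ₗ[k] D}
  {iD : D →ₐ[k] U} {iH : H →ₐ[k] U} {iB : B →ₐ[k] U}

section Legs

variable (R) (iH : H →ₐ[k] U)

/-- `R₁₂` in `U ⊗ U ⊗ U`. -/
def unitR12 : (U ⊗[k] (U ⊗[k] U))ˣ := Units.map (leg12 k U : U ⊗[k] U →* _) (unitR iH R)
/-- `R₁₃` in `U ⊗ U ⊗ U`. -/
def unitR13 : (U ⊗[k] (U ⊗[k] U))ˣ := Units.map (leg13 k U : U ⊗[k] U →* _) (unitR iH R)
/-- `R₂₃` in `U ⊗ U ⊗ U`. -/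
def unitR23 : (U ⊗[k] (U ⊗[k] U))ˣ := Units.map (leg23 k U : U ⊗[k] U →* _) (unitR iH R)

/-- `iH ⊗ iH ⊗ iH`. -/
def map3 : H ⊗[k] (H ⊗[k] H) →ₐ[k] U ⊗[k] (U ⊗[k] U) :=
  Algebra.TensorProduct.map iH (Algebra.TensorProduct.map iH iH)

lemma map3_leg12 (x : H ⊗[k] H) :
    map3 iH (leg12 k H x) = leg12 k U (Algebra.TensorProduct.map iH iH x) := by
  refine DFunLike.congr_fun (f := (map3 iH).comp (leg12 k H))
    (g := (leg12 k U).comp (Algebra.TensorProduct.map iH iH)) ?_ x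
  ext <;> simp [map3]

lemma map3_leg13 (x : H ⊗[k] H) :
    map3 iH (leg13 k H x) = leg13 k U (Algebra.TensorProduct.map iH iH x) := by
  refine DFunLike.congr_fun (f := (map3 iH).comp (leg13 k H))
    (g := (leg13 k U).comp (Algebra.TensorProduct.map iH iH)) ?_ x
  ext <;> simp [map3]

lemma map3_leg23 (x : H ⊗[k] H) :
    map3 iH (leg23 k H x) = leg23 k U (Algebra.TensorProduct.map iH iH x) := by
  simp [map3]

variable {R}

lemma unitR_yangBaxter (hR : IsQuasitriangular R) :
    unitR12 R iH * unitR13 R iH * unitR23 R iH = unitR23 R iH * unitR13 R iH * unitR12 R iH := by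
  have := congrArg (map3 iH) hR.yangBaxter
  simp only [map_mul, map3_leg12, map3_leg13, map3_leg23] at this
  exact Units.ext this

variable {iH} {φ : U →ₐ[k] U ⊗[k] U}

lemma map3_expandLeft (hφ : ∀ h, φ (iH h) = comulMid iH h) (x : H ⊗[k] H) :
    expandLeft k φ (Algebra.TensorProduct.map iH iH x) =
      map3 iH (expandLeft k (Bialgebra.comulAlgHom k H) x) := by
  induction x with
  | zero => simp
  | add x y hx hy => simp only [map_add, hx, hy]
  | tmul x y =>
    simp only [Algebra.TensorProduct.map_tmul, expandLeft_tmul, hφ, comulMid, AlgHom.comp_apply]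
    induction Bialgebra.comulAlgHom k H x with
    | zero => simp
    | add x y hx hy => simp only [map_add, TensorProduct.add_tmul, hx, hy]
    | tmul x y => simp [map3]

lemma map3_expandRight (hφ : ∀ h, φ (iH h) = comulMid iH h) (x : H ⊗[k] H) :
    expandRight k φ (Algebra.TensorProduct.map iH iH x) =
      map3 iH (expandRight k (Bialgebra.comulAlgHom k H) x) := by
  induction x with
  | zero => simp
  | add x y hx hy => simp only [map_add, hx, hy]
  | tmul x y =>
    simp [hφ, comulMid, map3]

lemma expandLeft_unitR (hR : IsQuasitriangular R) (hφ : ∀ h, φ (iH h) = comulMid iH h) :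
    Units.map (expandLeft k φ : U ⊗[k] U →* _) (unitR iH R) = unitR13 R iH * unitR23 R iH := by
  refine Units.ext ?_
  change expandLeft k φ (Algebra.TensorProduct.map iH iH R) = _
  rw [map3_expandLeft hφ, hR.expandLeft_eq, map_mul, map3_leg13, map3_leg23]
  rfl

lemma expandRight_unitR (hR : IsQuasitriangular R) (hφ : ∀ h, φ (iH h) = comulMid iH h) :
    Units.map (expandRight k φ : U ⊗[k] U →* _) (unitR iH R) = unitR13 R iH * unitR12 R iH := by
  refine Units.ext ?_
  change expandRight k φ (Algebra.TensorProduct.map iH iH R) = _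
  rw [map3_expandRight hφ, hR.expandRight_eq, map_mul, map3_leg13, map3_leg12]
  rfl

lemma commute_unitR12 (u : U) : Commute (unitR12 R iH : U ⊗[k] (U ⊗[k] U)) (1 ⊗ₜ (1 ⊗ₜ u)) := by
  change Commute (leg12 k U (unitR iH R : U ⊗[k] U)) _
  induction (unitR iH R : U ⊗[k] U) with
  | zero => simp
  | add x y hx hy => rw [map_add]; exact hx.add_left hy
  | tmul x y => simp [Commute, SemiconjBy]

lemma commute_unitR13 (u : U) : Commute (unitR13 R iH : U ⊗[k] (U ⊗[k] U)) (1 ⊗ₜ (u ⊗ₜ 1)) := by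
  change Commute (leg13 k U (unitR iH R : U ⊗[k] U)) _
  induction (unitR iH R : U ⊗[k] U) with
  | zero => simp
  | add x y hx hy => rw [map_add]; exact hx.add_left hy
  | tmul x y => simp [Commute, SemiconjBy]

lemma commute_unitR23 (u : U) : Commute (unitR23 R iH : U ⊗[k] (U ⊗[k] U)) (u ⊗ₜ (1 ⊗ₜ 1)) := by
  change Commute (leg23 k U (unitR iH R : U ⊗[k] U)) _
  induction (unitR iH R : U ⊗[k] U) with
  | zero => simp
  | add x y hx hy => rw [map_add]; exact hx.add_left hy
  | tmul x y => simp [Commute, SemiconjBy]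

lemma map_conj {X Y : Type*} [Ring X] [Algebra k X] [Ring Y] [Algebra k Y] (f : X →ₐ[k] Y)
    (u : Xˣ) (x : X) :
    f ((↑u⁻¹ : X) * x * u) =
      (↑(Units.map (f : X →* Y) u)⁻¹ : Y) * f x * (Units.map (f : X →* Y) u : Y) := by
  simp [map_mul]

lemma expandLeft_tmul_one (u : U) : expandLeft k φ (u ⊗ₜ 1) = leg12 k U (φ u) := by
  rw [expandLeft_tmul]
  induction φ u with
  | zero => simp
  | add x y hx hy => simp only [map_add, TensorProduct.add_tmul, hx, hy]
  | tmul x y => simp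

lemma expandLeft_one_tmul (u : U) : expandLeft k φ (1 ⊗ₜ u) = 1 ⊗ₜ (1 ⊗ₜ u) := by
  rw [expandLeft_tmul, map_one, Algebra.TensorProduct.one_def, TensorProduct.assoc_tmul]

lemma expandRight_tmul_one (u : U) : expandRight k φ (u ⊗ₜ 1) = u ⊗ₜ (1 ⊗ₜ 1) := by
  rw [expandRight_tmul, map_one, Algebra.TensorProduct.one_def]

end Legs

section Coassoc

variable {φ : U →ₐ[k] U ⊗[k] U}

variable (k R iH) in
lemma expandLeft_adjRight (hR : IsQuasitriangular R) (hH : ∀ h, φ (iH h) = comulMid iH h)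
    (x x' : U) :
    expandLeft k φ (((↑(unitR iH R)⁻¹ : U ⊗[k] U) * (x ⊗ₜ 1) * (unitR iH R : U ⊗[k] U)) * (1 ⊗ₜ x')) =
      (↑(unitR13 R iH * unitR23 R iH)⁻¹ : U ⊗[k] (U ⊗[k] U)) * leg12 k U (φ x) *
        (↑(unitR13 R iH * unitR23 R iH) : U ⊗[k] (U ⊗[k] U)) * (1 ⊗ₜ (1 ⊗ₜ x')) := by
  rw [map_mul, map_conj, expandLeft_unitR hR hH, expandLeft_tmul_one, expandLeft_one_tmul]

variable (k R iH) in
lemma expandRight_adjRight (hR : IsQuasitriangular R) (hH : ∀ h, φ (iH h) = comulMid iH h)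
    (x x' : U) :
    expandRight k φ (((↑(unitR iH R)⁻¹ : U ⊗[k] U) * (x ⊗ₜ 1) * (unitR iH R : U ⊗[k] U)) * (1 ⊗ₜ x')) =
      (↑(unitR13 R iH * unitR12 R iH)⁻¹ : U ⊗[k] (U ⊗[k] U)) * (x ⊗ₜ (1 ⊗ₜ 1)) *
        (↑(unitR13 R iH * unitR12 R iH) : U ⊗[k] (U ⊗[k] U)) * leg23 k U (φ x') := by
  rw [map_mul, map_conj, expandRight_unitR hR hH, expandRight_tmul_one]
  rfl

variable (k R iH) in
lemma expandLeft_adjLeft (hR : IsQuasitriangular R) (hH : ∀ h, φ (iH h) = comulMid iH h)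
    (x x' : U) :
    expandLeft k φ (((↑(unitR iH R)⁻¹ : U ⊗[k] U) * (1 ⊗ₜ x) * (unitR iH R : U ⊗[k] U)) * (x' ⊗ₜ 1)) =
      (↑(unitR13 R iH * unitR23 R iH)⁻¹ : U ⊗[k] (U ⊗[k] U)) * (1 ⊗ₜ (1 ⊗ₜ x)) *
        (↑(unitR13 R iH * unitR23 R iH) : U ⊗[k] (U ⊗[k] U)) * leg12 k U (φ x') := by
  rw [map_mul, map_conj, expandLeft_unitR hR hH, expandLeft_tmul_one, expandLeft_one_tmul]

variable (k R iH) in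
lemma expandRight_adjLeft (hR : IsQuasitriangular R) (hH : ∀ h, φ (iH h) = comulMid iH h)
    (x x' : U) :
    expandRight k φ (((↑(unitR iH R)⁻¹ : U ⊗[k] U) * (1 ⊗ₜ x) * (unitR iH R : U ⊗[k] U)) * (x' ⊗ₜ 1)) =
      (↑(unitR13 R iH * unitR12 R iH)⁻¹ : U ⊗[k] (U ⊗[k] U)) * leg23 k U (φ x) *
        (↑(unitR13 R iH * unitR12 R iH) : U ⊗[k] (U ⊗[k] U)) * (x' ⊗ₜ (1 ⊗ₜ 1)) := by
  rw [map_mul, map_conj, expandRight_unitR hR hH, expandRight_tmul_one]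
  rfl

lemma convComul_adjRight {b : B} {ι : Type*} (𝓡 : Repr k b ι) :
    convComul (adjRight R iH iB)
      ((Algebra.TensorProduct.includeRight : U →ₐ[k] U ⊗[k] U).comp iB).toLinearMap b =
    ∑ i ∈ 𝓡.index, ((((unitR iH R)⁻¹ : (U ⊗[k] U)ˣ) : U ⊗[k] U) *
      (iB (𝓡.left i) ⊗ₜ[k] (1 : U)) * (unitR iH R : U ⊗[k] U)) * (1 ⊗ₜ iB (𝓡.right i)) :=
  (convComul_apply 𝓡).trans (by simp [adjRight_apply])

lemma convComul_adjLeft {d : D} {ι : Type*} (𝓡 : Repr k d ι) :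
    convComul (adjLeft R iD iH)
      ((Algebra.TensorProduct.includeLeft : U →ₐ[k] U ⊗[k] U).comp iD).toLinearMap d =
    ∑ i ∈ 𝓡.index, ((((unitR iH R)⁻¹ : (U ⊗[k] U)ˣ) : U ⊗[k] U) *
      ((1 : U) ⊗ₜ[k] iD (𝓡.left i)) * (unitR iH R : U ⊗[k] U)) * (iD (𝓡.right i) ⊗ₜ 1) :=
  (convComul_apply 𝓡).trans (by simp [adjLeft_apply])

/-- Coassociativity of B matches the two triple sums, after which summands agree by
`yangBaxter_conj`: b₍₁₎ in the first leg commutes with R₂₃ and b₍₂₎ in the second with R₁₃. -/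
lemma expandLeft_comulRight (hR : IsQuasitriangular R) (hH : ∀ h, φ (iH h) = comulMid iH h)
    (hφ : ∀ b, φ (iB b) = convComul (adjRight R iH iB)
      ((Algebra.TensorProduct.includeRight : U →ₐ[k] U ⊗[k] U).comp iB).toLinearMap b) (b : B) :
    expandLeft k φ (φ (iB b)) = expandRight k φ (φ (iB b)) := by
  have key := congrArg (LinearMap.mul' k (U ⊗[k] (U ⊗[k] U)) ∘ₗ
      TensorProduct.map (LinearMap.mulLeft k
          (↑((unitR13 R iH * unitR12 R iH)⁻¹) : U ⊗[k] (U ⊗[k] U)) ∘ₗ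
        LinearMap.mulRight k (↑(unitR13 R iH * unitR12 R iH) : U ⊗[k] (U ⊗[k] U)) ∘ₗ
        (Algebra.TensorProduct.includeLeft.comp iB : B →ₐ[k] U ⊗[k] (U ⊗[k] U)).toLinearMap)
      ((leg23 k U).toLinearMap ∘ₗ LinearMap.mul' k (U ⊗[k] U) ∘ₗ TensorProduct.map
        (adjRight R iH iB)
        ((Algebra.TensorProduct.includeRight : U →ₐ[k] U ⊗[k] U).comp iB).toLinearMap))
      (sum_tmul_tmul_eq (ℛ k b) (fun i ↦ ℛ k ((ℛ k b).left i)) (fun i ↦ ℛ k ((ℛ k b).right i)))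
  simp only [map_sum, LinearMap.comp_apply, TensorProduct.map_tmul, LinearMap.mul'_apply,
    LinearMap.mulLeft_apply, LinearMap.mulRight_apply, AlgHom.toLinearMap_apply,
    AlgHom.comp_apply, Algebra.TensorProduct.includeLeft_apply,
    Algebra.TensorProduct.includeRight_apply, adjRight_apply] at key
  rw [hφ, convComul_adjRight (ℛ k b)]
  simp only [map_sum, expandLeft_adjRight k R iH hR hH, expandRight_adjRight k R iH hR hH, hφ,
    fun i ↦ convComul_adjRight (R := R) (iH := iH) (iB := iB) (ℛ k ((ℛ k b).left i)),
    fun i ↦ convComul_adjRight (R := R) (iH := iH) (iB := iB) (ℛ k ((ℛ k b).right i)),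
    Finset.mul_sum, Finset.sum_mul]
  refine Eq.trans (Finset.sum_congr rfl fun i _ ↦ Finset.sum_congr rfl fun j _ ↦ ?_)
    (key.trans (Finset.sum_congr rfl fun i _ ↦ Finset.sum_congr rfl fun j _ ↦ ?_))
  · rw [map_mul, map_conj]
    refine (yangBaxter_conj (unitR_yangBaxter iH hR) (commute_unitR23 _)
      (commute_unitR13 _)).trans ?_
    rw [map_mul (leg23 k U), map_conj (leg23 k U)]
    simp only [mul_assoc]
    rfl
  · simp only [mul_assoc]
    rfl

lemma expandLeft_comulLeft (hR : IsQuasitriangular R) (hH : ∀ h, φ (iH h) = comulMid iH h)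
    (hφ : ∀ d, φ (iD d) = convComul (adjLeft R iD iH)
      ((Algebra.TensorProduct.includeLeft : U →ₐ[k] U ⊗[k] U).comp iD).toLinearMap d) (d : D) :
    expandLeft k φ (φ (iD d)) = expandRight k φ (φ (iD d)) := by
  have key := congrArg (LinearMap.mul' k (U ⊗[k] (U ⊗[k] U)) ∘ₗ
      TensorProduct.map (LinearMap.mulLeft k
          (↑((unitR13 R iH * unitR23 R iH)⁻¹) : U ⊗[k] (U ⊗[k] U)) ∘ₗ
        LinearMap.mulRight k (↑(unitR13 R iH * unitR23 R iH) : U ⊗[k] (U ⊗[k] U)) ∘ₗ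
        ((Algebra.TensorProduct.includeRight.comp Algebra.TensorProduct.includeRight).comp iD :
          D →ₐ[k] U ⊗[k] (U ⊗[k] U)).toLinearMap)
      ((leg12 k U).toLinearMap ∘ₗ LinearMap.mul' k (U ⊗[k] U) ∘ₗ TensorProduct.map
        (adjLeft R iD iH)
        ((Algebra.TensorProduct.includeLeft : U →ₐ[k] U ⊗[k] U).comp iD).toLinearMap))
      (sum_tmul_tmul_eq (ℛ k d) (fun i ↦ ℛ k ((ℛ k d).left i)) (fun i ↦ ℛ k ((ℛ k d).right i)))
  simp only [map_sum, LinearMap.comp_apply, TensorProduct.map_tmul, LinearMap.mul'_apply,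
    LinearMap.mulLeft_apply, LinearMap.mulRight_apply, AlgHom.toLinearMap_apply,
    AlgHom.comp_apply, Algebra.TensorProduct.includeLeft_apply,
    Algebra.TensorProduct.includeRight_apply, adjLeft_apply] at key
  rw [hφ, convComul_adjLeft (ℛ k d)]
  simp only [map_sum, expandLeft_adjLeft k R iH hR hH, expandRight_adjLeft k R iH hR hH, hφ,
    fun i ↦ convComul_adjLeft (R := R) (iH := iH) (iD := iD) (ℛ k ((ℛ k d).left i)),
    fun i ↦ convComul_adjLeft (R := R) (iH := iH) (iD := iD) (ℛ k ((ℛ k d).right i)),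
    Finset.mul_sum, Finset.sum_mul]
  refine Eq.symm (Eq.trans (Finset.sum_congr rfl fun i _ ↦ Finset.sum_congr rfl fun j _ ↦ ?_)
    (key.trans (Finset.sum_congr rfl fun i _ ↦ Finset.sum_congr rfl fun j _ ↦ ?_)))
  · rw [map_mul, map_conj]
    refine (yangBaxter_conj (unitR_yangBaxter iH hR).symm (commute_unitR12 _)
      (commute_unitR13 _)).trans ?_
    rw [map_mul (leg12 k U), map_conj (leg12 k U)]
    simp only [mul_assoc]
    rfl
  · simp only [mul_assoc]

end Coassoc

end Bialgebra

/-! ### The counit, and the bialgebra on the crossed triple algebra. -/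

section CrossedBialgebra

universe uU

open Coalgebra MulOpposite

variable {k H B D U : Type*} [Field k] [Ring H] [HopfAlgebra k H]
  [Ring B] [Algebra k B] [Coalgebra k B] [Module Hᵐᵒᵖ B] [IsScalarTower k Hᵐᵒᵖ B]
  [Ring D] [Algebra k D] [Coalgebra k D] [Module H D] [IsScalarTower k H D]
  [Ring U] {R : (H ⊗[k] H)ˣ} {SB : B →ₗ[k] B} {SD : D →ₗ[k] D}

/-- A bialgebra structure on the crossed triple algebra in which the coproducts of `D` and `B` are
twisted by `R`. -/
structure IsCrossedBialgebra [Bialgebra k U] (R : (H ⊗[k] H)ˣ) (iD : D →ₐ[k] U) (iH : H →ₐ[k] U)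
    (iB : B →ₐ[k] U) : Prop extends IsCrossedTriple iD iH iB where
  bijective : Function.Bijective (tripleMap iD.toLinearMap iH.toLinearMap iB.toLinearMap)
  comul_left : ∀ d, comul (R := k) (iD d) = convComul (adjLeft R iD iH)
      ((Algebra.TensorProduct.includeLeft : U →ₐ[k] U ⊗[k] U).comp iD).toLinearMap d
  comul_mid : ∀ h, comul (R := k) (iH h) = TensorProduct.map iH.toLinearMap iH.toLinearMap
      (comul (R := k) h)
  comul_right : ∀ b, comul (R := k) (iB b) = convComul (adjRight R iH iB)
      ((Algebra.TensorProduct.includeRight : U →ₐ[k] U ⊗[k] U).comp iB).toLinearMap b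
  counit_left : ∀ d, counit (R := k) (iD d) = counit (R := k) d
  counit_mid : ∀ h, counit (R := k) (iH h) = counit (R := k) h
  counit_right : ∀ b, counit (R := k) (iB b) = counit (R := k) b

section

variable {A : Type*} [Ring A] [Algebra k A] [Coalgebra k A] {Ψ : A ⊗[k] A →ₗ[k] A ⊗[k] A}
  {S : A →ₗ[k] A}

/-- The counit of a braided Hopf algebra. -/
def IsBraidedHopf.counitHom (h : IsBraidedHopf Ψ S) : A →ₐ[k] k :=
  AlgHom.ofLinearMap counit h.counit_one h.counit_mul

@[simp] lemma IsBraidedHopf.counitHom_apply (h : IsBraidedHopf Ψ S) (a : A) :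
    h.counitHom a = counit (R := k) a := rfl

end

lemma counit_isCrossedTriple (hD : IsLeftBraidedGroup (R : H ⊗[k] H) SD)
    (hB : IsRightBraidedGroup (R : H ⊗[k] H) SB) :
    IsCrossedTriple hD.counitHom (Bialgebra.counitAlgHom k H) hB.counitHom where
  hd h d := by
    conv_lhs => rw [← sum_counit_smul (ℛ k h)]
    rw [← (ℛ k h).eq]
    simp [hD.counit_act, Finset.sum_mul]
    refine Finset.sum_congr rfl fun i _ ↦ by ring
  bh b h := by
    conv_lhs => rw [← sum_counit_smul (ℛ k h)]
    rw [← (ℛ k h).eq]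
    simp [hB.counit_act, Finset.mul_sum]
    refine Finset.sum_congr rfl fun i _ ↦ by ring
  bd b d := mul_comm _ _

section Counit

variable [Algebra k U] {iD : D →ₐ[k] U} {iH : H →ₐ[k] U} {iB : B →ₐ[k] U} {ε : U →ₐ[k] k}

lemma counit_unitR_left (hR : IsQuasitriangular R) (hε : ∀ h, ε (iH h) = counit (R := k) h) :
    Algebra.TensorProduct.map ε (AlgHom.id k U) (unitR iH R : U ⊗[k] U) = 1 := by
  obtain ⟨n, r, r', hr⟩ := TensorProduct.exists_sum_tmul_eq (R : H ⊗[k] H)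
  have := congrArg (fun x ↦ (1 : k) ⊗ₜ[k] iH x) (hR.sum_counit_left hr)
  simp only [map_sum, map_smul, TensorProduct.tmul_sum, map_one] at this
  rw [coe_unitR, hr]
  simp only [map_sum, Algebra.TensorProduct.map_tmul, hε, AlgHom.id_apply]
  rw [Algebra.TensorProduct.one_def, ← this]
  refine Finset.sum_congr rfl fun i _ ↦ ?_
  rw [← TensorProduct.smul_tmul, smul_eq_mul, mul_one]

lemma counit_unitR_right (hR : IsQuasitriangular R) (hε : ∀ h, ε (iH h) = counit (R := k) h) :
    Algebra.TensorProduct.map (AlgHom.id k U) ε (unitR iH R : U ⊗[k] U) = 1 := by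
  obtain ⟨n, r, r', hr⟩ := TensorProduct.exists_sum_tmul_eq (R : H ⊗[k] H)
  have := congrArg (fun x ↦ iH x ⊗ₜ[k] (1 : k)) (hR.sum_counit_right hr)
  simp only [map_sum, map_smul, TensorProduct.sum_tmul, map_one] at this
  rw [coe_unitR, hr]
  simp only [map_sum, Algebra.TensorProduct.map_tmul, hε, AlgHom.id_apply]
  rw [Algebra.TensorProduct.one_def, ← this]
  refine Finset.sum_congr rfl fun i _ ↦ ?_
  rw [TensorProduct.smul_tmul, smul_eq_mul, mul_one]

/-- Applied with f the counit on one leg, which sends R to 1. The twisted coproducts thus inherit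
the counit laws of D and B. -/
lemma map_conj_mul {X Y : Type*} [Ring X] [Algebra k X] [Ring Y] [Algebra k Y] (f : X →ₐ[k] Y)
    (u : Xˣ) (h : f u = 1) (x y : X) :
    f ((↑u⁻¹ : X) * x * u * y) = f x * f y := by
  have h' : f (↑u⁻¹ : X) = 1 := by
    have := map_one f
    rwa [← Units.inv_mul u, map_mul, h, mul_one] at this
  simp only [map_mul, h, h', mul_one, one_mul]

lemma counit_convComul_adjRight (hR : IsQuasitriangular R)
    (hε : ∀ h, ε (iH h) = counit (R := k) h) (hB : ∀ b, ε (iB b) = counit (R := k) b) (b : B) :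
    Algebra.TensorProduct.map ε (AlgHom.id k U) (convComul (adjRight R iH iB)
      ((Algebra.TensorProduct.includeRight : U →ₐ[k] U ⊗[k] U).comp iB).toLinearMap b) =
      1 ⊗ₜ iB b := by
  rw [convComul_adjRight (ℛ k b)]
  conv_rhs => rw [← sum_counit_smul (ℛ k b)]
  simp only [map_sum, map_conj_mul _ _ (counit_unitR_left hR hε), one_mul, mul_one, Algebra.TensorProduct.map_tmul, hB, AlgHom.id_apply, map_one, one_mul, mul_one,
    Algebra.TensorProduct.tmul_mul_tmul, map_smul, TensorProduct.tmul_sum]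
  refine Finset.sum_congr rfl fun i _ ↦ ?_
  rw [← TensorProduct.smul_tmul, smul_eq_mul, mul_one]

lemma convComul_adjRight_counit (hR : IsQuasitriangular R)
    (hε : ∀ h, ε (iH h) = counit (R := k) h) (hB : ∀ b, ε (iB b) = counit (R := k) b) (b : B) :
    Algebra.TensorProduct.map (AlgHom.id k U) ε (convComul (adjRight R iH iB)
      ((Algebra.TensorProduct.includeRight : U →ₐ[k] U ⊗[k] U).comp iB).toLinearMap b) =
      iB b ⊗ₜ 1 := by
  rw [convComul_adjRight (ℛ k b)]
  have := congrArg (TensorProduct.map iB.toLinearMap (LinearMap.id : k →ₗ[k] k))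
    (sum_tmul_counit_eq (ℛ k b))
  simp only [map_sum, TensorProduct.map_tmul, LinearMap.id_apply, AlgHom.toLinearMap_apply] at this
  simp only [map_sum, map_conj_mul _ _ (counit_unitR_right hR hε), one_mul, mul_one, Algebra.TensorProduct.map_tmul, hB, AlgHom.id_apply, map_one, one_mul, mul_one,
    Algebra.TensorProduct.tmul_mul_tmul, this]

lemma counit_convComul_adjLeft (hR : IsQuasitriangular R)
    (hε : ∀ h, ε (iH h) = counit (R := k) h) (hD : ∀ d, ε (iD d) = counit (R := k) d) (d : D) :
    Algebra.TensorProduct.map ε (AlgHom.id k U) (convComul (adjLeft R iD iH)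
      ((Algebra.TensorProduct.includeLeft : U →ₐ[k] U ⊗[k] U).comp iD).toLinearMap d) =
      1 ⊗ₜ iD d := by
  rw [convComul_adjLeft (ℛ k d)]
  have := congrArg ((TensorProduct.comm k U k).toLinearMap ∘ₗ
    TensorProduct.map iD.toLinearMap (LinearMap.id : k →ₗ[k] k)) (sum_tmul_counit_eq (ℛ k d))
  simp only [map_sum, TensorProduct.map_tmul, LinearMap.id_apply, AlgHom.toLinearMap_apply,
    LinearMap.comp_apply, LinearEquiv.coe_coe, TensorProduct.comm_tmul] at this
  simp only [map_sum, map_conj_mul _ _ (counit_unitR_left hR hε), one_mul, mul_one, Algebra.TensorProduct.map_tmul, hD, AlgHom.id_apply, map_one, one_mul, mul_one,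
    Algebra.TensorProduct.tmul_mul_tmul, this]

lemma convComul_adjLeft_counit (hR : IsQuasitriangular R)
    (hε : ∀ h, ε (iH h) = counit (R := k) h) (hD : ∀ d, ε (iD d) = counit (R := k) d) (d : D) :
    Algebra.TensorProduct.map (AlgHom.id k U) ε (convComul (adjLeft R iD iH)
      ((Algebra.TensorProduct.includeLeft : U →ₐ[k] U ⊗[k] U).comp iD).toLinearMap d) =
      iD d ⊗ₜ 1 := by
  rw [convComul_adjLeft (ℛ k d)]
  conv_rhs => rw [← sum_counit_smul (ℛ k d)]
  simp only [map_sum, map_conj_mul _ _ (counit_unitR_right hR hε), one_mul, mul_one, Algebra.TensorProduct.map_tmul, hD, AlgHom.id_apply, map_one, one_mul, mul_one,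
    Algebra.TensorProduct.tmul_mul_tmul, map_smul, TensorProduct.sum_tmul]
  refine Finset.sum_congr rfl fun i _ ↦ ?_
  rw [TensorProduct.smul_tmul, smul_eq_mul, mul_one]

end Counit

/-- Coproduct and counit come from the universal property, so they are algebra maps and the
coalgebra axioms need checking only on D, H and B. -/
theorem IsCrossedTriple.exists_crossedBialgebra {U : Type uU} [Ring U] [Algebra k U] {iD : D →ₐ[k] U} {iH : H →ₐ[k] U}
    {iB : B →ₐ[k] U} (t : IsCrossedTriple iD iH iB)
    (bij : Function.Bijective (tripleMap iD.toLinearMap iH.toLinearMap iB.toLinearMap))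
    (hR : IsQuasitriangular R) (hD : IsLeftBraidedGroup (R : H ⊗[k] H) SD)
    (hB : IsRightBraidedGroup (R : H ⊗[k] H) SB) :
    ∃ (V : Type uU) (_ : Ring V) (_ : Bialgebra k V) (jD : D →ₐ[k] V) (jH : H →ₐ[k] V)
      (jB : B →ₐ[k] V), IsCrossedBialgebra R jD jH jB := by
  let δ : U →ₐ[k] U ⊗[k] U := t.lift bij (comul_isCrossedTriple t hR hD hB)
  let ε : U →ₐ[k] k := t.lift bij (counit_isCrossedTriple hD hB)
  have δD (d) : δ (iD d) = convComul (adjLeft R iD iH)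
      ((Algebra.TensorProduct.includeLeft : U →ₐ[k] U ⊗[k] U).comp iD).toLinearMap d :=
    t.lift_left bij _ d
  have δH (h) : δ (iH h) = comulMid iH h := t.lift_mid bij _ h
  have δB (b) : δ (iB b) = convComul (adjRight R iH iB)
      ((Algebra.TensorProduct.includeRight : U →ₐ[k] U ⊗[k] U).comp iB).toLinearMap b :=
    t.lift_right bij _ b
  have εD (d) : ε (iD d) = counit (R := k) d := t.lift_left bij _ d
  have εH (h) : ε (iH h) = counit (R := k) h := t.lift_mid bij _ h
  have εB (b) : ε (iB b) = counit (R := k) b := t.lift_right bij _ b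
  letI inst : Bialgebra k U := Bialgebra.ofAlgHom δ ε
    (algHom_ext_of_tripleMap bij.2 (expandLeft_comulLeft hR δH δD)
      (fun h ↦ by
        change expandLeft k δ (δ (iH h)) = expandRight k δ (δ (iH h))
        simp only [δH, comulMid, AlgHom.comp_apply]
        rw [map3_expandLeft δH, map3_expandRight δH]
        exact congrArg (map3 iH) (coassoc_apply h))
      (expandLeft_comulRight hR δH δB))
    (algHom_ext_of_tripleMap bij.2
      (fun d ↦ by
        change Algebra.TensorProduct.map ε (AlgHom.id k U) (δ (iD d)) = _
        rw [δD, counit_convComul_adjLeft hR εH εD]; rfl)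
      (fun h ↦ by
        change Algebra.TensorProduct.map ε (AlgHom.id k U) (δ (iH h)) = _
        rw [δH]
        have := congrArg (TensorProduct.map (LinearMap.id : k →ₗ[k] k) iH.toLinearMap)
          (sum_counit_tmul_eq (ℛ k h))
        simp only [map_sum, TensorProduct.map_tmul, LinearMap.id_apply,
          AlgHom.toLinearMap_apply] at this
        simp only [comulMid, AlgHom.comp_apply, Bialgebra.comulAlgHom_apply]
        rw [← (ℛ k h).eq]
        simp only [map_sum, Algebra.TensorProduct.map_tmul, εH, AlgHom.id_apply, this]
        rfl)
      (fun b ↦ by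
        change Algebra.TensorProduct.map ε (AlgHom.id k U) (δ (iB b)) = _
        rw [δB, counit_convComul_adjRight hR εH εB]; rfl))
    (algHom_ext_of_tripleMap bij.2
      (fun d ↦ by
        change Algebra.TensorProduct.map (AlgHom.id k U) ε (δ (iD d)) = _
        rw [δD, convComul_adjLeft_counit hR εH εD]; rfl)
      (fun h ↦ by
        change Algebra.TensorProduct.map (AlgHom.id k U) ε (δ (iH h)) = _
        rw [δH]
        have := congrArg (TensorProduct.map iH.toLinearMap (LinearMap.id : k →ₗ[k] k))
          (sum_tmul_counit_eq (ℛ k h))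
        simp only [map_sum, TensorProduct.map_tmul, LinearMap.id_apply,
          AlgHom.toLinearMap_apply] at this
        simp only [comulMid, AlgHom.comp_apply, Bialgebra.comulAlgHom_apply]
        rw [← (ℛ k h).eq]
        simp only [map_sum, Algebra.TensorProduct.map_tmul, εH, AlgHom.id_apply, this]
        rfl)
      (fun b ↦ by
        change Algebra.TensorProduct.map (AlgHom.id k U) ε (δ (iB b)) = _
        rw [δB, convComul_adjRight_counit hR εH εB]; rfl))
  exact ⟨U, _, inst, iD, iH, iB,
    { t with
      bijective := bij
      comul_left := δD
      comul_mid := δH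
      comul_right := δB
      counit_left := εD
      counit_mid := εH
      counit_right := εB }⟩

end CrossedBialgebra

/-! ### The projections of the crossed triple algebra onto D and B. -/

section Projections

open Coalgebra MulOpposite

variable {k H B D U : Type*} [Field k] [Ring H] [HopfAlgebra k H]
  [Ring B] [Algebra k B] [Coalgebra k B] [Module Hᵐᵒᵖ B] [IsScalarTower k Hᵐᵒᵖ B]
  [Ring D] [Algebra k D] [Coalgebra k D] [Module H D] [IsScalarTower k H D]
  [Ring U] {R : (H ⊗[k] H)ˣ} {SB : B →ₗ[k] B} {SD : D →ₗ[k] D}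

section

variable {A M : Type*} [AddCommGroup A] [Module k A] [Coalgebra k A] [AddCommGroup M] [Module k M]
  {ι : Type*} {a : A}

lemma sum_counit_smul_map (𝓡 : Repr k a ι) (f : A →ₗ[k] M) :
    ∑ i ∈ 𝓡.index, counit (R := k) (𝓡.left i) • f (𝓡.right i) = f a := by
  conv_rhs => rw [← sum_counit_smul 𝓡]
  simp

lemma sum_counit_right_smul_map (𝓡 : Repr k a ι) (f : A →ₗ[k] M) :
    ∑ i ∈ 𝓡.index, counit (R := k) (𝓡.right i) • f (𝓡.left i) = f a := by
  have := congrArg ((TensorProduct.lid k M).toLinearMap ∘ₗ (TensorProduct.comm k M k).toLinearMap ∘ₗ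
    TensorProduct.map f LinearMap.id) (sum_tmul_counit_eq 𝓡)
  simpa only [map_sum, LinearMap.comp_apply, LinearEquiv.coe_coe, TensorProduct.map_tmul,
    LinearMap.id_apply, TensorProduct.comm_tmul, TensorProduct.lid_tmul, one_smul] using this

end

variable [Bialgebra k U] {iD : D →ₐ[k] U} {iH : H →ₐ[k] U} {iB : B →ₐ[k] U}

namespace IsCrossedBialgebra

variable (w : IsCrossedBialgebra R iD iH iB)

/-- The linear isomorphism `d ⊗ h ⊗ b ↦ d h b`. -/
def equiv : D ⊗[k] (H ⊗[k] B) ≃ₗ[k] U := LinearEquiv.ofBijective _ w.bijective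

@[simp] lemma equiv_tmul (d : D) (h : H) (b : B) : w.equiv (d ⊗ₜ (h ⊗ₜ b)) = iD d * (iH h * iB b) :=
  rfl

lemma equiv_symm (d : D) (h : H) (b : B) :
    w.equiv.symm (iD d * (iH h * iB b)) = d ⊗ₜ (h ⊗ₜ b) := by
  rw [LinearEquiv.symm_apply_eq, equiv_tmul]

include w in
@[elab_as_elim]
lemma ind {P : U → Prop} (h0 : P 0) (ha : ∀ x y, P x → P y → P (x + y))
    (hP : ∀ d h b, P (iD d * (iH h * iB b))) (u : U) : P u := by
  obtain ⟨z, rfl⟩ := w.equiv.surjective u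
  induction z with
  | zero => simpa using h0
  | add x y hx hy => rw [map_add]; exact ha _ _ hx hy
  | tmul d z =>
    induction z with
    | zero => simpa using h0
    | add x y hx hy => rw [TensorProduct.tmul_add, map_add]; exact ha _ _ hx hy
    | tmul h b => exact hP d h b

/-- `d h b ↦ ε(d) ε(h) b`. -/
def projRight : U →ₗ[k] B :=
  (TensorProduct.lid k B).toLinearMap ∘ₗ TensorProduct.map (counit (R := k))
    ((TensorProduct.lid k B).toLinearMap ∘ₗ (counit (R := k) (A := H)).rTensor B) ∘ₗ
    w.equiv.symm.toLinearMap

/-- `d h b ↦ d ε(h) ε(b)`. -/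
def projLeft : U →ₗ[k] D :=
  (TensorProduct.rid k D).toLinearMap ∘ₗ TensorProduct.map LinearMap.id
    (LinearMap.mul' k k ∘ₗ TensorProduct.map (counit (R := k) (A := H)) (counit (R := k))) ∘ₗ
    w.equiv.symm.toLinearMap

lemma projRight_mul (d : D) (h : H) (b : B) :
    w.projRight (iD d * (iH h * iB b)) = counit (R := k) d • counit (R := k) h • b := by
  simp only [projRight, LinearMap.comp_apply, LinearEquiv.coe_coe, equiv_symm,
    TensorProduct.map_tmul, LinearMap.rTensor_tmul, TensorProduct.lid_tmul]

lemma projLeft_mul (d : D) (h : H) (b : B) :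
    w.projLeft (iD d * (iH h * iB b)) = (counit (R := k) h * counit (R := k) b) • d := by
  simp [projLeft, equiv_symm]

lemma mul_mul (d : D) (h : H) (b : B) (d' : D) (h' : H) (b' : B) :
    (iD d * (iH h * iB b)) * (iD d' * (iH h' * iB b')) = w.equiv (tripleMul d h b d' h' b') :=
  w.toIsCrossedTriple.tripleMap_mul d h b d' h' b'

variable (hD : IsLeftBraidedGroup (R : H ⊗[k] H) SD) (hB : IsRightBraidedGroup (R : H ⊗[k] H) SB)

-- This makes β = `projRight` a map of right modules onto B, on which D acts by its counit, H by the
-- given action and B by multiplication.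
include hD in
lemma projRight_mul_mul (u : U) (d' : D) (h' : H) (b' : B) :
    w.projRight (u * (iD d' * (iH h' * iB b'))) =
      counit (R := k) d' • ((op h' • w.projRight u) * b') := by
  induction u using w.ind with
  | h0 => simp
  | ha x y hx hy => simp only [add_mul, map_add, smul_add, hx, hy]
  | hP d h b =>
    rw [w.mul_mul]
    simp only [tripleMul, map_sum, equiv_tmul, projRight_mul, hD.counit_mul, hD.counit_act,
      Bialgebra.counit_mul]
    have h1 := sum_counit_smul_map (ℛ k h')
      (LinearMap.mulRight k b' ∘ₗ (rightAct k H B).flip b)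
    have h2 := sum_counit_smul_map (ℛ k h) (counit (R := k))
    simp only [LinearMap.comp_apply, LinearMap.mulRight_apply, LinearMap.flip_apply,
      rightAct_apply, smul_eq_mul] at h1 h2
    rw [smul_comm (op h'), smul_comm (op h'), smul_mul_assoc, smul_mul_assoc, ← h1, ← h2]
    simp only [Finset.smul_sum, Finset.sum_smul, Finset.mul_sum, Finset.sum_mul, smul_smul]
    rw [Finset.sum_comm]
    refine Finset.sum_congr rfl fun i _ ↦ Finset.sum_congr rfl fun j _ ↦ ?_
    congr 1
    ring

-- Likewise γ = `projLeft` is a map of left modules onto D, on which B acts by its counit.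
include hB in
lemma projLeft_mul_mul (u : U) (d : D) (h : H) (b : B) :
    w.projLeft ((iD d * (iH h * iB b)) * u) =
      counit (R := k) b • (d * (h • w.projLeft u)) := by
  induction u using w.ind with
  | h0 => simp
  | ha x y hx hy => simp only [mul_add, map_add, smul_add, hx, hy]
  | hP d' h' b' =>
    rw [w.mul_mul]
    simp only [tripleMul, map_sum, equiv_tmul, projLeft_mul, hB.counit_mul, hB.counit_act,
      Bialgebra.counit_mul]
    have h1 := sum_counit_right_smul_map (ℛ k h)
      (LinearMap.mulLeft k d ∘ₗ (leftAct k H D).flip d')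
    have h2 := sum_counit_smul_map (ℛ k h') (counit (R := k))
    simp only [LinearMap.comp_apply, LinearMap.mulLeft_apply, LinearMap.flip_apply,
      leftAct_apply, smul_eq_mul] at h1 h2
    rw [smul_comm h, mul_smul_comm, ← h1, ← h2]
    simp only [Finset.smul_sum, Finset.sum_smul, Finset.sum_mul, smul_smul]
    refine Finset.sum_congr rfl fun i _ ↦ ?_
    refine Finset.sum_congr rfl fun j _ ↦ ?_
    congr 1
    ring

include hD hB

lemma projRight_right (b : B) : w.projRight (iB b) = b := by
  simpa [hD.counit_one] using w.projRight_mul 1 1 b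

lemma projRight_left_mul (d : D) (u : U) :
    w.projRight (iD d * u) = counit (R := k) d • w.projRight u := by
  induction u using w.ind with
  | h0 => simp
  | ha x y hx hy => simp only [mul_add, map_add, smul_add, hx, hy]
  | hP d' h' b' =>
    rw [← mul_assoc, ← map_mul, projRight_mul, projRight_mul, hD.counit_mul, mul_smul]

lemma projRight_mid_mul (h : H) (u : U) :
    w.projRight (iH h * u) = counit (R := k) h • w.projRight u := by
  induction u using w.ind with
  | h0 => simp
  | ha x y hx hy => simp only [mul_add, map_add, smul_add, hx, hy]
  | hP d' h' b' =>
    have := w.projRight_mul_mul hD (iH h) d' h' b'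
    have e := w.projRight_mul 1 h 1
    simp only [map_one, one_mul, mul_one, hD.counit_one, one_smul] at e
    rw [this, e, projRight_mul, smul_comm (op h'), hB.act_one, Algebra.algebraMap_eq_smul_one]
    simp only [smul_mul_assoc, one_mul, smul_smul]
    congr 1
    ring

lemma projLeft_left_mul (d : D) (u : U) : w.projLeft (iD d * u) = d * w.projLeft u := by
  simpa [hB.counit_one] using w.projLeft_mul_mul hB u d 1 1

lemma projLeft_mid_mul (h : H) (u : U) : w.projLeft (iH h * u) = h • w.projLeft u := by
  simpa [hB.counit_one] using w.projLeft_mul_mul hB u 1 h 1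

lemma projLeft_right_mul (b : B) (u : U) :
    w.projLeft (iB b * u) = counit (R := k) b • w.projLeft u := by
  simpa using w.projLeft_mul_mul hB u 1 1 b

lemma projLeft_left (d : D) : w.projLeft (iD d) = d := by
  simpa [hB.counit_one] using w.projLeft_mul d 1 1

lemma projLeft_mul_right (u : U) (b : B) :
    w.projLeft (u * iB b) = counit (R := k) b • w.projLeft u := by
  induction u using w.ind with
  | h0 => simp
  | ha x y hx hy => simp only [add_mul, map_add, smul_add, hx, hy]
  | hP d' h' b' =>
    rw [mul_assoc, mul_assoc, ← map_mul, projLeft_mul, projLeft_mul, hB.counit_mul, smul_smul]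
    congr 1
    ring

lemma projLeft_mul_mid (u : U) (h : H) :
    w.projLeft (u * iH h) = counit (R := k) h • w.projLeft u := by
  induction u using w.ind with
  | h0 => simp
  | ha x y hx hy => simp only [add_mul, map_add, smul_add, hx, hy]
  | hP d' h' b' =>
    have := w.projLeft_mul_mul hB (iH h) d' h' b'
    have e := w.projLeft_mul 1 h 1
    simp only [map_one, one_mul, mul_one, hB.counit_one] at e
    rw [this, e, projLeft_mul, smul_comm h', hD.act_one, Algebra.algebraMap_eq_smul_one]
    simp only [mul_smul_comm, mul_one, smul_smul]
    congr 1
    ring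

end IsCrossedBialgebra

end Projections

/-! ### Explicit coproducts, and their images under the projections. -/

section ComulFormulas

open Coalgebra MulOpposite

variable {k H B D U : Type*} [Field k] [Ring H] [HopfAlgebra k H]
  [Ring B] [Algebra k B] [Coalgebra k B] [Module Hᵐᵒᵖ B] [IsScalarTower k Hᵐᵒᵖ B]
  [Ring D] [Algebra k D] [Coalgebra k D] [Module H D] [IsScalarTower k H D]
  [Ring U] {R : (H ⊗[k] H)ˣ} {SB : B →ₗ[k] B} {SD : D →ₗ[k] D}

section CopComul

variable {κ : Type*} [Fintype κ] {s s' : κ → H}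

lemma copComul_eq_sum (hs : ((R⁻¹ : (H ⊗[k] H)ˣ) : H ⊗[k] H) = ∑ i, s i ⊗ₜ[k] s' i) {ι : Type*}
    {d : D} (𝓡 : Repr k d ι) :
    copComul R D d = ∑ x ∈ 𝓡.index, ∑ i, (s i • 𝓡.right x) ⊗ₜ[k] (s' i • 𝓡.left x) := by
  simp only [copComul, LinearMap.comp_apply, ← 𝓡.eq, map_sum, hs, LinearMap.sum_apply,
    LinearEquiv.coe_coe, TensorProduct.comm_tmul, tensorAct_tmul, leftAct_apply]

/-- The braiding undoes the inverse braiding in Δ̄. Through this identity the R appearing in the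
cocycle condition turns Δ̄ back into the coproduct of D. -/
lemma tensorAct_copComul (d : D) :
    TensorProduct.comm k D D (tensorAct (leftAct k H D) (leftAct k H D) (R : H ⊗[k] H)
      (copComul R D d)) = comul d := by
  obtain ⟨n, r, r', hr⟩ := TensorProduct.exists_sum_tmul_eq (R : H ⊗[k] H)
  obtain ⟨m, s, s', hs⟩ := TensorProduct.exists_sum_tmul_eq ((R⁻¹ : (H ⊗[k] H)ˣ) : H ⊗[k] H)
  have h2 : ∑ i, ∑ l, (r i * s l) ⊗ₜ[k] (r' i * s' l) = 1 := by
    rw [← Units.mul_inv R, hs, hr]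
    simp [Finset.sum_mul_sum]
  have h3 (x y : D) := congrArg (TensorProduct.map ((leftAct k H D).flip x)
    ((leftAct k H D).flip y) ∘ₗ (TensorProduct.comm k H H).toLinearMap) h2
  simp only [map_sum, LinearMap.comp_apply, LinearEquiv.coe_coe, TensorProduct.comm_tmul,
    TensorProduct.map_tmul, LinearMap.flip_apply, leftAct_apply, mul_smul,
    Algebra.TensorProduct.one_def, one_smul] at h3
  rw [copComul_eq_sum hs (ℛ k d), hr]
  conv_rhs => rw [← (ℛ k d).eq]
  refine Eq.trans ?_ (Finset.sum_congr rfl fun x _ ↦ h3 _ _)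
  simp only [map_sum, LinearMap.sum_apply, tensorAct_tmul, leftAct_apply, TensorProduct.comm_tmul]
  exact Finset.sum_congr rfl fun x _ ↦ Finset.sum_comm

lemma counit_copComul (hR : IsQuasitriangular R) (hD : IsLeftBraidedGroup (R : H ⊗[k] H) SD)
    (d : D) : (counit (R := k)).rTensor D (copComul R D d) = 1 ⊗ₜ d := by
  obtain ⟨m, s, s', hs⟩ := TensorProduct.exists_sum_tmul_eq ((R⁻¹ : (H ⊗[k] H)ˣ) : H ⊗[k] H)
  have h (x : D) := congrArg (fun h ↦ h • x) (hR.sum_inv_counit_left hs)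
  simp only [Finset.sum_smul, smul_assoc, one_smul] at h
  rw [copComul_eq_sum hs (ℛ k d)]
  rw [← TensorProduct.mk_apply, ← sum_counit_right_smul_map (ℛ k d) (TensorProduct.mk k k D 1)]
  simp only [map_sum, LinearMap.rTensor_tmul, hD.counit_act, TensorProduct.mk_apply]
  refine Finset.sum_congr rfl fun x _ ↦ ?_
  conv_rhs => rw [← h ((ℛ k d).left x), TensorProduct.tmul_sum, Finset.smul_sum]
  refine Finset.sum_congr rfl fun i _ ↦ ?_
  have (a b : k) (z : D) : (a * b) ⊗ₜ[k] z = b • (1 : k) ⊗ₜ[k] (a • z) := by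
    rw [TensorProduct.tmul_smul, smul_smul, TensorProduct.smul_tmul', smul_eq_mul, mul_one, mul_comm]
  exact this _ _ _

lemma copComul_counit (hR : IsQuasitriangular R) (hD : IsLeftBraidedGroup (R : H ⊗[k] H) SD)
    (d : D) : (counit (R := k)).lTensor D (copComul R D d) = d ⊗ₜ 1 := by
  obtain ⟨m, s, s', hs⟩ := TensorProduct.exists_sum_tmul_eq ((R⁻¹ : (H ⊗[k] H)ˣ) : H ⊗[k] H)
  have h (x : D) := congrArg (fun h ↦ h • x) (hR.sum_inv_counit_right hs)
  simp only [Finset.sum_smul, smul_assoc, one_smul] at h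
  rw [copComul_eq_sum hs (ℛ k d)]
  refine Eq.trans ?_ (sum_counit_smul_map (ℛ k d) ((TensorProduct.mk k D k).flip 1))
  simp only [map_sum, LinearMap.lTensor_tmul, hD.counit_act, LinearMap.flip_apply,
    TensorProduct.mk_apply]
  refine Finset.sum_congr rfl fun x _ ↦ ?_
  conv_rhs => rw [← h ((ℛ k d).right x), TensorProduct.sum_tmul, Finset.smul_sum]
  refine Finset.sum_congr rfl fun i _ ↦ ?_
  have (a b : k) (z : D) : z ⊗ₜ[k] (a * b) = b • (a • z) ⊗ₜ[k] (1 : k) := by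
    rw [TensorProduct.smul_tmul, ← TensorProduct.tmul_smul, smul_eq_mul, smul_eq_mul, mul_one,
      mul_comm]
  exact this _ _ _

end CopComul

variable [Bialgebra k U] {iD : D →ₐ[k] U} {iH : H →ₐ[k] U} {iB : B →ₐ[k] U}

namespace IsCrossedBialgebra

variable (w : IsCrossedBialgebra R iD iH iB)
  {κ ξ : Type*} [Fintype κ] [Fintype ξ] {r r' s s' : κ → H} {c₁ c₂ : ξ → D}

include w

lemma comul_right_eq_sum (hR : IsQuasitriangular R)
    (hr : (R : H ⊗[k] H) = ∑ i, r i ⊗ₜ[k] r' i) {b : B} {ι : Type*} (𝓡 : Repr k b ι) :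
    comul (R := k) (iB b) = ∑ y ∈ 𝓡.index, ∑ i,
      iB (op (r i) • 𝓡.left y) ⊗ₜ[k] (iH (r' i) * iB (𝓡.right y)) := by
  rw [w.comul_right, convComul_apply 𝓡]
  simp [adjRight_eq_sum w.toIsCrossedTriple hR hr, Finset.sum_mul]

/-- In terms of Δ̄ the coproduct on D takes the shape used in the bosonisation over R̄ = R₂₁⁻¹.
Moving R⁻⁽¹⁾ to the right of d₍₂₎ splits it by (Δ ⊗ id)R⁻¹ = R₂₃⁻¹R₁₃⁻¹: one copy combines with the
flip to give Δ̄, the other remains. -/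
lemma comul_left_eq_sum (hR : IsQuasitriangular R)
    (hs : ((R⁻¹ : (H ⊗[k] H)ˣ) : H ⊗[k] H) = ∑ i, s i ⊗ₜ[k] s' i) {d : D}
    (hc : copComul R D d = ∑ x, c₁ x ⊗ₜ[k] c₂ x) :
    comul (R := k) (iD d) = ∑ x, ∑ i, (iD (c₁ x) * iH (s i)) ⊗ₜ[k] iD (s' i • c₂ x) := by
  have e1 := congrArg (fun z ↦ ∑ i, TensorProduct.map
    (LinearMap.mulRight k (iH (s i)) ∘ₗ iD.toLinearMap)
    (iD.toLinearMap ∘ₗ leftAct k H D (s' i)) z) ((copComul_eq_sum hs (ℛ k d)).symm.trans hc)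
  have e2 (x y : D) := congrArg (TensorProduct.map (pushLeft iD.toLinearMap iH.toLinearMap x)
    (iD.toLinearMap ∘ₗ (leftAct k H D).flip y) ∘ₗ
    (TensorProduct.assoc k H H H).symm.toLinearMap) (hR.sum_expandLeft_inv hs)
  simp only [map_sum, LinearMap.comp_apply, LinearEquiv.coe_coe, TensorProduct.assoc_symm_tmul,
    LinearEquiv.symm_apply_apply, TensorProduct.map_tmul, pushLeft_tmul, LinearMap.flip_apply,
    leftAct_apply, AlgHom.toLinearMap_apply, ← w.hd, LinearMap.mulRight_apply, mul_smul]
    at e1 e2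
  rw [w.comul_left, convComul_apply (ℛ k d), Finset.sum_comm (s := Finset.univ), ← e1,
    Finset.sum_comm]
  refine Finset.sum_congr rfl fun x _ ↦ ?_
  rw [← e2]
  simp [adjLeft_eq_sum w.toIsCrossedTriple hR hs, Finset.sum_mul]

lemma comul_mid_eq_sum {h : H} {ι : Type*} (𝓡 : Repr k h ι) :
    comul (R := k) (iH h) = ∑ i ∈ 𝓡.index, iH (𝓡.left i) ⊗ₜ[k] iH (𝓡.right i) := by
  rw [w.comul_mid, ← 𝓡.eq]
  simp

variable (hR : IsQuasitriangular R) (hD : IsLeftBraidedGroup (R : H ⊗[k] H) SD)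
  (hB : IsRightBraidedGroup (R : H ⊗[k] H) SB)

include hR hD hB

/-- Right factors from H and B are absorbed by γ through their counits. Under γ on the first leg a
right factor Δ(b) therefore acts as 1 ⊗ b, and similarly for Δ(h). For β the same happens with left
factors from D and H. -/
lemma map_projLeft_mul_comul_right (X : U ⊗[k] U) (b : B) :
    TensorProduct.map w.projLeft LinearMap.id (X * comul (R := k) (iB b)) =
      TensorProduct.map w.projLeft (LinearMap.mulRight k (iB b)) X := by
  obtain ⟨n, r, r', hr⟩ := TensorProduct.exists_sum_tmul_eq (R : H ⊗[k] H)
  rw [w.comul_right_eq_sum hR hr (ℛ k b)]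
  induction X with
  | zero => simp
  | add x y hx hy => rw [add_mul, map_add, map_add, hx, hy]
  | tmul x y =>
    simp only [Finset.mul_sum, map_sum, Algebra.TensorProduct.tmul_mul_tmul,
      TensorProduct.map_tmul, w.projLeft_mul_right hD hB, hB.counit_act, LinearMap.id_apply,
      LinearMap.mulRight_apply]
    have h1 := congrArg (fun z ↦ y * (iH z * iB b)) (hR.sum_counit_left hr)
    have h2 (z) := sum_counit_smul_map (ℛ k b) (LinearMap.mulLeft k (y * iH z) ∘ₗ iB.toLinearMap)
    simp only [LinearMap.comp_apply, AlgHom.toLinearMap_apply, LinearMap.mulLeft_apply] at h2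
    simp only [map_sum, map_smul, Finset.sum_mul, Finset.mul_sum, map_one, one_mul, smul_mul_assoc,
      mul_smul_comm, ← mul_assoc] at h1
    rw [← h1]
    simp only [← h2, TensorProduct.tmul_sum, TensorProduct.tmul_smul, TensorProduct.smul_tmul,
      Finset.smul_sum]
    rw [Finset.sum_comm]
    refine Finset.sum_congr rfl fun i _ ↦ Finset.sum_congr rfl fun j _ ↦ ?_
    rw [← TensorProduct.tmul_smul, smul_smul, mul_assoc, mul_comm (counit _), TensorProduct.tmul_smul]

lemma map_projLeft_mul_comul_mid (X : U ⊗[k] U) (h : H) :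
    TensorProduct.map w.projLeft LinearMap.id (X * comul (R := k) (iH h)) =
      TensorProduct.map w.projLeft (LinearMap.mulRight k (iH h)) X := by
  rw [w.comul_mid_eq_sum (ℛ k h)]
  induction X with
  | zero => simp
  | add x y hx hy => rw [add_mul, map_add, map_add, hx, hy]
  | tmul x y =>
    have h2 := sum_counit_smul_map (ℛ k h) (LinearMap.mulLeft k y ∘ₗ iH.toLinearMap)
    simp only [LinearMap.comp_apply, AlgHom.toLinearMap_apply, LinearMap.mulLeft_apply] at h2
    simp only [Finset.mul_sum, map_sum, Algebra.TensorProduct.tmul_mul_tmul,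
      TensorProduct.map_tmul, w.projLeft_mul_mid hD hB, LinearMap.id_apply,
      LinearMap.mulRight_apply, ← h2, TensorProduct.tmul_sum, TensorProduct.smul_tmul]

lemma map_projLeft_comul_left (d : D) :
    TensorProduct.map w.projLeft LinearMap.id (comul (R := k) (iD d)) =
      TensorProduct.map LinearMap.id iD.toLinearMap (copComul R D d) := by
  obtain ⟨m, s, s', hs⟩ := TensorProduct.exists_sum_tmul_eq ((R⁻¹ : (H ⊗[k] H)ˣ) : H ⊗[k] H)
  obtain ⟨n, c₁, c₂, hc⟩ := TensorProduct.exists_sum_tmul_eq (copComul R D d)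
  rw [w.comul_left_eq_sum hR hs hc, hc]
  simp only [map_sum, TensorProduct.map_tmul, w.projLeft_mul_mid hD hB, w.projLeft_left hD hB,
    LinearMap.id_apply, AlgHom.toLinearMap_apply]
  refine Finset.sum_congr rfl fun x _ ↦ ?_
  have := congrArg (fun h ↦ c₁ x ⊗ₜ[k] iD (h • c₂ x)) (hR.sum_inv_counit_left hs)
  simp only [Finset.sum_smul, smul_assoc, one_smul, map_sum, map_smul,
    TensorProduct.tmul_sum] at this
  rw [← this]
  refine Finset.sum_congr rfl fun i _ ↦ ?_
  rw [TensorProduct.smul_tmul]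

lemma map_projRight_comul_left_mul (X : U ⊗[k] U) (d : D) :
    TensorProduct.map w.projRight LinearMap.id (comul (R := k) (iD d) * X) =
      TensorProduct.map w.projRight (LinearMap.mulLeft k (iD d)) X := by
  obtain ⟨m, s, s', hs⟩ := TensorProduct.exists_sum_tmul_eq ((R⁻¹ : (H ⊗[k] H)ˣ) : H ⊗[k] H)
  obtain ⟨n, c₁, c₂, hc⟩ := TensorProduct.exists_sum_tmul_eq (copComul R D d)
  rw [w.comul_left_eq_sum hR hs hc]
  induction X with
  | zero => simp
  | add x y hx hy => rw [mul_add, map_add, map_add, hx, hy]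
  | tmul x y =>
    simp only [Finset.sum_mul, map_sum, Algebra.TensorProduct.tmul_mul_tmul, mul_assoc,
      TensorProduct.map_tmul, w.projRight_left_mul hD hB, w.projRight_mid_mul hD hB,
      LinearMap.id_apply, LinearMap.mulLeft_apply]
    have h0 : ∑ x, counit (R := k) (c₁ x) • c₂ x = d := by
      simpa [hc] using congrArg (TensorProduct.lid k D) (counit_copComul hR hD d)
    have h1 := congrArg (fun h ↦ iD (h • d) * y) (hR.sum_inv_counit_left hs)
    simp only [one_smul] at h1
    rw [← h1, ← h0]
    simp only [Finset.sum_smul, Finset.smul_sum, Finset.sum_mul, map_sum, map_smul, smul_assoc,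
      smul_mul_assoc, TensorProduct.tmul_sum, TensorProduct.tmul_smul, ← TensorProduct.smul_tmul']
    refine Finset.sum_congr rfl fun j _ ↦ Finset.sum_congr rfl fun i _ ↦ ?_
    rw [smul_comm (s' i), map_smul iD (counit (c₁ j)), smul_mul_assoc,
      TensorProduct.tmul_smul (counit (c₁ j)), smul_comm (counit (s i))]

lemma map_projRight_comul_mid_mul (X : U ⊗[k] U) (h : H) :
    TensorProduct.map w.projRight LinearMap.id (comul (R := k) (iH h) * X) =
      TensorProduct.map w.projRight (LinearMap.mulLeft k (iH h)) X := by
  rw [w.comul_mid_eq_sum (ℛ k h)]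
  induction X with
  | zero => simp
  | add x y hx hy => rw [mul_add, map_add, map_add, hx, hy]
  | tmul x y =>
    have h2 := sum_counit_smul_map (ℛ k h) (LinearMap.mulRight k y ∘ₗ iH.toLinearMap)
    simp only [LinearMap.comp_apply, AlgHom.toLinearMap_apply, LinearMap.mulRight_apply] at h2
    simp only [Finset.sum_mul, map_sum, Algebra.TensorProduct.tmul_mul_tmul,
      TensorProduct.map_tmul, w.projRight_mid_mul hD hB, LinearMap.id_apply,
      LinearMap.mulLeft_apply, ← h2, TensorProduct.tmul_sum, TensorProduct.smul_tmul]

lemma map_projRight_comul_right (hr : (R : H ⊗[k] H) = ∑ i, r i ⊗ₜ[k] r' i) {b : B} {ι : Type*}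
    (𝓡 : Repr k b ι) :
    TensorProduct.map w.projRight LinearMap.id (comul (R := k) (iB b)) =
      ∑ y ∈ 𝓡.index, ∑ i, (op (r i) • 𝓡.left y) ⊗ₜ[k] (iH (r' i) * iB (𝓡.right y)) := by
  simp [w.comul_right_eq_sum hR hr 𝓡, w.projRight_right hD hB]

end IsCrossedBialgebra

end ComulFormulas

/-! ### The projections are coalgebra maps. -/

section ProjectionCoalgebra

open Coalgebra MulOpposite

variable {k H B D U : Type*} [Field k] [Ring H] [HopfAlgebra k H]
  [Ring B] [Algebra k B] [Coalgebra k B] [Module Hᵐᵒᵖ B] [IsScalarTower k Hᵐᵒᵖ B]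
  [Ring D] [Algebra k D] [Coalgebra k D] [Module H D] [IsScalarTower k H D]
  [Ring U] {R : (H ⊗[k] H)ˣ} {SB : B →ₗ[k] B} {SD : D →ₗ[k] D}

lemma map_eq_map_id {M N P Q : Type*} [AddCommGroup M] [Module k M] [AddCommGroup N] [Module k N]
    [AddCommGroup P] [Module k P] [AddCommGroup Q] [Module k Q] (f : M →ₗ[k] P) (g : N →ₗ[k] Q)
    (z : M ⊗[k] N) :
    TensorProduct.map f g z = TensorProduct.map LinearMap.id g (TensorProduct.map f LinearMap.id z) := by
  rw [← LinearMap.comp_apply, ← TensorProduct.map_comp, LinearMap.id_comp, LinearMap.comp_id]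

variable [Bialgebra k U] {iD : D →ₐ[k] U} {iH : H →ₐ[k] U} {iB : B →ₐ[k] U}

namespace IsCrossedBialgebra

variable (w : IsCrossedBialgebra R iD iH iB)
  {κ : Type*} [Fintype κ] {r r' : κ → H}
  (hR : IsQuasitriangular R) (hD : IsLeftBraidedGroup (R : H ⊗[k] H) SD)
  (hB : IsRightBraidedGroup (R : H ⊗[k] H) SB)

include hR hD hB

lemma map_projLeft_comul (d : D) (h : H) (b : B) :
    TensorProduct.map w.projLeft LinearMap.id (comul (R := k) (iD d * (iH h * iB b))) =
      TensorProduct.map LinearMap.id (LinearMap.mulRight k (iH h * iB b) ∘ₗ iD.toLinearMap)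
        (copComul R D d) := by
  rw [← mul_assoc, Bialgebra.comul_mul, w.map_projLeft_mul_comul_right hR hD hB, map_eq_map_id,
    Bialgebra.comul_mul, w.map_projLeft_mul_comul_mid hR hD hB, map_eq_map_id _ (LinearMap.mulRight
    k (iH h)), w.map_projLeft_comul_left hR hD hB]
  induction copComul R D d with
  | zero => simp
  | add x y hx hy => simp only [map_add, hx, hy]
  | tmul x y => simp [mul_assoc]

lemma map_projRight_comul (hr : (R : H ⊗[k] H) = ∑ i, r i ⊗ₜ[k] r' i) (d : D) (h : H) {b : B}
    {ι : Type*} (𝓡 : Repr k b ι) :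
    TensorProduct.map w.projRight LinearMap.id (comul (R := k) (iD d * (iH h * iB b))) =
      ∑ y ∈ 𝓡.index, ∑ i, (op (r i) • 𝓡.left y) ⊗ₜ[k]
        (iD d * (iH h * (iH (r' i) * iB (𝓡.right y)))) := by
  rw [Bialgebra.comul_mul, w.map_projRight_comul_left_mul hR hD hB, map_eq_map_id,
    Bialgebra.comul_mul, w.map_projRight_comul_mid_mul hR hD hB, map_eq_map_id _
    (LinearMap.mulLeft k (iH h)), w.map_projRight_comul_right hR hD hB hr 𝓡]
  simp

/-- The relation behind the left half of the cocycle condition. -/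
lemma map_projLeft_projRight_comul (y : U) (d : D) (h : H) (b : B) :
    TensorProduct.map w.projLeft (w.projRight ∘ₗ LinearMap.mulLeft k y)
      (comul (R := k) (iD d * (iH h * iB b))) = d ⊗ₜ ((op h • w.projRight y) * b) := by
  obtain ⟨n, c₁, c₂, hc⟩ := TensorProduct.exists_sum_tmul_eq (copComul R D d)
  have h0 := copComul_counit hR hD d
  rw [hc] at h0
  have h1 := congrArg (TensorProduct.map (LinearMap.id : D →ₗ[k] D)
    (LinearMap.toSpanSingleton k B ((op h • w.projRight y) * b))) h0
  simp only [map_sum, LinearMap.lTensor_tmul, TensorProduct.map_tmul, LinearMap.id_apply,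
    LinearMap.toSpanSingleton_apply, one_smul] at h1
  rw [map_eq_map_id, w.map_projLeft_comul hR hD hB, hc, ← h1]
  simp only [map_sum, TensorProduct.map_tmul, LinearMap.id_apply, LinearMap.comp_apply,
    LinearMap.mulRight_apply, LinearMap.mulLeft_apply, AlgHom.toLinearMap_apply,
    w.projRight_mul_mul hD]

/-- The relation behind the right half of the cocycle condition. -/
lemma map_projRight_projLeft_comul (hr : (R : H ⊗[k] H) = ∑ i, r i ⊗ₜ[k] r' i) (z : U) (d : D)
    (h : H) (b : B) :
    TensorProduct.map w.projRight (w.projLeft ∘ₗ LinearMap.mulRight k z)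
      (comul (R := k) (iD d * (iH h * iB b))) =
      ∑ i, (op (r i) • b) ⊗ₜ (d * (h • r' i • w.projLeft z)) := by
  rw [map_eq_map_id, w.map_projRight_comul hR hD hB hr d h (ℛ k b)]
  simp only [map_sum, TensorProduct.map_tmul, LinearMap.id_apply, LinearMap.comp_apply,
    LinearMap.mulRight_apply, mul_assoc, w.projLeft_left_mul hD hB, w.projLeft_mid_mul hD hB,
    w.projLeft_right_mul hD hB]
  rw [Finset.sum_comm]
  refine Finset.sum_congr rfl fun i _ ↦ ?_
  refine Eq.trans (Finset.sum_congr rfl fun y _ ↦ ?_) (sum_counit_right_smul_map (ℛ k b)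
    ((TensorProduct.mk k B D).flip (d * (h • r' i • w.projLeft z)) ∘ₗ rightAct k H B (r i)))
  simp only [LinearMap.comp_apply, LinearMap.flip_apply, TensorProduct.mk_apply, rightAct_apply]
  rw [smul_comm (r' i) (counit (R := k) _), smul_comm h (counit (R := k) _), mul_smul_comm,
    TensorProduct.tmul_smul]

/-- The R in Δ(b) puts its second leg in front of b₍₂₎, where β applies the counit to it, and (id ⊗
ε)R = 1. -/
lemma comul_projRight (u : U) :
    comul (R := k) (w.projRight u) = TensorProduct.map w.projRight w.projRight (comul u) := by
  obtain ⟨n, r, r', hr⟩ := TensorProduct.exists_sum_tmul_eq (R : H ⊗[k] H)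
  induction u using w.ind with
  | h0 => simp
  | ha x y hx hy => simp only [map_add, hx, hy]
  | hP d h b =>
    rw [map_eq_map_id, w.map_projRight_comul hR hD hB hr d h (ℛ k b), w.projRight_mul]
    simp only [map_sum, TensorProduct.map_tmul, LinearMap.id_apply, map_smul,
      w.projRight_left_mul hD hB, w.projRight_mid_mul hD hB, w.projRight_right hD hB]
    conv_lhs => rw [← (ℛ k b).eq]
    simp only [Finset.smul_sum]
    refine Finset.sum_congr rfl fun y _ ↦ ?_
    have := congrArg (fun z ↦ counit (R := k) d • counit (R := k) h •
      (rightAct k H B z ((ℛ k b).left y) ⊗ₜ[k] (ℛ k b).right y)) (hR.sum_counit_right hr)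
    simp only [map_sum, map_smul, LinearMap.sum_apply, LinearMap.smul_apply, rightAct_apply, op_one,
      one_smul, TensorProduct.sum_tmul, Finset.smul_sum] at this
    rw [← this]
    refine Finset.sum_congr rfl fun i _ ↦ ?_
    simp only [TensorProduct.tmul_smul, TensorProduct.smul_tmul']

/-- The coproduct on D respected by γ is Δ̄, which is why the cocycle inverse and the cross relation
involve Δ̄ and S̄. -/
lemma copComul_projLeft (u : U) :
    copComul R D (w.projLeft u) = TensorProduct.map w.projLeft w.projLeft (comul u) := by
  induction u using w.ind with
  | h0 => simp
  | ha x y hx hy => simp only [map_add, hx, hy]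
  | hP d h b =>
    rw [map_eq_map_id, w.map_projLeft_comul hR hD hB, w.projLeft_mul]
    rw [map_smul]
    induction copComul R D d with
    | zero => simp
    | add x y hx hy => simp only [map_add, smul_add, hx, hy]
    | tmul x y =>
      simp only [TensorProduct.map_tmul, LinearMap.id_apply, LinearMap.comp_apply,
        AlgHom.toLinearMap_apply, LinearMap.mulRight_apply, w.projLeft_mul, TensorProduct.tmul_smul]

end IsCrossedBialgebra

end ProjectionCoalgebra

/-! ### Braided antimultiplicativity of the antipode. -/

section BraidedAntipode

open Coalgebra MulOpposite

variable {k H D : Type*} [Field k] [Ring H] [HopfAlgebra k H]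
  [Ring D] [Algebra k D] [Coalgebra k D] [Module H D] [IsScalarTower k H D]
  {R : (H ⊗[k] H)ˣ} {SD : D →ₗ[k] D} {κ : Type*} [Fintype κ] {r r' : κ → H}

namespace IsLeftBraidedGroup

variable (hR : IsQuasitriangular R) (hD : IsLeftBraidedGroup (R : H ⊗[k] H) SD)

include hD

lemma comul_mul_eq_sum (hr : (R : H ⊗[k] H) = ∑ i, r i ⊗ₜ[k] r' i) {x y : D} {ι ι' : Type*}
    (𝓡 : Repr k x ι) (𝓢 : Repr k y ι') :
    comul (R := k) (x * y) = ∑ a ∈ 𝓡.index, ∑ b ∈ 𝓢.index, ∑ i,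
      (𝓡.left a * (r' i • 𝓢.left b)) ⊗ₜ ((r i • 𝓡.right a) * 𝓢.right b) := by
  rw [hD.comul_mul, ← 𝓡.eq, ← 𝓢.eq]
  simp only [TensorProduct.sum_tmul, TensorProduct.tmul_sum, map_sum, middle_tmul, leftBraiding, hr,
    LinearMap.comp_apply, LinearMap.sum_apply, tensorAct_tmul, leftAct_apply, LinearEquiv.coe_coe,
    TensorProduct.comm_tmul, TensorProduct.assoc_tmul, TensorProduct.assoc_symm_tmul,
    TensorProduct.map_tmul, LinearMap.mul'_apply]
  exact Finset.sum_comm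

/-- As a function P of y, the left side satisfies P * id = ε(x)·1 in the convolution algebra of D:
this is the left antipode axiom for xy, with Δ(xy) expanded by the braiding. Convolving with S on
the right gives P = ε(x)S. -/
lemma sum_antipode_mul_smul (hr : (R : H ⊗[k] H) = ∑ i, r i ⊗ₜ[k] r' i) {x : D} {ι : Type*}
    (𝓡 : Repr k x ι) (y : D) :
    ∑ a ∈ 𝓡.index, ∑ i, SD (𝓡.left a * (r' i • y)) * (r i • 𝓡.right a) =
      counit (R := k) x • SD y := by
  let P : D →ₗ[k] D := ∑ a ∈ 𝓡.index, ∑ i, LinearMap.mulRight k (r i • 𝓡.right a) ∘ₗ SD ∘ₗ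
    LinearMap.mulLeft k (𝓡.left a) ∘ₗ leftAct k H D (r' i)
  have h1 : WithConv.toConv P * WithConv.toConv LinearMap.id = counit (R := k) x • 1 := by
    ext y
    have := hD.antipode_left (x * y)
    rw [hD.comul_mul_eq_sum hr 𝓡 (ℛ k y), hD.counit_mul] at this
    rw [(ℛ k y).convMul_apply]
    simp only [map_sum, LinearMap.rTensor_tmul, LinearMap.mul'_apply] at this
    simp only [P, LinearMap.sum_apply, LinearMap.comp_apply, LinearMap.mulRight_apply,
      LinearMap.mulLeft_apply, leftAct_apply, LinearMap.id_apply, Finset.sum_mul, mul_assoc]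
    rw [Finset.sum_comm]
    refine this.trans ?_
    simp [Algebra.smul_def]
  have h2 : WithConv.toConv (LinearMap.id : D →ₗ[k] D) * WithConv.toConv SD = 1 := by
    ext y
    have := hD.antipode_right y
    rw [(ℛ k y).convMul_apply]
    conv at this => lhs; rw [← (ℛ k y).eq]
    simpa using this
  have h3 : WithConv.toConv P = counit (R := k) x • WithConv.toConv SD := by
    rw [← mul_one (WithConv.toConv P), ← h2, ← mul_assoc, h1, smul_mul_assoc, one_mul]
  have := congrArg (fun f ↦ f.ofConv y) h3
  simpa [P] using this

lemma smul_mul_eq_map (h : H) (p q : D) : h • (p * q) = LinearMap.mul' k D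
    (TensorProduct.map ((leftAct k H D).flip p) ((leftAct k H D).flip q) (comul (R := k) h)) := by
  rw [hD.act_mul]
  induction comul (R := k) h with
  | zero => simp
  | add x y hx hy => simp only [map_add, LinearMap.add_apply, hx, hy]
  | tmul x y => simp

include hR in
/-- The braided antipode is braided antimultiplicative. -/
lemma antipode_mul (hr : (R : H ⊗[k] H) = ∑ i, r i ⊗ₜ[k] r' i) (x y : D) :
    SD (x * y) = ∑ i, (r' i • SD y) * (r i • SD x) := by
  have h1 (c p q : D) : ∑ i, ∑ j, SD (c * (r' i • r' j • y)) * ((r i • p) * (r j • q)) =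
      ∑ i, SD (c * (r' i • y)) * (r i • (p * q)) := by
    have := congrArg (LinearMap.mul' k D ∘ₗ (TensorProduct.comm k D D).toLinearMap ∘ₗ
      TensorProduct.map (LinearMap.mul' k D ∘ₗ TensorProduct.map ((leftAct k H D).flip p)
        ((leftAct k H D).flip q)) (SD ∘ₗ LinearMap.mulLeft k c ∘ₗ (leftAct k H D).flip y) ∘ₗ
      (TensorProduct.assoc k H H H).symm.toLinearMap) (hR.sum_expandLeft hr)
    simp only [map_sum, LinearMap.comp_apply, LinearEquiv.coe_coe, TensorProduct.assoc_symm_tmul,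
      LinearEquiv.symm_apply_apply, TensorProduct.map_tmul, TensorProduct.comm_tmul,
      LinearMap.mul'_apply, LinearMap.mulLeft_apply, LinearMap.flip_apply, leftAct_apply,
      ← hD.smul_mul_eq_map, mul_smul] at this
    exact this.symm
  have h2 (c : D) {z : D} {ι : Type _} (𝓡 : Repr k z ι) :
      ∑ a ∈ 𝓡.index, ∑ i, ∑ j, SD (c * (r' i • r' j • y)) *
        ((r i • 𝓡.left a) * (r j • SD (𝓡.right a))) = counit (R := k) z • SD (c * y) := by
    have e := hD.antipode_right z
    rw [← 𝓡.eq] at e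
    simp only [map_sum, LinearMap.lTensor_tmul, LinearMap.mul'_apply] at e
    simp only [h1]
    rw [Finset.sum_comm]
    simp only [← Finset.mul_sum, ← Finset.smul_sum, e, Algebra.algebraMap_eq_smul_one]
    have := congrArg (fun h ↦ counit (R := k) z • SD (c * leftAct k H D h y)) (hR.sum_counit_left hr)
    simp only [map_sum, map_smul, LinearMap.sum_apply, LinearMap.smul_apply, Finset.mul_sum,
      mul_smul_comm, leftAct_apply, one_smul, Finset.smul_sum] at this
    rw [← this]
    refine Finset.sum_congr rfl fun i _ ↦ ?_
    rw [smul_comm (r i), hD.act_one, Algebra.algebraMap_eq_smul_one, mul_smul_comm, mul_smul_comm,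
      mul_one]
  -- Λ is evaluated on x₍₁₎ ⊗ x₍₂₎ ⊗ x₍₃₎ in two ways. Contracting x₍₂₎ with S x₍₃₎ gives S(xy);
  -- contracting the part with x₍₁₎ and x₍₂₎ by `sum_antipode_mul_smul` gives (R⁽²⁾ ▷ Sy)(R⁽¹⁾ ▷
  -- Sx).
  let Λ : D ⊗[k] (D ⊗[k] D) →ₗ[k] D := ∑ i, ∑ j, LinearMap.mul' k D ∘ₗ
    TensorProduct.map (SD ∘ₗ LinearMap.mulRight k (r' i • r' j • y))
      (LinearMap.mul' k D ∘ₗ TensorProduct.map (leftAct k H D (r i)) (leftAct k H D (r j) ∘ₗ SD))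
  have hΛ (p q t : D) : Λ (p ⊗ₜ (q ⊗ₜ t)) = ∑ i, ∑ j,
      SD (p * (r' i • r' j • y)) * ((r i • q) * (r j • SD t)) := by
    simp [Λ]
  have key := congrArg Λ
    (sum_tmul_tmul_eq (ℛ k x) (fun i ↦ ℛ k ((ℛ k x).left i)) (fun i ↦ ℛ k ((ℛ k x).right i)))
  simp only [map_sum, hΛ] at key
  have e1 := sum_counit_right_smul_map (ℛ k x) (SD ∘ₗ LinearMap.mulRight k y)
  simp only [LinearMap.comp_apply, LinearMap.mulRight_apply, ← h2 _ (ℛ k _)] at e1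
  rw [← e1, ← key]
  have e2 (j) (a) := congrArg (fun z ↦ z * (r j • SD ((ℛ k x).right a)))
    (hD.sum_antipode_mul_smul hr (ℛ k ((ℛ k x).left a)) (r' j • y))
  simp only [Finset.sum_mul, mul_assoc, smul_mul_assoc, fun j ↦ hD.antipode_act (r' j) y] at e2
  have e3 (j) := sum_counit_smul_map (ℛ k x)
    (LinearMap.mulLeft k (r' j • SD y) ∘ₗ leftAct k H D (r j) ∘ₗ SD)
  simp only [LinearMap.comp_apply, LinearMap.mulLeft_apply, leftAct_apply] at e3
  simp only [← e3, ← e2]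
  conv_rhs => rw [Finset.sum_comm]
  refine Finset.sum_congr rfl fun a _ ↦ ?_
  conv_rhs => rw [Finset.sum_comm]
  refine Finset.sum_congr rfl fun c _ ↦ Finset.sum_comm

end IsLeftBraidedGroup

end BraidedAntipode

/-! ### The pairing defines a two-cocycle. -/

section Cocycle

open Coalgebra MulOpposite WithConv

variable {k H B D U : Type*} [Field k] [Ring H] [HopfAlgebra k H]
  [Ring B] [Algebra k B] [Coalgebra k B] [Module Hᵐᵒᵖ B] [IsScalarTower k Hᵐᵒᵖ B]
  [Ring D] [Algebra k D] [Coalgebra k D] [Module H D] [IsScalarTower k H D]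
  [Ring U] {R : (H ⊗[k] H)ˣ} {SB : B →ₗ[k] B} {SD : D ≃ₗ[k] D} {pair : D →ₗ[k] B →ₗ[k] k}

section CopAntipode

variable (hR : IsQuasitriangular R) (hD : IsLeftBraidedGroup (R : H ⊗[k] H) SD.toLinearMap)

include hD in
lemma IsLeftBraidedGroup.antipode_symm_act (h : H) (d : D) : SD.symm (h • d) = h • SD.symm d := by
  rw [LinearEquiv.symm_apply_eq]
  have := hD.antipode_act h (SD.symm d)
  simpa using this.symm

include hD in
lemma IsLeftBraidedGroup.antipode_one : SD 1 = 1 := by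
  have := hD.antipode_left 1
  simpa [hD.comul_one, hD.counit_one] using this

include hR hD

/-- S̄ is an antipode for Δ̄. Applying S to x S̄(y) gives, by antimultiplicativity, the contraction
of Ψ(x ⊗ y) with id ⊗ S. Since Ψ ∘ Δ̄ is the coproduct of D, the right antipode axiom for S applies.
-/
lemma mul_antipode_copComul (d : D) : LinearMap.mul' k D (TensorProduct.map LinearMap.id
    SD.symm.toLinearMap (copComul R D d)) = counit (R := k) d • 1 := by
  apply SD.injective
  obtain ⟨n, r, r', hr⟩ := TensorProduct.exists_sum_tmul_eq (R : H ⊗[k] H)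
  have h1 (z : D ⊗[k] D) : SD (LinearMap.mul' k D (TensorProduct.map LinearMap.id
      SD.symm.toLinearMap z)) = LinearMap.mul' k D (TensorProduct.map LinearMap.id SD.toLinearMap
      (TensorProduct.comm k D D
        (tensorAct (leftAct k H D) (leftAct k H D) (R : H ⊗[k] H) z))) := by
    induction z with
    | zero => simp
    | add x y hx hy => simp only [map_add, hx, hy]
    | tmul x y =>
      have := hD.antipode_mul hR hr x (SD.symm y)
      simp only [LinearEquiv.coe_coe, LinearEquiv.apply_symm_apply] at this
      have act (h : H) (c : D) : SD (h • c) = h • SD c := hD.antipode_act h c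
      simp [hr, this, act]
  rw [h1, tensorAct_copComul, map_smul, hD.antipode_one, ← Algebra.algebraMap_eq_smul_one]
  exact hD.antipode_right d

lemma antipode_mul_copComul (d : D) : LinearMap.mul' k D (TensorProduct.map SD.symm.toLinearMap
    LinearMap.id (copComul R D d)) = counit (R := k) d • 1 := by
  apply SD.injective
  obtain ⟨n, r, r', hr⟩ := TensorProduct.exists_sum_tmul_eq (R : H ⊗[k] H)
  have h1 (z : D ⊗[k] D) : SD (LinearMap.mul' k D (TensorProduct.map SD.symm.toLinearMap
      LinearMap.id z)) = LinearMap.mul' k D (TensorProduct.map SD.toLinearMap LinearMap.id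
      (TensorProduct.comm k D D
        (tensorAct (leftAct k H D) (leftAct k H D) (R : H ⊗[k] H) z))) := by
    induction z with
    | zero => simp
    | add x y hx hy => simp only [map_add, hx, hy]
    | tmul x y =>
      have := hD.antipode_mul hR hr (SD.symm x) y
      simp only [LinearEquiv.coe_coe, LinearEquiv.apply_symm_apply] at this
      have act (h : H) (c : D) : SD (h • c) = h • SD c := hD.antipode_act h c
      simp [hr, this, act]
  rw [h1, tensorAct_copComul, map_smul, hD.antipode_one, ← Algebra.algebraMap_eq_smul_one]
  exact hD.antipode_left d

end CopAntipode

variable [Bialgebra k U] {iD : D →ₐ[k] U} {iH : H →ₐ[k] U} {iB : B →ₐ[k] U}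

namespace IsCrossedBialgebra

variable (w : IsCrossedBialgebra R iD iH iB)

/-- The bilinear form `u ⊗ v ↦ f(γ(v), β(u))`. -/
def form (f : D →ₗ[k] B →ₗ[k] k) : U ⊗[k] U →ₗ[k] k :=
  TensorProduct.lift f.flip ∘ₗ TensorProduct.map w.projRight w.projLeft

@[simp] lemma form_tmul (f : D →ₗ[k] B →ₗ[k] k) (u v : U) :
    w.form f (u ⊗ₜ v) = f (w.projLeft v) (w.projRight u) := rfl

variable (hR : IsQuasitriangular R) (hD : IsLeftBraidedGroup (R : H ⊗[k] H) SD.toLinearMap)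
  (hB : IsRightBraidedGroup (R : H ⊗[k] H) SB) (hp : IsDualPairing H pair)

include hR hD hB hp

/-- For v = dhb both sides equal ⟨d(h ▷ c₍₁₎), β(u)⟩⟨c₍₂₎, b⟩ with c = γ(x). On the left,
β(u₍₂₎v₍₂₎) is a product in B and the pairing expands it by the coproduct of c. On the right,
γ(v₍₂₎x₍₂₎) is a product in D, and an R produced by Δ(b) is absorbed by c. -/
lemma form_cocycle :
    toConv (w.form pair ∘ₗ (dropRight k U).toLinearMap) *
      toConv (w.form pair ∘ₗ (applyLeft (Bialgebra.mulCoalgHom k U)).toLinearMap) =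
    toConv (w.form pair ∘ₗ (dropLeft k U).toLinearMap) *
      toConv (w.form pair ∘ₗ (applyRight (Bialgebra.mulCoalgHom k U)).toLinearMap) := by
  obtain ⟨n, r, r', hr⟩ := TensorProduct.exists_sum_tmul_eq (R : H ⊗[k] H)
  apply WithConv.ext
  ext u v x
  simp only [TensorProduct.AlgebraTensorModule.curry_apply, TensorProduct.curry_apply,
    LinearMap.coe_restrictScalars]
  induction v using w.ind with
  | h0 => simp
  | ha y z hy hz => simp only [TensorProduct.add_tmul, TensorProduct.tmul_add, map_add, hy, hz]
  | hP d h b =>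
    set v := iD d * (iH h * iB b) with hv
    let Ω : D ⊗[k] D →ₗ[k] k := LinearMap.mul' k k ∘ₗ TensorProduct.map
      (pair.flip (w.projRight u) ∘ₗ LinearMap.mulLeft k d ∘ₗ leftAct k H D h) (pair.flip b)
    trans Ω (comul (w.projLeft x))
    · change (_ * _ : WithConv (U ⊗[k] (U ⊗[k] U) →ₗ[k] k)) _ = _
      rw [((ℛ k u).tmul ((ℛ k v).tmul (ℛ k x))).convMul_apply]
      have e1 (p : k) (z : B) : ∑ l ∈ (ℛ k x).index, counit (R := k) ((ℛ k x).left l) * p *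
          pair (w.projLeft ((ℛ k x).right l)) z = p * pair (w.projLeft x) z := by
        have := sum_counit_smul_map (ℛ k x) (pair.flip z ∘ₗ w.projLeft)
        simp only [LinearMap.comp_apply, LinearMap.flip_apply, smul_eq_mul] at this
        rw [← this, Finset.mul_sum]
        exact Finset.sum_congr rfl fun i _ ↦ by ring
      have e2 (y : U) (q : B) : ∑ j ∈ (ℛ k v).index, pair (w.projLeft ((ℛ k v).left j)) q *
          pair (w.projLeft x) (w.projRight (y * (ℛ k v).right j)) =
          pair d q * pair (w.projLeft x) ((op h • w.projRight y) * b) := by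
        have := congrArg (LinearMap.mul' k k ∘ₗ TensorProduct.map (pair.flip q)
          (pair (w.projLeft x))) (w.map_projLeft_projRight_comul hR hD hB y d h b)
        rw [← hv, ← (ℛ k v).eq] at this
        simpa using this
      have e3 : pair (w.projLeft x) ∘ₗ LinearMap.mulRight k b =
          ∑ i ∈ (ℛ k (w.projLeft x)).index, pair ((ℛ k (w.projLeft x)).right i) b •
            pair ((ℛ k (w.projLeft x)).left i) := by
        ext q
        simp only [LinearMap.comp_apply, LinearMap.mulRight_apply, hp.mul_right]
        rw [← (ℛ k (w.projLeft x)).eq]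
        simp [mul_comm]
      have e4 (q : B) := LinearMap.congr_fun e3 q
      simp only [LinearMap.comp_apply, LinearMap.mulRight_apply, LinearMap.sum_apply,
        LinearMap.smul_apply, smul_eq_mul] at e4
      have e5 (c : D) : pair (d * (h • c)) (w.projRight u) = ∑ i ∈ (ℛ k u).index,
          pair d (w.projRight ((ℛ k u).left i)) *
            pair c (op h • w.projRight ((ℛ k u).right i)) := by
        rw [hp.mul_left, w.comul_projRight hR hD hB, ← (ℛ k u).eq]
        simp [hp.act]
      rw [← (ℛ k (w.projLeft x)).eq]
      simp only [Repr.tmul_index, Finset.sum_product, Repr.tmul_left, Repr.tmul_right,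
        LinearMap.comp_apply, CoalgHom.toLinearMap_eq_coe, LinearMap.coe_coe, dropRight_tmul,
        applyLeft_tmul, Bialgebra.coe_mulCoalgHom, LinearMap.mul'_apply, map_smul, form_tmul,
        smul_eq_mul, e1, e2, e4, Ω, map_sum, TensorProduct.map_tmul, LinearMap.flip_apply,
        LinearMap.mulLeft_apply, leftAct_apply, e5, Finset.mul_sum, Finset.sum_mul]
      rw [Finset.sum_comm]
      exact Finset.sum_congr rfl fun i _ ↦ Finset.sum_congr rfl fun j _ ↦ by ring
    · change _ = (_ * _ : WithConv (U ⊗[k] (U ⊗[k] U) →ₗ[k] k)) _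
      rw [((ℛ k u).tmul ((ℛ k v).tmul (ℛ k x))).convMul_apply]
      have e1 (p : k) (z : D) : ∑ l ∈ (ℛ k u).index, counit (R := k) ((ℛ k u).left l) * p *
          pair z (w.projRight ((ℛ k u).right l)) = p * pair z (w.projRight u) := by
        have := sum_counit_smul_map (ℛ k u) (pair z ∘ₗ w.projRight)
        simp only [LinearMap.comp_apply, smul_eq_mul] at this
        rw [← this, Finset.mul_sum]
        exact Finset.sum_congr rfl fun i _ ↦ by ring
      have e2 (y : U) (c : D) : ∑ j ∈ (ℛ k v).index, pair c (w.projRight ((ℛ k v).left j)) *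
          pair (w.projLeft ((ℛ k v).right j * y)) (w.projRight u) =
          ∑ i, pair (r i • c) b * pair (d * (h • r' i • w.projLeft y)) (w.projRight u) := by
        have := congrArg (LinearMap.mul' k k ∘ₗ TensorProduct.map (pair c)
          (pair.flip (w.projRight u))) (w.map_projRight_projLeft_comul hR hD hB hr y d h b)
        rw [← hv, ← (ℛ k v).eq] at this
        simpa [hp.act] using this
      -- The coproduct of x supplies Δ̄(c), and the R left over in `e2` acts on its two legs. After
      -- a flip this is the ordinary coproduct of c, as required by Ω.
      have e3 := tensorAct_copComul (R := R) (w.projLeft x)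
      rw [w.copComul_projLeft hR hD hB, ← (ℛ k x).eq, hr] at e3
      rw [← e3]
      simp only [Repr.tmul_index, Finset.sum_product, Repr.tmul_left, Repr.tmul_right]
      rw [Finset.sum_comm]
      simp only [Finset.sum_comm (s := (ℛ k u).index) (t := (ℛ k x).index)]
      rw [Finset.sum_comm]
      simp only [LinearMap.comp_apply, CoalgHom.toLinearMap_eq_coe, LinearMap.coe_coe, dropLeft_tmul,
        applyRight_tmul, Bialgebra.coe_mulCoalgHom, LinearMap.mul'_apply, map_smul, form_tmul,
        smul_eq_mul, e1, e2, Ω, map_sum, TensorProduct.map_tmul, LinearMap.flip_apply,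
        LinearMap.sum_apply, tensorAct_tmul, LinearEquiv.coe_coe, TensorProduct.comm_tmul,
        LinearMap.mulLeft_apply, leftAct_apply]
      exact Finset.sum_congr rfl fun i _ ↦ Finset.sum_congr rfl fun j _ ↦ mul_comm _ _

omit hp in
lemma counit_projRight (u : U) : counit (R := k) (w.projRight u) = counit (R := k) u := by
  induction u using w.ind with
  | h0 => simp
  | ha x y hx hy => simp only [map_add, hx, hy]
  | hP d h b =>
    rw [w.projRight_mul, Bialgebra.counit_mul, Bialgebra.counit_mul, w.counit_left, w.counit_mid,
      w.counit_right]
    simp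

omit hp in
lemma counit_projLeft (u : U) : counit (R := k) (w.projLeft u) = counit (R := k) u := by
  induction u using w.ind with
  | h0 => simp
  | ha x y hx hy => simp only [map_add, hx, hy]
  | hP d h b =>
    rw [w.projLeft_mul, Bialgebra.counit_mul, Bialgebra.counit_mul, w.counit_left, w.counit_mid,
      w.counit_right]
    simp only [map_smul, smul_eq_mul]
    ring

/-- Since β is a coalgebra map and the product of D is dual to the coproduct of B, convolving two
forms convolves P with Q along Δ̄. The inverse of the cocycle is thus governed by the antipode for
Δ̄. -/
lemma form_mul_form {P Q : D →ₗ[k] D} (hPQ : ∀ d, LinearMap.mul' k D (TensorProduct.map P Q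
      (copComul R D d)) = counit (R := k) d • 1) :
    toConv (w.form (pair ∘ₗ P)) * toConv (w.form (pair ∘ₗ Q)) = 1 := by
  apply WithConv.ext
  ext u v
  simp only [TensorProduct.AlgebraTensorModule.curry_apply, TensorProduct.curry_apply,
    LinearMap.coe_restrictScalars]
  change (_ * _ : WithConv (U ⊗[k] U →ₗ[k] k)) _ = _
  rw [((ℛ k u).tmul (ℛ k v)).convMul_apply]
  have e1 (c d : D) : ∑ i ∈ (ℛ k u).index, pair c (w.projRight ((ℛ k u).left i)) *
      pair d (w.projRight ((ℛ k u).right i)) = pair (c * d) (w.projRight u) := by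
    rw [hp.mul_left, w.comul_projRight hR hD hB, ← (ℛ k u).eq]
    simp
  have e2 := congrArg (pair.flip (w.projRight u)) (hPQ (w.projLeft v))
  rw [w.copComul_projLeft hR hD hB, ← (ℛ k v).eq] at e2
  simp only [map_sum, TensorProduct.map_tmul, LinearMap.mul'_apply, LinearMap.flip_apply, map_smul,
    LinearMap.smul_apply, hp.one_left, w.counit_projLeft hR hD hB, w.counit_projRight hR hD hB,
    smul_eq_mul] at e2
  simp only [Repr.tmul_index, Finset.sum_product, Repr.tmul_left, Repr.tmul_right, form_tmul,
    LinearMap.comp_apply]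
  rw [Finset.sum_comm]
  simp only [e1, e2]
  simp [LinearMap.convOne_def, mul_comm]

lemma isTwoCocycle : IsTwoCocycle (w.form pair) (w.form (pair ∘ₗ SD.symm.toLinearMap)) where
  mul_inv := w.form_mul_form hR hD hB hp (P := LinearMap.id) (mul_antipode_copComul hR hD)
  inv_mul := w.form_mul_form hR hD hB hp (Q := LinearMap.id) (antipode_mul_copComul hR hD)
  cocycle := w.form_cocycle hR hD hB hp

end IsCrossedBialgebra

end Cocycle

/-! ### Products that the twist leaves unchanged. -/

section TwistedProduct

open Coalgebra MulOpposite WithConv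

variable {k U X : Type*} [Field k] [Ring U] [Bialgebra k U] [Ring X] [Algebra k X]

/-- A scalar factor equal to ε ⊗ ε where it is evaluated has no effect. The condition is imposed
only on the legs of one representation of Δ(u), which suits u in a subcoalgebra such as DH. -/
lemma scalarConv_mul_apply_left (F : U ⊗[k] U →ₗ[k] k) (G : WithConv (U ⊗[k] U →ₗ[k] X)) {u : U}
    (v : U) {ι : Type*} (𝓡 : Repr k u ι)
    (h : ∀ i, ∀ v, F (𝓡.left i ⊗ₜ v) = counit (R := k) (𝓡.left i) * counit (R := k) v) :
    (scalarConv X F * G) (u ⊗ₜ v) = G (u ⊗ₜ v) := by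
  rw [(𝓡.tmul (ℛ k v)).convMul_apply]
  simp only [Repr.tmul_index, Finset.sum_product, Repr.tmul_left, Repr.tmul_right, scalarConv,
    LinearMap.comp_apply, Algebra.linearMap_apply, h, Algebra.algebraMap_eq_smul_one,
    smul_mul_assoc, one_mul, mul_smul, ← Finset.smul_sum]
  have e1 (x : U) := sum_counit_smul_map (ℛ k v) (G.ofConv ∘ₗ TensorProduct.mk k U U x)
  have e2 := sum_counit_smul_map 𝓡 (G.ofConv ∘ₗ (TensorProduct.mk k U U).flip v)
  simp only [LinearMap.comp_apply, TensorProduct.mk_apply, LinearMap.flip_apply] at e1 e2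
  exact (Finset.sum_congr rfl fun i _ ↦ congrArg _ (e1 _)).trans e2

lemma mul_scalarConv_apply_left (F : U ⊗[k] U →ₗ[k] k) (G : WithConv (U ⊗[k] U →ₗ[k] X)) {u : U}
    (v : U) {ι : Type*} (𝓡 : Repr k u ι)
    (h : ∀ i, ∀ v, F (𝓡.right i ⊗ₜ v) = counit (R := k) (𝓡.right i) * counit (R := k) v) :
    (G * scalarConv X F) (u ⊗ₜ v) = G (u ⊗ₜ v) := by
  rw [(𝓡.tmul (ℛ k v)).convMul_apply]
  simp only [Repr.tmul_index, Finset.sum_product, Repr.tmul_left, Repr.tmul_right, scalarConv,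
    LinearMap.comp_apply, Algebra.linearMap_apply, h, Algebra.algebraMap_eq_smul_one,
    mul_smul_comm, mul_one, mul_smul, ← Finset.smul_sum]
  have e1 (x : U) := sum_counit_right_smul_map (ℛ k v) (G.ofConv ∘ₗ TensorProduct.mk k U U x)
  have e2 := sum_counit_right_smul_map 𝓡 (G.ofConv ∘ₗ (TensorProduct.mk k U U).flip v)
  simp only [LinearMap.comp_apply, TensorProduct.mk_apply, LinearMap.flip_apply] at e1 e2
  exact (Finset.sum_congr rfl fun i _ ↦ congrArg _ (e1 _)).trans e2

lemma scalarConv_mul_apply_right (F : U ⊗[k] U →ₗ[k] k) (G : WithConv (U ⊗[k] U →ₗ[k] X)) (u : U)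
    {v : U} {ι : Type*} (𝓡 : Repr k v ι)
    (h : ∀ i, ∀ u, F (u ⊗ₜ 𝓡.left i) = counit (R := k) u * counit (R := k) (𝓡.left i)) :
    (scalarConv X F * G) (u ⊗ₜ v) = G (u ⊗ₜ v) := by
  rw [((ℛ k u).tmul 𝓡).convMul_apply]
  simp only [Repr.tmul_index, Finset.sum_product, Repr.tmul_left, Repr.tmul_right, scalarConv,
    LinearMap.comp_apply, Algebra.linearMap_apply, h, Algebra.algebraMap_eq_smul_one,
    smul_mul_assoc, one_mul, mul_smul, ← Finset.smul_sum]
  have e1 (x : U) := sum_counit_smul_map 𝓡 (G.ofConv ∘ₗ TensorProduct.mk k U U x)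
  have e2 := sum_counit_smul_map (ℛ k u) (G.ofConv ∘ₗ (TensorProduct.mk k U U).flip v)
  simp only [LinearMap.comp_apply, TensorProduct.mk_apply, LinearMap.flip_apply] at e1 e2
  exact (Finset.sum_congr rfl fun i _ ↦ congrArg _ (e1 _)).trans e2

lemma mul_scalarConv_apply_right (F : U ⊗[k] U →ₗ[k] k) (G : WithConv (U ⊗[k] U →ₗ[k] X)) (u : U)
    {v : U} {ι : Type*} (𝓡 : Repr k v ι)
    (h : ∀ i, ∀ u, F (u ⊗ₜ 𝓡.right i) = counit (R := k) u * counit (R := k) (𝓡.right i)) :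
    (G * scalarConv X F) (u ⊗ₜ v) = G (u ⊗ₜ v) := by
  rw [((ℛ k u).tmul 𝓡).convMul_apply]
  simp only [Repr.tmul_index, Finset.sum_product, Repr.tmul_left, Repr.tmul_right, scalarConv,
    LinearMap.comp_apply, Algebra.linearMap_apply, h, Algebra.algebraMap_eq_smul_one,
    mul_smul_comm, mul_one, mul_smul, ← Finset.smul_sum]
  have e1 (x : U) := sum_counit_right_smul_map 𝓡 (G.ofConv ∘ₗ TensorProduct.mk k U U x)
  have e2 := sum_counit_right_smul_map (ℛ k u) (G.ofConv ∘ₗ (TensorProduct.mk k U U).flip v)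
  simp only [LinearMap.comp_apply, TensorProduct.mk_apply, LinearMap.flip_apply] at e1 e2
  exact (Finset.sum_congr rfl fun i _ ↦ congrArg _ (e1 _)).trans e2

variable {H B D : Type*} [Ring H] [HopfAlgebra k H]
  [Ring B] [Algebra k B] [Coalgebra k B] [Module Hᵐᵒᵖ B] [IsScalarTower k Hᵐᵒᵖ B]
  [Ring D] [Algebra k D] [Coalgebra k D] [Module H D] [IsScalarTower k H D]
  {R : (H ⊗[k] H)ˣ} {SB : B →ₗ[k] B} {SD : D ≃ₗ[k] D} {pair : D →ₗ[k] B →ₗ[k] k}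
  {iD : D →ₐ[k] U} {iH : H →ₐ[k] U} {iB : B →ₐ[k] U}

lemma counit_antipode_symm (hR : IsQuasitriangular R)
    (hD : IsLeftBraidedGroup (R : H ⊗[k] H) SD.toLinearMap) (d : D) :
    counit (R := k) (SD.symm d) = counit (R := k) d := by
  have h := congrArg (hD.counitHom) (mul_antipode_copComul hR hD d)
  have h1 (z : D ⊗[k] D) : hD.counitHom (LinearMap.mul' k D (TensorProduct.map LinearMap.id
      SD.symm.toLinearMap z)) = counit (R := k) (SD.symm (TensorProduct.lid k D
        ((counit (R := k)).rTensor D z))) := by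
    induction z with
    | zero => simp
    | add x y hx hy => simp only [map_add, hx, hy]
    | tmul x y => simp [hD.counit_mul]
  rw [h1, counit_copComul hR hD] at h
  simpa [hD.counit_one] using h

namespace IsCrossedBialgebra

variable (w : IsCrossedBialgebra R iD iH iB)

variable (hR : IsQuasitriangular R) (hD : IsLeftBraidedGroup (R : H ⊗[k] H) SD.toLinearMap)
  (hB : IsRightBraidedGroup (R : H ⊗[k] H) SB) (hp : IsDualPairing H pair)

include w hR in
/-- The products `d h` span a subcoalgebra. -/
lemma exists_repr_left (d : D) (h : H) : ∃ (ι : Type) (𝓡 : Repr k (iD d * iH h) ι),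
    ∀ i, (∃ d' h', 𝓡.left i = iD d' * iH h') ∧ ∃ d' h', 𝓡.right i = iD d' * iH h' := by
  obtain ⟨m, s, s', hs⟩ := TensorProduct.exists_sum_tmul_eq ((R⁻¹ : (H ⊗[k] H)ˣ) : H ⊗[k] H)
  obtain ⟨n, c₁, c₂, hc⟩ := TensorProduct.exists_sum_tmul_eq (copComul R D d)
  obtain ⟨p, h₁, h₂, hh⟩ := TensorProduct.exists_sum_tmul_eq (comul (R := k) h)
  refine ⟨(Fin n × Fin m) × Fin p,
    { index := Finset.univ
      left := fun i ↦ iD (c₁ i.1.1) * iH (s i.1.2 * h₁ i.2)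
      right := fun i ↦ iD (s' i.1.2 • c₂ i.1.1) * iH (h₂ i.2)
      eq := ?_ }, fun i ↦ ⟨⟨_, _, rfl⟩, ⟨_, _, rfl⟩⟩⟩
  rw [Bialgebra.comul_mul, w.comul_left_eq_sum hR hs hc, w.comul_mid, hh]
  simp only [Fintype.sum_prod_type, map_sum, TensorProduct.map_tmul, Finset.sum_mul]
  simp [Finset.mul_sum, mul_assoc]

include w hR in
/-- The products `h b` span a subcoalgebra. -/
lemma exists_repr_right (h : H) (b : B) : ∃ (ι : Type) (𝓡 : Repr k (iH h * iB b) ι),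
    ∀ i, (∃ h' b', 𝓡.left i = iH h' * iB b') ∧ ∃ h' b', 𝓡.right i = iH h' * iB b' := by
  obtain ⟨m, r, r', hr⟩ := TensorProduct.exists_sum_tmul_eq (R : H ⊗[k] H)
  obtain ⟨n, b₁, b₂, hb⟩ := TensorProduct.exists_sum_tmul_eq (comul (R := k) b)
  obtain ⟨p, h₁, h₂, hh⟩ := TensorProduct.exists_sum_tmul_eq (comul (R := k) h)
  let 𝓑 : Repr k b (Fin n) := ⟨Finset.univ, b₁, b₂, hb.symm⟩
  refine ⟨Fin p × (Fin n × Fin m),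
    { index := Finset.univ
      left := fun i ↦ iH (h₁ i.1) * iB (op (r i.2.2) • b₁ i.2.1)
      right := fun i ↦ iH (h₂ i.1 * r' i.2.2) * iB (b₂ i.2.1)
      eq := ?_ }, fun i ↦ ⟨⟨_, _, rfl⟩, ⟨_, _, rfl⟩⟩⟩
  rw [Bialgebra.comul_mul, w.comul_right_eq_sum hR hr 𝓑, w.comul_mid, hh]
  simp only [Fintype.sum_prod_type, map_sum, TensorProduct.map_tmul, Finset.sum_mul]
  simp [Finset.mul_sum, mul_assoc, 𝓑]

include hR hD hB hp

lemma form_left (d : D) (h : H) (v : U) (P : D →ₗ[k] D)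
    (hP : ∀ d, counit (R := k) (P d) = counit (R := k) d) :
    w.form (pair ∘ₗ P) ((iD d * iH h) ⊗ₜ v) =
      counit (R := k) (iD d * iH h) * counit (R := k) v := by
  have := w.projRight_mul d h 1
  rw [map_one, mul_one] at this
  rw [form_tmul, this, Bialgebra.counit_mul, w.counit_left, w.counit_mid]
  simp [hp.one_right, hP, w.counit_projLeft hR hD hB, mul_assoc]

lemma form_right (h : H) (b : B) (u : U) (P : D →ₗ[k] D) (hP : P 1 = 1) :
    w.form (pair ∘ₗ P) (u ⊗ₜ (iH h * iB b)) =
      counit (R := k) u * counit (R := k) (iH h * iB b) := by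
  have := w.projLeft_mul 1 h b
  rw [map_one, one_mul] at this
  rw [form_tmul, this, Bialgebra.counit_mul, w.counit_right, w.counit_mid]
  simp [hp.one_left, hP, w.counit_projRight hR hD hB, mul_comm]


/-- On DH the projection β takes values ε(d)ε(h)1, where the pairing is a counit. As DH is stable
under the coproduct, both cocycle factors drop out. -/
lemma twistMul_left (d : D) (h : H) (v : U) :
    twistMul (w.form pair) (w.form (pair ∘ₗ SD.symm.toLinearMap)) ((iD d * iH h) ⊗ₜ v) =
      (iD d * iH h) * v := by
  obtain ⟨ι, 𝓡, h𝓡⟩ := w.exists_repr_left hR d h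
  refine (mul_scalarConv_apply_left _ _ v 𝓡 fun i v ↦ ?_).trans
    ((scalarConv_mul_apply_left _ _ v 𝓡 fun i v ↦ ?_).trans rfl)
  · obtain ⟨d', h', e⟩ := (h𝓡 i).2
    rw [e, w.form_left hR hD hB hp _ _ _ _ (counit_antipode_symm hR hD)]
  · obtain ⟨d', h', e⟩ := (h𝓡 i).1
    rw [e]
    exact w.form_left hR hD hB hp d' h' v LinearMap.id fun _ ↦ rfl

/-- Dually, γ is scalar on HB. Among products of two elements of D, H, B, only b times c can be
altered by the twist. -/
lemma twistMul_right (u : U) (h : H) (b : B) :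
    twistMul (w.form pair) (w.form (pair ∘ₗ SD.symm.toLinearMap)) (u ⊗ₜ (iH h * iB b)) =
      u * (iH h * iB b) := by
  obtain ⟨ι, 𝓡, h𝓡⟩ := w.exists_repr_right hR h b
  have h1 : SD.symm.toLinearMap 1 = 1 := by
    rw [LinearEquiv.coe_coe, LinearEquiv.symm_apply_eq, hD.antipode_one]
  refine (mul_scalarConv_apply_right _ _ u 𝓡 fun i v ↦ ?_).trans
    ((scalarConv_mul_apply_right _ _ u 𝓡 fun i v ↦ ?_).trans rfl)
  · obtain ⟨d', h', e⟩ := (h𝓡 i).2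
    rw [e, w.form_right hR hD hB hp _ _ _ _ h1]
  · obtain ⟨d', h', e⟩ := (h𝓡 i).1
    rw [e]
    exact w.form_right hR hD hB hp d' h' v LinearMap.id rfl

end IsCrossedBialgebra

end TwistedProduct

/-! ### The twisted product of b and c. -/

section CrossRelation

open Coalgebra MulOpposite WithConv

variable {k H B D U X : Type*} [Field k] [Ring H] [HopfAlgebra k H]
  [Ring B] [Algebra k B] [Coalgebra k B] [Module Hᵐᵒᵖ B] [IsScalarTower k Hᵐᵒᵖ B]
  [Ring D] [Algebra k D] [Coalgebra k D] [Module H D] [IsScalarTower k H D]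
  {R : (H ⊗[k] H)ˣ} {SB : B →ₗ[k] B} {SD : D ≃ₗ[k] D} {pair : D →ₗ[k] B →ₗ[k] k}
  [Ring U] [Bialgebra k U] [Ring X] [Algebra k X]
  {iD : D →ₐ[k] U} {iH : H →ₐ[k] U} {iB : B →ₐ[k] U}

lemma sum_comm_pairs {M : Type*} [AddCommMonoid M] {ι κ μ ν : Type*} [Fintype ι] [Fintype κ]
    [Fintype μ] [Fintype ν] (f : ι → κ → μ → ν → M) :
    ∑ i, ∑ j, ∑ x, ∑ y, f i j x y = ∑ x, ∑ y, ∑ i, ∑ j, f i j x y := by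
  simp only [← Fintype.sum_prod_type']
  rw [← Equiv.sum_comp (Equiv.mk (fun p : (μ × ν) × ι × κ ↦ (p.2.1, p.2.2, p.1.1, p.1.2))
    (fun p ↦ ((p.2.2.1, p.2.2.2), p.1, p.2.1)) (fun _ ↦ rfl) (fun _ ↦ rfl))]
  simp only [Fintype.sum_prod_type, Equiv.coe_fn_mk]

namespace IsCrossedBialgebra

variable (w : IsCrossedBialgebra R iD iH iB)

/-- The form sees its arguments only through β and γ, so the short formulas for (β ⊗ id)Δ and (γ ⊗
id)Δ suffice to evaluate the convolution. -/
lemma scalarConv_form_mul (f : D →ₗ[k] B →ₗ[k] k) (G : WithConv (U ⊗[k] U →ₗ[k] X)) {u v : U}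
    {ι κ : Type*} [Fintype ι] [Fintype κ] {a : ι → B} {x : ι → U} {c : κ → D} {y : κ → U}
    (hu : TensorProduct.map w.projRight LinearMap.id (comul (R := k) u) = ∑ i, a i ⊗ₜ[k] x i)
    (hv : TensorProduct.map w.projLeft LinearMap.id (comul (R := k) v) = ∑ j, c j ⊗ₜ[k] y j) :
    (scalarConv X (w.form f) * G) (u ⊗ₜ v) = ∑ i, ∑ j, f (c j) (a i) • G (x i ⊗ₜ y j) := by
  have e1 (c : D) (y : U) := congrArg ((TensorProduct.lid k X).toLinearMap ∘ₗ
    TensorProduct.map (f c) (G.ofConv ∘ₗ (TensorProduct.mk k U U).flip y)) hu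
  have e2 (a : B) (x : U) := congrArg ((TensorProduct.lid k X).toLinearMap ∘ₗ
    TensorProduct.map (f.flip a) (G.ofConv ∘ₗ TensorProduct.mk k U U x)) hv
  rw [← (ℛ k u).eq] at e1
  rw [← (ℛ k v).eq] at e2
  simp only [map_sum, LinearMap.comp_apply, TensorProduct.map_tmul, LinearEquiv.coe_coe,
    TensorProduct.lid_tmul, TensorProduct.mk_apply, LinearMap.flip_apply, LinearMap.id_apply]
    at e1 e2
  rw [((ℛ k u).tmul (ℛ k v)).convMul_apply]
  simp only [Repr.tmul_index, Finset.sum_product, Repr.tmul_left, Repr.tmul_right, scalarConv,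
    LinearMap.comp_apply, Algebra.linearMap_apply, Algebra.algebraMap_eq_smul_one,
    smul_mul_assoc, one_mul, form_tmul]
  refine (Finset.sum_congr rfl fun i _ ↦ e2 _ _).trans ?_
  rw [Finset.sum_comm]
  refine (Finset.sum_congr rfl fun i _ ↦ e1 _ _).trans ?_
  rw [Finset.sum_comm]

lemma mul_scalarConv_form (f : D →ₗ[k] B →ₗ[k] k) (G : WithConv (U ⊗[k] U →ₗ[k] X)) {u v : U}
    {ι κ : Type*} [Fintype ι] [Fintype κ] {a : ι → B} {x : ι → U} {c : κ → D} {y : κ → U}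
    (hu : TensorProduct.map LinearMap.id w.projRight (comul (R := k) u) = ∑ i, x i ⊗ₜ[k] a i)
    (hv : TensorProduct.map LinearMap.id w.projLeft (comul (R := k) v) = ∑ j, y j ⊗ₜ[k] c j) :
    (G * scalarConv X (w.form f)) (u ⊗ₜ v) = ∑ i, ∑ j, f (c j) (a i) • G (x i ⊗ₜ y j) := by
  have e1 (c : D) (y : U) := congrArg ((TensorProduct.rid k X).toLinearMap ∘ₗ
    TensorProduct.map (G.ofConv ∘ₗ (TensorProduct.mk k U U).flip y) (f c)) hu
  have e2 (a : B) (x : U) := congrArg ((TensorProduct.rid k X).toLinearMap ∘ₗ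
    TensorProduct.map (G.ofConv ∘ₗ TensorProduct.mk k U U x) (f.flip a)) hv
  rw [← (ℛ k u).eq] at e1
  rw [← (ℛ k v).eq] at e2
  simp only [map_sum, LinearMap.comp_apply, TensorProduct.map_tmul, LinearEquiv.coe_coe,
    TensorProduct.rid_tmul, TensorProduct.mk_apply, LinearMap.flip_apply, LinearMap.id_apply]
    at e1 e2
  rw [((ℛ k u).tmul (ℛ k v)).convMul_apply]
  simp only [Repr.tmul_index, Finset.sum_product, Repr.tmul_left, Repr.tmul_right, scalarConv,
    LinearMap.comp_apply, Algebra.linearMap_apply, Algebra.algebraMap_eq_smul_one,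
    mul_smul_comm, mul_one, form_tmul]
  refine (Finset.sum_congr rfl fun i _ ↦ e2 _ _).trans ?_
  rw [Finset.sum_comm]
  refine (Finset.sum_congr rfl fun i _ ↦ e1 _ _).trans ?_
  rw [Finset.sum_comm]

variable (hR : IsQuasitriangular R) (hD : IsLeftBraidedGroup (R : H ⊗[k] H) SD.toLinearMap)
  (hB : IsRightBraidedGroup (R : H ⊗[k] H) SB) (hp : IsDualPairing H pair)

variable {ι κ : Type*} [Fintype ι] [Fintype κ] {r r' : ι → H} {s s' : κ → H}

include hR hB hD in
lemma map_projRight_mid_mul_right {h : H} {b : B} {ν : Type*} [Fintype ν] {b₁ b₂ : ν → B}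
    (hb : comul (R := k) b = ∑ y, b₁ y ⊗ₜ[k] b₂ y) :
    TensorProduct.map LinearMap.id w.projRight (comul (R := k) (iH h * iB b)) =
      ∑ y, (iH h * iB (b₁ y)) ⊗ₜ[k] b₂ y := by
  obtain ⟨m, r, r', hr⟩ := TensorProduct.exists_sum_tmul_eq (R : H ⊗[k] H)
  let 𝓑 : Repr k b ν := ⟨Finset.univ, b₁, b₂, hb.symm⟩
  have e1 (b : B) := congrArg (fun h ↦ iB (op h • b)) (hR.sum_counit_right hr)
  have e2 := sum_counit_right_smul_map (ℛ k h) iH.toLinearMap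
  simp only [AlgHom.toLinearMap_apply] at e2
  simp only [Finset.op_sum, Finset.sum_smul, op_smul, smul_assoc, op_one, one_smul, map_sum,
    map_smul] at e1
  rw [Bialgebra.comul_mul, w.comul_mid_eq_sum (ℛ k h), w.comul_right_eq_sum hR hr 𝓑]
  simp only [Finset.sum_mul, Finset.mul_sum, map_sum, Algebra.TensorProduct.tmul_mul_tmul,
    TensorProduct.map_tmul, LinearMap.id_apply, w.projRight_mid_mul hD hB, w.projRight_right hD hB,
    map_smul]
  have e3 (y : U) (i : Fin m) (b : B) : ∑ x ∈ (ℛ k h).index, (iH ((ℛ k h).left x) * y) ⊗ₜ[k]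
      (counit (R := k) ((ℛ k h).right x) • counit (R := k) (r' i) • b) =
      counit (R := k) (r' i) • ((iH h * y) ⊗ₜ[k] b) := by
    rw [← e2]
    simp only [Finset.sum_mul, TensorProduct.sum_tmul, Finset.smul_sum, TensorProduct.tmul_smul,
      smul_mul_assoc, ← TensorProduct.smul_tmul', smul_comm (counit (R := k) (r' i))]
  have e4 (y : ν) (i : Fin m) := e3 (iB (op (r i) • b₁ y)) i (b₂ y)
  refine (Finset.sum_congr rfl fun y _ ↦ Finset.sum_congr rfl fun i _ ↦ e4 y i).trans ?_
  refine Finset.sum_congr rfl fun y _ ↦ ?_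
  rw [← e1 (b₁ y)]
  simp only [Finset.mul_sum, TensorProduct.sum_tmul, mul_smul_comm, ← TensorProduct.smul_tmul']


include hR hB hD in
lemma map_projLeft_comul_left' (hs : ((R⁻¹ : (H ⊗[k] H)ˣ) : H ⊗[k] H) = ∑ i, s i ⊗ₜ[k] s' i)
    {c : D} {μ : Type*} [Fintype μ] {c₁ c₂ : μ → D}
    (hc : copComul R D c = ∑ x, c₁ x ⊗ₜ[k] c₂ x) :
    TensorProduct.map LinearMap.id w.projLeft (comul (R := k) (iD c)) =
      ∑ x : μ × κ, (iD (c₁ x.1) * iH (s x.2)) ⊗ₜ[k] (s' x.2 • c₂ x.1) := by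
  rw [w.comul_left_eq_sum hR hs hc, Fintype.sum_prod_type]
  simp [w.projLeft_left hD hB]

include w in
/-- The normal ordering of `R⁽²⁾ d`. -/
lemma sum_smul_mid_mul_left (hR : IsQuasitriangular R) (hp : IsDualPairing H pair)
    (hr : (R : H ⊗[k] H) = ∑ i, r i ⊗ₜ[k] r' i) (c₁ c₂ : D)
    (b : B) : ∑ i, pair c₁ (op (r i) • b) • (iH (r' i) * iD c₂) =
      ∑ i, ∑ j, pair (r i • c₁) (op (r j) • b) • (iD (r' i • c₂) * iH (r' j)) := by
  have := congrArg ((TensorProduct.lid k U).toLinearMap ∘ₗ TensorProduct.map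
    (pair c₁ ∘ₗ (rightAct k H B).flip b) (pushLeft iD.toLinearMap iH.toLinearMap c₂))
    (hR.sum_expandRight hr)
  simp only [map_sum, LinearMap.comp_apply, TensorProduct.map_tmul, ← w.hd, LinearEquiv.coe_coe,
    TensorProduct.lid_tmul, LinearMap.flip_apply, rightAct_apply, pushLeft_tmul,
    AlgHom.toLinearMap_apply, op_mul, mul_smul] at this
  rw [this, Finset.sum_comm]
  simp only [hp.act]

include w in
/-- The normal ordering of `b R⁻⁽¹⁾`. -/
lemma sum_smul_right_mul_mid (hR : IsQuasitriangular R)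
    (hD : IsLeftBraidedGroup (R : H ⊗[k] H) SD.toLinearMap) (hp : IsDualPairing H pair)
    (hs : ((R⁻¹ : (H ⊗[k] H)ˣ) : H ⊗[k] H) = ∑ i, s i ⊗ₜ[k] s' i)
    (c : D) (b₂ b₃ : B) : ∑ i, pair (SD.symm (s' i • c)) b₃ • (iB b₂ * iH (s i)) =
      ∑ i, ∑ j, pair (s' i • SD.symm c) (op (s' j) • b₃) • (iH (s i) * iB (op (s j) • b₂)) := by
  have := congrArg (((TensorProduct.rid k U).toLinearMap ∘ₗ TensorProduct.map
    (pushRight iH.toLinearMap iB.toLinearMap b₂)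
    (pair.flip b₃ ∘ₗ SD.symm.toLinearMap ∘ₗ (leftAct k H D).flip c)) ∘ₗ
    (TensorProduct.assoc k H H H).symm.toLinearMap)
    (hR.sum_expandLeft_inv hs)
  simp only [map_sum, LinearMap.comp_apply, TensorProduct.map_tmul, ← w.bh, LinearEquiv.coe_coe,
    TensorProduct.rid_tmul, LinearMap.flip_apply, leftAct_apply, pushRight_tmul,
    TensorProduct.assoc_symm_tmul, LinearEquiv.symm_apply_apply,
    AlgHom.toLinearMap_apply, mul_smul] at this
  rw [this, Finset.sum_comm]
  simp only [hD.antipode_symm_act, ← hp.act]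

include hR hD hB hp

/-- The cocycle removes the outer legs of b and c and leaves R⁽²⁾ c₍₂₎ b₍₂₎ R⁻⁽¹⁾ in the middle,
since c₍₂₎ and b₍₂₎ commute before twisting. Bringing R⁽²⁾ to the right of c₍₂₎ and R⁻⁽¹⁾ to the
left of b₍₂₎ doubles each of R and R⁻¹, whence the four copies in the cross relation. -/
lemma twistMul_right_left (hr : (R : H ⊗[k] H) = ∑ i, r i ⊗ₜ[k] r' i)
    (hs : ((R⁻¹ : (H ⊗[k] H)ˣ) : H ⊗[k] H) = ∑ i, s i ⊗ₜ[k] s' i)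
    (b : B) (c : D) {μ ν : Type*} [Fintype μ] [Fintype ν] {c₁ c₂ c₃ : μ → D} {b₁ b₂ b₃ : ν → B}
    (hc : (copComul R D).lTensor D (copComul R D c) = ∑ x, c₁ x ⊗ₜ[k] (c₂ x ⊗ₜ[k] c₃ x))
    (hb : (comul (R := k) (A := B)).lTensor B (comul (R := k) b) =
      ∑ y, b₁ y ⊗ₜ[k] (b₂ y ⊗ₜ[k] b₃ y)) :
    twistMul (w.form pair) (w.form (pair ∘ₗ SD.symm.toLinearMap)) (iB b ⊗ₜ iD c) =
      ∑ i₁, ∑ i₂, ∑ j₁, ∑ j₂, ∑ x, ∑ y,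
        (pair (r i₁ • c₁ x) (op (r i₂) • b₁ y) *
          pair (s' j₁ • SD.symm (c₃ x)) (op (s' j₂) • b₃ y)) •
        (iD (r' i₁ • c₂ x) * (iH (r' i₂ * s j₁) * iB (op (s j₂) • b₂ y))) := by
  let Φ (i : ι) (j : κ) (b₁ b₂ b₃ : B) (c₁ c₂ c₃ : D) : U :=
    (pair c₁ (op (r i) • b₁) * pair (SD.symm (s' j • c₃)) b₃) •
      ((iH (r' i) * iD c₂) * (iB b₂ * iH (s j)))
  have key : twistMul (w.form pair) (w.form (pair ∘ₗ SD.symm.toLinearMap)) (iB b ⊗ₜ iD c) =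
      ∑ i, ∑ j, ∑ x, ∑ y, Φ i j (b₁ y) (b₂ y) (b₃ y) (c₁ x) (c₂ x) (c₃ x) := by
    obtain ⟨n, b₁', b₂', hb'⟩ := TensorProduct.exists_sum_tmul_eq (comul (R := k) b)
    obtain ⟨m, c₁', c₂', hc'⟩ := TensorProduct.exists_sum_tmul_eq (copComul R D c)
    -- The iterated coproducts arise as nested sums. `e2` and `e3` translate these into the given
    -- expressions by applying linear functionals to `hb` and `hc`.
    choose p a₁ a₂ ha using fun y ↦ TensorProduct.exists_sum_tmul_eq (comul (R := k) (b₂' y))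
    choose q d₁ d₂ hd using fun x ↦ TensorProduct.exists_sum_tmul_eq (copComul R D (c₂' x))
    let 𝓑 : Repr k b (Fin n) := ⟨Finset.univ, b₁', b₂', hb'.symm⟩
    have hu := w.map_projRight_comul_right hR hD hB hr 𝓑
    rw [← Fintype.sum_prod_type' (f := fun y i ↦
      (op (r i) • b₁' y) ⊗ₜ[k] (iH (r' i) * iB (b₂' y)))] at hu
    have hv := w.map_projLeft_comul_left hR hD hB c
    rw [hc'] at hv
    simp only [map_sum, TensorProduct.map_tmul, LinearMap.id_apply,
      AlgHom.toLinearMap_apply] at hv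
    have e1 (y : Fin n) (i : ι) (x : Fin m) := w.mul_scalarConv_form (X := U)
      (pair ∘ₗ SD.symm.toLinearMap) (toConv (LinearMap.mul' k U))
      (w.map_projRight_mid_mul_right hR hD hB (h := r' i) (ha y))
      (w.map_projLeft_comul_left' hR hD hB hs (hd x))
    rw [twistMul, mul_assoc]
    refine (w.scalarConv_form_mul _ _ hu hv).trans ?_
    simp only [e1]
    have e2 (i : ι) (j : κ) (c₁ c₂ c₃ : D) := congrArg ((TensorProduct.lid k U).toLinearMap ∘ₗ
      TensorProduct.map (pair c₁ ∘ₗ rightAct k H B (r i)) ((TensorProduct.rid k U).toLinearMap ∘ₗ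
        TensorProduct.map (LinearMap.mulLeft k (iH (r' i) * iD c₂) ∘ₗ
          LinearMap.mulRight k (iH (s j)) ∘ₗ iB.toLinearMap) (pair (SD.symm (s' j • c₃))))) hb
    have e3 (i : ι) (j : κ) (b₁ b₂ b₃ : B) := congrArg ((TensorProduct.lid k U).toLinearMap ∘ₗ
      TensorProduct.map (pair.flip (op (r i) • b₁)) ((TensorProduct.rid k U).toLinearMap ∘ₗ
        TensorProduct.map (LinearMap.mulLeft k (iH (r' i)) ∘ₗ
          LinearMap.mulRight k (iB b₂ * iH (s j)) ∘ₗ iD.toLinearMap)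
          (pair.flip b₃ ∘ₗ SD.symm.toLinearMap ∘ₗ leftAct k H D (s' j)))) hc
    rw [hb'] at e2
    rw [hc'] at e3
    simp only [map_sum, LinearMap.lTensor_tmul, ha, hd, TensorProduct.tmul_sum,
      LinearMap.comp_apply, TensorProduct.map_tmul, LinearEquiv.coe_coe, TensorProduct.lid_tmul,
      TensorProduct.rid_tmul, LinearMap.flip_apply, leftAct_apply, rightAct_apply,
      LinearMap.mulLeft_apply, LinearMap.mulRight_apply, AlgHom.toLinearMap_apply] at e2 e3
    have e4 (i : ι) (y : Fin n) (y' : Fin (p y)) (x : Fin m) (x' : Fin (q x)) (j : κ) :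
        iH (r' i) * iB (a₁ y y') * (iD (d₁ x x') * iH (s j)) =
          iH (r' i) * (iD (d₁ x x') * (iB (a₁ y y') * iH (s j))) := by
      rw [mul_assoc, ← mul_assoc (iB _), w.bd, mul_assoc]
    simp only [Fintype.sum_prod_type, LinearMap.comp_apply, LinearMap.mul'_apply, e4,
      LinearEquiv.coe_coe, Finset.smul_sum]
    simp only [Φ, Finset.sum_comm (t := (Finset.univ : Finset κ))]
    simp only [Finset.sum_comm (t := (Finset.univ : Finset ι))]
    refine Finset.sum_congr rfl fun i _ ↦ Finset.sum_congr rfl fun j _ ↦ ?_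
    calc _ = ∑ y, ∑ y', ∑ x, ∑ x', pair (c₁' x) (op (r i) • b₁' y) •
              pair (SD.symm (s' j • d₂ x x')) (a₂ y y') •
                (iH (r' i) * (iD (d₁ x x') * (iB (a₁ y y') * iH (s j)))) :=
          Finset.sum_congr rfl fun y _ ↦ Finset.sum_comm
      _ = ∑ y, ∑ y', ∑ x, pair (c₁ x) (op (r i) • b₁' y) •
              pair (SD.symm (s' j • c₃ x)) (a₂ y y') •
                (iH (r' i) * (iD (c₂ x) * (iB (a₁ y y') * iH (s j)))) :=
          Finset.sum_congr rfl fun y _ ↦ Finset.sum_congr rfl fun y' _ ↦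
            e3 i j (b₁' y) (a₁ y y') (a₂ y y')
      _ = ∑ x, ∑ y, ∑ y', pair (c₁ x) (op (r i) • b₁' y) •
              pair (SD.symm (s' j • c₃ x)) (a₂ y y') •
                (iH (r' i) * iD (c₂ x) * (iB (a₁ y y') * iH (s j))) := by
          simp only [mul_assoc]
          rw [Finset.sum_comm]
          exact Finset.sum_congr rfl fun y _ ↦ Finset.sum_comm
      _ = _ := by
          refine Finset.sum_congr rfl fun x _ ↦ (e2 i j (c₁ x) (c₂ x) (c₃ x)).trans ?_
          simp only [mul_smul]
  rw [key]
  have step (b₁ b₂ b₃ : B) (c₁ c₂ c₃ : D) : ∑ i, ∑ j, Φ i j b₁ b₂ b₃ c₁ c₂ c₃ =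
      ∑ i₁, ∑ i₂, ∑ j₁, ∑ j₂, (pair (r i₁ • c₁) (op (r i₂) • b₁) *
          pair (s' j₁ • SD.symm c₃) (op (s' j₂) • b₃)) •
        (iD (r' i₁ • c₂) * (iH (r' i₂ * s j₁) * iB (op (s j₂) • b₂))) := by
    have h1 := w.sum_smul_mid_mul_left hR hp hr c₁ c₂ b₁
    have h2 := w.sum_smul_right_mul_mid hR hD hp hs c₃ b₂ b₃
    -- The two normal orderings take place on either side of the middle of c₍₂₎ b₍₂₎ and do not
    -- interact, so their formulas can simply be multiplied.
    have h3 := congrArg₂ (· * ·) h1 h2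
    simp only [Finset.sum_mul, smul_mul_assoc] at h3
    simp only [Finset.mul_sum, mul_smul_comm, smul_smul, ← mul_assoc] at h3
    simpa [Φ, map_mul, mul_assoc, Finset.smul_sum, smul_smul] using h3
  rw [sum_comm_pairs]
  simp only [step]
  rw [sum_comm_pairs]
  exact Finset.sum_congr rfl fun _ _ ↦ Finset.sum_congr rfl fun _ _ ↦ sum_comm_pairs _

end IsCrossedBialgebra
end CrossRelation

/-! ### The twisted bialgebra on a copy of the coalgebra. -/

section Twist

open Coalgebra MulOpposite WithConv

universe uU

/-- A copy of a coalgebra, to carry another product. -/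
def Copy (U : Type uU) : Type uU := U

instance {U : Type uU} [AddCommGroup U] : AddCommGroup (Copy U) := inferInstanceAs (AddCommGroup U)

instance {k : Type*} {U : Type uU} [Field k] [AddCommGroup U] [Module k U] : Module k (Copy U) :=
  inferInstanceAs (Module k U)

instance {k : Type*} {U : Type uU} [Field k] [AddCommGroup U] [Module k U] [Coalgebra k U] :
    Coalgebra k (Copy U) := inferInstanceAs (Coalgebra k U)

/-- Twisting a bialgebra by a two-cocycle. -/
theorem IsTwoCocycle.exists_twist {k : Type*} {U : Type uU} [Field k] [Ring U] [Bialgebra k U]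
    {σ σ' : U ⊗[k] U →ₗ[k] k} (hσ : IsTwoCocycle σ σ')
    (one_mul : ∀ u, twistMul σ σ' (1 ⊗ₜ u) = u) (mul_one : ∀ u, twistMul σ σ' (u ⊗ₜ 1) = u) :
    ∃ (V : Type uU) (_ : Ring V) (_ : Bialgebra k V) (e : U ≃ₗ[k] V), e 1 = 1 ∧
      (∀ u v, e u * e v = e (twistMul σ σ' (u ⊗ₜ v))) ∧
      (∀ u, comul (R := k) (e u) = TensorProduct.map e.toLinearMap e.toLinearMap (comul u)) ∧
      ∀ u, counit (R := k) (e u) = counit (R := k) u := by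
  let m : U →ₗ[k] U →ₗ[k] U := TensorProduct.curry (twistMul σ σ')
  let e : U ≃ₗ[k] Copy U := LinearEquiv.refl k U
  letI ring : Ring (Copy U) :=
    { (inferInstance : AddCommGroup (Copy U)) with
      mul := fun u v ↦ e (m (e.symm u) (e.symm v))
      one := e 1
      one_mul := one_mul
      mul_one := mul_one
      mul_assoc := hσ.twistMul_assoc
      left_distrib := fun u v x ↦ map_add (m (e.symm u)) (e.symm v) (e.symm x)
      right_distrib := fun u v x ↦ LinearMap.map_add₂ m (e.symm u) (e.symm v) (e.symm x)
      zero_mul := fun u ↦ LinearMap.map_zero₂ m (e.symm u)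
      mul_zero := fun u ↦ map_zero (m (e.symm u)) }
  letI alg : Algebra k (Copy U) := Algebra.ofModule
    (fun a u v ↦ LinearMap.map_smul₂ m a (e.symm u) (e.symm v))
    (fun a u v ↦ map_smul (m (e.symm u)) a (e.symm v))
  have hc (u : U) : comul (R := k) (e u) =
      TensorProduct.map e.toLinearMap e.toLinearMap (comul (R := k) u) := by
    change comul (R := k) u = TensorProduct.map LinearMap.id LinearMap.id _
    rw [TensorProduct.map_id]; rfl
  letI bialg : Bialgebra k (Copy U) := Bialgebra.mk' k (Copy U)
    (by exact (Bialgebra.counit_one : counit (R := k) (1 : U) = 1))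
    (by intro a b; exact hσ.counit_twistMul _ _)
    (by exact (Bialgebra.comul_one : comul (R := k) (1 : U) = 1))
    (by
      intro a b
      obtain ⟨a, rfl⟩ := e.surjective a
      obtain ⟨b, rfl⟩ := e.surjective b
      change comul (R := k) (e (twistMul σ σ' (a ⊗ₜ b))) = comul (e a) * comul (e b)
      rw [hc, hc, hc, hσ.comul_twistMul, ← ((ℛ k a).tmul (ℛ k b)).eq, ← (ℛ k a).eq, ← (ℛ k b).eq]
      simp only [Repr.tmul_index, Finset.sum_product, Repr.tmul_left, Repr.tmul_right, map_sum,
        TensorProduct.map_tmul, Finset.sum_mul_sum, Algebra.TensorProduct.tmul_mul_tmul]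
      rfl)
  exact ⟨Copy U, ring, bialg, e, rfl, fun _ _ ↦ rfl, hc, fun _ ↦ rfl⟩

end Twist

/-! ### The double-bosonisation as a bialgebra. -/

section Double

open Coalgebra MulOpposite WithConv

universe uU

variable {k H B D V : Type*} [Field k] [Ring H] [HopfAlgebra k H]
  [Ring B] [Algebra k B] [Coalgebra k B] [Module Hᵐᵒᵖ B] [IsScalarTower k Hᵐᵒᵖ B]
  [Ring D] [Algebra k D] [Coalgebra k D] [Module H D] [IsScalarTower k H D]
  {R : (H ⊗[k] H)ˣ} {SB : B →ₗ[k] B} {SD : D ≃ₗ[k] D} {pair : D →ₗ[k] B →ₗ[k] k}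

/-- The double-bosonisation as a bialgebra generated by `D`, `H` and `B`. -/
structure IsDoubleBialgebra [Ring V] [Bialgebra k V] (R : (H ⊗[k] H)ˣ) (SD : D ≃ₗ[k] D)
    (pair : D →ₗ[k] B →ₗ[k] k) (jD : D →ₐ[k] V) (jH : H →ₐ[k] V) (jB : B →ₐ[k] V) : Prop where
  hd : ∀ h d, jH h * jD d = pushLeft jD.toLinearMap jH.toLinearMap d (comul (R := k) h)
  bh : ∀ b h, jB b * jH h = pushRight jH.toLinearMap jB.toLinearMap b (comul (R := k) h)
  bijective : Function.Bijective (tripleMap jD.toLinearMap jH.toLinearMap jB.toLinearMap)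
  comul_left : ∀ (d : D) {n m : ℕ} {s s' : Fin m → H} {c₁ c₂ : Fin n → D},
    ((R⁻¹ : (H ⊗[k] H)ˣ) : H ⊗[k] H) = ∑ i, s i ⊗ₜ[k] s' i →
    copComul R D d = ∑ x, c₁ x ⊗ₜ[k] c₂ x →
    comul (R := k) (jD d) = ∑ x, ∑ i, (jD (c₁ x) * jH (s i)) ⊗ₜ[k] jD (s' i • c₂ x)
  comul_mid : ∀ h, comul (R := k) (jH h) = TensorProduct.map jH.toLinearMap jH.toLinearMap
    (comul (R := k) h)
  comul_right : ∀ (b : B) {n m : ℕ} {r r' : Fin m → H} {b₁ b₂ : Fin n → B},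
    (R : H ⊗[k] H) = ∑ i, r i ⊗ₜ[k] r' i →
    comul (R := k) b = ∑ y, b₁ y ⊗ₜ[k] b₂ y →
    comul (R := k) (jB b) = ∑ y, ∑ i, jB (op (r i) • b₁ y) ⊗ₜ[k] (jH (r' i) * jB (b₂ y))
  counit_left : ∀ d, counit (R := k) (jD d) = counit (R := k) d
  counit_mid : ∀ h, counit (R := k) (jH h) = counit (R := k) h
  counit_right : ∀ b, counit (R := k) (jB b) = counit (R := k) b
  cross : ∀ (b : B) (c : D) {l m p q : ℕ} {r r' : Fin l → H} {s s' : Fin m → H}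
    {c₁ c₂ c₃ : Fin p → D} {b₁ b₂ b₃ : Fin q → B},
    (R : H ⊗[k] H) = ∑ i, r i ⊗ₜ[k] r' i →
    ((R⁻¹ : (H ⊗[k] H)ˣ) : H ⊗[k] H) = ∑ i, s i ⊗ₜ[k] s' i →
    (copComul R D).lTensor D (copComul R D c) = ∑ x, c₁ x ⊗ₜ[k] (c₂ x ⊗ₜ[k] c₃ x) →
    (comul (R := k) (A := B)).lTensor B (comul (R := k) b) =
      ∑ y, b₁ y ⊗ₜ[k] (b₂ y ⊗ₜ[k] b₃ y) →
    jB b * jD c = ∑ i₁, ∑ i₂, ∑ j₁, ∑ j₂, ∑ x, ∑ y,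
        (pair (r i₁ • c₁ x) (op (r i₂) • b₁ y) *
          pair (s' j₁ • SD.symm (c₃ x)) (op (s' j₂) • b₃ y)) •
        (jD (r' i₁ • c₂ x) * (jH (r' i₂ * s j₁) * jB (op (s j₂) • b₂ y)))

/-- The inclusions of D, H and B stay algebra maps because the twist is invisible on products with
left factor in DH or right factor in HB. The same facts keep each element dhb in place, and with it
the triangular decomposition. -/
theorem IsCrossedBialgebra.exists_doubleBialgebra {U : Type uU} [Ring U] [Bialgebra k U]
    {iD : D →ₐ[k] U} {iH : H →ₐ[k] U} {iB : B →ₐ[k] U} (w : IsCrossedBialgebra R iD iH iB)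
    (hR : IsQuasitriangular R) (hD : IsLeftBraidedGroup (R : H ⊗[k] H) SD.toLinearMap)
    (hB : IsRightBraidedGroup (R : H ⊗[k] H) SB) (hp : IsDualPairing H pair) :
    ∃ (V : Type uU) (_ : Ring V) (_ : Bialgebra k V) (jD : D →ₐ[k] V) (jH : H →ₐ[k] V)
      (jB : B →ₐ[k] V), IsDoubleBialgebra R SD pair jD jH jB := by
  have left := w.twistMul_left hR hD hB hp
  have right := w.twistMul_right hR hD hB hp
  have left1 (d) (v) := left d 1 v
  have mid1 (h) (v) := left 1 h v
  have right1 (u) (b) := right u 1 b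
  have mid2 (u) (h) := right u h 1
  simp only [map_one, mul_one, one_mul] at left1 mid1 right1 mid2
  obtain ⟨V, _, _, e, e1, em, ec, eε⟩ := (w.isTwoCocycle hR hD hB hp).exists_twist
    (by simpa using left 1 1) (by simpa using fun u ↦ right u 1 1)
  let jD : D →ₐ[k] V := AlgHom.ofLinearMap (e.toLinearMap ∘ₗ iD.toLinearMap)
    (by simp [e1]) (fun x y ↦ by simp [em, left1])
  let jH : H →ₐ[k] V := AlgHom.ofLinearMap (e.toLinearMap ∘ₗ iH.toLinearMap)
    (by simp [e1]) (fun x y ↦ by simp [em, mid1])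
  let jB : B →ₐ[k] V := AlgHom.ofLinearMap (e.toLinearMap ∘ₗ iB.toLinearMap)
    (by simp [e1]) (fun x y ↦ by simp [em, right1])
  have hjD (d) : jD d = e (iD d) := rfl
  have hjH (h) : jH h = e (iH h) := rfl
  have hjB (b) : jB b = e (iB b) := rfl
  have triple (z) : tripleMap jD.toLinearMap jH.toLinearMap jB.toLinearMap z =
      e (tripleMap iD.toLinearMap iH.toLinearMap iB.toLinearMap z) := by
    induction z with
    | zero => simp
    | add x y hx hy => simp only [map_add, hx, hy]
    | tmul d z =>
      induction z with
      | zero => simp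
      | add x y hx hy => simp only [map_add, TensorProduct.tmul_add, hx, hy]
      | tmul h b => simp [hjB, hjH, hjD, em, left1, right1]
  refine ⟨V, _, _, jD, jH, jB, ?_⟩
  constructor
  · intro h d
    rw [hjH, hjD, em, mid1, w.hd, ← (ℛ k h).eq]
    simp [hjD, hjH, em, left1]
  · intro b h
    rw [hjB, hjH, em, mid2, w.bh, ← (ℛ k h).eq]
    simp [hjB, hjH, em, right1]
  · convert e.bijective.comp w.bijective using 1
    exact funext triple
  · intro d n m s s' c₁ c₂ hs hc
    rw [hjD, ec, w.comul_left_eq_sum hR hs hc]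
    simp [hjD, hjH, em, left1]
  · intro h
    rw [hjH, ec, w.comul_mid, ← (ℛ k h).eq]
    simp [hjH]
  · intro b n m r r' b₁ b₂ hr hb
    let 𝓑 : Repr k b (Fin n) := ⟨Finset.univ, b₁, b₂, hb.symm⟩
    rw [hjB, ec, w.comul_right_eq_sum hR hr 𝓑]
    simp [hjB, hjH, em, right1, 𝓑]
  · simp [hjD, eε, w.counit_left]
  · simp [hjH, eε, w.counit_mid]
  · simp [hjB, eε, w.counit_right]
  · intro b c l m p q r r' s s' c₁ c₂ c₃ b₁ b₂ b₃ hr hs hc hb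
    rw [hjB, hjD, em, w.twistMul_right_left hR hD hB hp hr hs b c hc hb]
    simp only [map_sum, map_smul, hjD, hjH, hjB, em, right1, left1, map_mul]

end Double

/-! ### The antipode of the double-bosonisation. -/

section Antipode

open Coalgebra MulOpposite

variable {k H B D V : Type*} [Field k] [Ring H] [HopfAlgebra k H]
  [Ring B] [Algebra k B] [Coalgebra k B] [Module Hᵐᵒᵖ B] [IsScalarTower k Hᵐᵒᵖ B]
  [Ring D] [Algebra k D] [Coalgebra k D] [Module H D] [IsScalarTower k H D]
  {R : (H ⊗[k] H)ˣ} {SB : B →ₗ[k] B} {SD : D ≃ₗ[k] D} {pair : D →ₗ[k] B →ₗ[k] k}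
  [Ring V]

lemma IsRightBraidedGroup.smul_mul_eq_map (hB : IsRightBraidedGroup (R : H ⊗[k] H) SB) (h : H)
    (p q : B) : op h • (p * q) = LinearMap.mul' k B
      (TensorProduct.map ((rightAct k H B).flip p) ((rightAct k H B).flip q)
        (comul (R := k) h)) := by
  rw [hB.act_mul]
  induction comul (R := k) h with
  | zero => simp
  | add x y hx hy => simp only [map_add, LinearMap.add_apply, hx, hy]
  | tmul x y => simp

section

variable [Algebra k V] {ι ν : Type*} [Fintype ι] [Fintype ν] {r r' s s' : ι → H}
  {c₁ c₂ : ν → D} {b₁ b₂ : ν → B} {jD : D →ₐ[k] V} {jH : H →ₐ[k] V} {jB : B →ₐ[k] V}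

/-- The antipode on `D`, `c ↦ S(R⁻⁽¹⁾) (R⁻⁽²⁾ ▷ T c)`. -/
def antipodeLeft (s s' : ι → H) (T : D →ₗ[k] D) (jD : D →ₐ[k] V) (jH : H →ₐ[k] V) : D →ₗ[k] V :=
  ∑ i, LinearMap.mulLeft k (jH (HopfAlgebra.antipode k (s i))) ∘ₗ jD.toLinearMap ∘ₗ
    leftAct k H D (s' i) ∘ₗ T

/-- The antipode on `B`, `b ↦ (S b ◁ R⁽¹⁾) S(R⁽²⁾)`. -/
def antipodeRight (r r' : ι → H) (S : B →ₗ[k] B) (jH : H →ₐ[k] V) (jB : B →ₐ[k] V) : B →ₗ[k] V :=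
  ∑ i, LinearMap.mulRight k (jH (HopfAlgebra.antipode k (r' i))) ∘ₗ jB.toLinearMap ∘ₗ
    rightAct k H B (r i) ∘ₗ S

lemma antipodeLeft_apply (T : D →ₗ[k] D) (c : D) : antipodeLeft s s' T jD jH c =
    ∑ i, jH (HopfAlgebra.antipode k (s i)) * jD (s' i • T c) := by
  simp [antipodeLeft]

lemma antipodeRight_apply (S : B →ₗ[k] B) (b : B) : antipodeRight r r' S jH jB b =
    ∑ i, jB (op (r i) • S b) * jH (HopfAlgebra.antipode k (r' i)) := by
  simp [antipodeRight]

/-- The left antipode axiom on D, in the form in which it occurs inside Δ(dhb). The two copies of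
R⁻⁽²⁾ acting on S̄c₍₁₎ and c₍₂₎ merge by (id ⊗ Δ)R⁻¹ into one acting on their product, which is a
multiple of 1. -/
lemma sum_mul_antipodeLeft_mul (hR : IsQuasitriangular R)
    (hD : IsLeftBraidedGroup (R : H ⊗[k] H) SD.toLinearMap)
    (hs : ((R⁻¹ : (H ⊗[k] H)ˣ) : H ⊗[k] H) = ∑ i, s i ⊗ₜ[k] s' i) {c : D}
    (hc : copComul R D c = ∑ x, c₁ x ⊗ₜ[k] c₂ x) :
    ∑ x, ∑ i, jH (HopfAlgebra.antipode k (s i)) * (antipodeLeft s s' SD.symm.toLinearMap jD jH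
      (c₁ x) * jD (s' i • c₂ x)) = counit (R := k) c • 1 := by
  have e1 (x : ν) := congrArg (LinearMap.mul' k V ∘ₗ TensorProduct.map
    (jH.toLinearMap ∘ₗ HopfAlgebra.antipode k) (jD.toLinearMap ∘ₗ LinearMap.mul' k D ∘ₗ
      TensorProduct.map ((leftAct k H D).flip (SD.symm (c₁ x))) ((leftAct k H D).flip (c₂ x))))
    (hR.sum_expandRight_inv hs)
  have e2 := antipode_mul_copComul hR hD c
  have e3 := congrArg (fun h ↦ jH (HopfAlgebra.antipode k h)) (hR.sum_inv_counit_right hs)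
  rw [hc] at e2
  simp only [map_sum, TensorProduct.map_tmul, LinearMap.comp_apply, LinearMap.mul'_apply,
    AlgHom.toLinearMap_apply, ← hD.smul_mul_eq_map, LinearMap.flip_apply, leftAct_apply,
    LinearEquiv.coe_coe, LinearMap.id_apply, HopfAlgebra.antipode_mul_antidistrib, map_mul,
    map_smul, HopfAlgebra.antipode_one, map_one] at e1 e2 e3
  calc _ = ∑ x, ∑ i, jH (HopfAlgebra.antipode k (s i)) * jD (s' i • (SD.symm (c₁ x) * c₂ x)) := by
        refine Finset.sum_congr rfl fun x _ ↦ ?_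
        rw [e1, Finset.sum_comm]
        simp only [antipodeLeft_apply, Finset.sum_mul, Finset.mul_sum, mul_assoc,
          LinearEquiv.coe_coe]
    _ = ∑ i, jH (HopfAlgebra.antipode k (s i)) * jD (s' i • (counit (R := k) c • (1 : D))) := by
        rw [Finset.sum_comm, ← e2]
        simp only [Finset.smul_sum, map_sum, Finset.mul_sum]
    _ = _ := by
        have (h : H) : jD (h • (counit (R := k) c • (1 : D))) =
            counit (R := k) c • counit (R := k) h • (1 : V) := by
          rw [smul_comm, hD.act_one]
          simp [Algebra.algebraMap_eq_smul_one]
        simp only [this, mul_smul_comm, mul_one, ← Finset.smul_sum, e3]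

/-- The right antipode axiom on D. Here the two copies of R⁻¹ cancel outright, by
`sum_mul_antipode_inv`. -/
lemma sum_mul_mul_antipodeLeft (hR : IsQuasitriangular R)
    (hD : IsLeftBraidedGroup (R : H ⊗[k] H) SD.toLinearMap)
    (hs : ((R⁻¹ : (H ⊗[k] H)ˣ) : H ⊗[k] H) = ∑ i, s i ⊗ₜ[k] s' i) {c : D}
    (hc : copComul R D c = ∑ x, c₁ x ⊗ₜ[k] c₂ x) :
    ∑ x, ∑ i, jD (c₁ x) * (jH (s i) * antipodeLeft s s' SD.symm.toLinearMap jD jH (s' i • c₂ x)) =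
      counit (R := k) c • 1 := by
  have e1 (x : D) := congrArg (LinearMap.mul' k V ∘ₗ TensorProduct.map jH.toLinearMap
    (jD.toLinearMap ∘ₗ (leftAct k H D).flip (SD.symm x))) (hR.sum_mul_antipode_inv hs)
  have e2 := congrArg jD (mul_antipode_copComul hR hD c)
  rw [hc] at e2
  rw [Algebra.TensorProduct.one_def] at e1
  simp only [map_sum, TensorProduct.map_tmul, LinearMap.comp_apply, LinearMap.mul'_apply,
    AlgHom.toLinearMap_apply, LinearMap.flip_apply, leftAct_apply, LinearEquiv.coe_coe,
    LinearMap.id_apply, map_mul, map_smul, map_one, one_smul, one_mul, mul_smul] at e1 e2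
  rw [← e2]
  refine Finset.sum_congr rfl fun x _ ↦ ?_
  rw [← e1, Finset.mul_sum]
  simp only [antipodeLeft_apply, Finset.sum_mul, Finset.mul_sum, mul_assoc,
    LinearEquiv.coe_coe, hD.antipode_symm_act]
  exact Finset.sum_comm

lemma sum_mul_antipodeRight_mul (hR : IsQuasitriangular R)
    (hB : IsRightBraidedGroup (R : H ⊗[k] H) SB)
    (hr : (R : H ⊗[k] H) = ∑ i, r i ⊗ₜ[k] r' i) {b : B}
    (hb : comul (R := k) b = ∑ y, b₁ y ⊗ₜ[k] b₂ y) :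
    ∑ y, ∑ i, jB (op (r i) • b₁ y) * (antipodeRight r r' SB jH jB (b₂ y) *
      jH (HopfAlgebra.antipode k (r' i))) = counit (R := k) b • 1 := by
  have e1 (y : ν) := congrArg ((LinearMap.mul' k V ∘ₗ TensorProduct.map
    (jB.toLinearMap ∘ₗ LinearMap.mul' k B ∘ₗ
      TensorProduct.map ((rightAct k H B).flip (b₁ y)) ((rightAct k H B).flip (SB (b₂ y))))
    (jH.toLinearMap ∘ₗ HopfAlgebra.antipode k)) ∘ₗ (TensorProduct.assoc k H H H).symm.toLinearMap)
    (hR.sum_expandLeft hr)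
  have e2 := hB.antipode_right b
  have e3 := congrArg (fun h ↦ jH (HopfAlgebra.antipode k h)) (hR.sum_counit_left hr)
  rw [hb] at e2
  simp only [map_sum, TensorProduct.map_tmul, LinearMap.comp_apply, LinearMap.mul'_apply,
    AlgHom.toLinearMap_apply, ← hB.smul_mul_eq_map, LinearMap.flip_apply, rightAct_apply,
    LinearEquiv.coe_coe, LinearMap.id_apply, HopfAlgebra.antipode_mul_antidistrib, map_mul,
    map_smul, HopfAlgebra.antipode_one, map_one, LinearEquiv.symm_apply_apply,
    TensorProduct.assoc_symm_tmul, LinearMap.lTensor_tmul] at e1 e2 e3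
  calc _ = ∑ y, ∑ i, jB (op (r i) • (b₁ y * SB (b₂ y))) * jH (HopfAlgebra.antipode k (r' i)) := by
        refine Finset.sum_congr rfl fun y _ ↦ ?_
        rw [e1]
        simp only [antipodeRight_apply, Finset.sum_mul, Finset.mul_sum, mul_assoc]
    _ = ∑ i, jB (op (r i) • (algebraMap k B (counit (R := k) b))) *
          jH (HopfAlgebra.antipode k (r' i)) := by
        rw [Finset.sum_comm, ← e2]
        simp only [Finset.smul_sum, map_sum, Finset.sum_mul]
    _ = _ := by
        have (h : H) : jB (op h • (algebraMap k B (counit (R := k) b))) =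
            counit (R := k) b • counit (R := k) h • (1 : V) := by
          rw [Algebra.algebraMap_eq_smul_one, smul_comm, hB.act_one]
          simp [Algebra.algebraMap_eq_smul_one]
        simp only [this, smul_mul_assoc, one_mul, ← Finset.smul_sum, e3]

lemma sum_antipodeRight_mul_mul (hR : IsQuasitriangular R)
    (hB : IsRightBraidedGroup (R : H ⊗[k] H) SB)
    (hr : (R : H ⊗[k] H) = ∑ i, r i ⊗ₜ[k] r' i) {b : B}
    (hb : comul (R := k) b = ∑ y, b₁ y ⊗ₜ[k] b₂ y) :
    ∑ y, ∑ i, antipodeRight r r' SB jH jB (op (r i) • b₁ y) * (jH (r' i) * jB (b₂ y)) =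
      counit (R := k) b • 1 := by
  have e1 (y : B) := congrArg (LinearMap.mul' k V ∘ₗ TensorProduct.map
    (jB.toLinearMap ∘ₗ (rightAct k H B).flip (SB y)) jH.toLinearMap) (hR.sum_antipode_mul hr)
  have e2 := congrArg jB (hB.antipode_left b)
  rw [hb] at e2
  rw [Algebra.TensorProduct.one_def] at e1
  simp only [map_sum, TensorProduct.map_tmul, LinearMap.comp_apply, LinearMap.mul'_apply,
    AlgHom.toLinearMap_apply, LinearMap.flip_apply, rightAct_apply, LinearEquiv.coe_coe,
    LinearMap.id_apply, map_mul, map_smul, map_one, one_smul, mul_one, mul_smul, op_mul, op_one,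
    LinearMap.rTensor_tmul, Algebra.algebraMap_eq_smul_one] at e1 e2
  rw [← e2]
  refine Finset.sum_congr rfl fun y _ ↦ ?_
  rw [← e1, Finset.sum_mul]
  simp only [antipodeRight_apply, Finset.sum_mul, Finset.mul_sum, mul_assoc, hB.antipode_act]

end

namespace IsDoubleBialgebra

variable [Bialgebra k V] {jD : D →ₐ[k] V} {jH : H →ₐ[k] V} {jB : B →ₐ[k] V}
  (w : IsDoubleBialgebra R SD pair jD jH jB)

include w in
@[elab_as_elim]
lemma ind {P : V → Prop} (v : V) (h0 : P 0) (ha : ∀ x y, P x → P y → P (x + y))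
    (hP : ∀ d h b, P (jD d * (jH h * jB b))) : P v := by
  obtain ⟨z, rfl⟩ := w.bijective.2 v
  induction z with
  | zero => simpa using h0
  | add x y hx hy => rw [map_add]; exact ha _ _ hx hy
  | tmul d z =>
    induction z with
    | zero => simpa using h0
    | add x y hx hy => rw [TensorProduct.tmul_add, map_add]; exact ha _ _ hx hy
    | tmul h b => exact hP d h b

/-- The equivalence `d ⊗ h ⊗ b ↦ d h b`. -/
def equiv : D ⊗[k] (H ⊗[k] B) ≃ₗ[k] V := LinearEquiv.ofBijective _ w.bijective

@[simp] lemma equiv_tmul (d : D) (h : H) (b : B) :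
    w.equiv (d ⊗ₜ (h ⊗ₜ b)) = jD d * (jH h * jB b) := rfl

/-- The antipode determined by its restrictions to `D` and `B`. -/
def antipode (TD : D →ₗ[k] V) (TB : B →ₗ[k] V) : V →ₗ[k] V :=
  LinearMap.mul' k V ∘ₗ (TensorProduct.comm k V V).toLinearMap ∘ₗ TensorProduct.map TD
    (LinearMap.mul' k V ∘ₗ (TensorProduct.comm k V V).toLinearMap ∘ₗ
      TensorProduct.map (jH.toLinearMap ∘ₗ HopfAlgebra.antipode k) TB) ∘ₗ w.equiv.symm.toLinearMap

lemma antipode_apply (TD : D →ₗ[k] V) (TB : B →ₗ[k] V) (d : D) (h : H) (b : B) :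
    w.antipode TD TB (jD d * (jH h * jB b)) =
      TB b * (jH (HopfAlgebra.antipode k h) * TD d) := by
  rw [← w.equiv_tmul, antipode]
  simp only [LinearMap.comp_apply, LinearEquiv.coe_coe, LinearEquiv.symm_apply_apply,
    TensorProduct.map_tmul, TensorProduct.comm_tmul, LinearMap.mul'_apply, mul_assoc,
    AlgHom.toLinearMap_apply]

section

variable (hR : IsQuasitriangular R) (hD : IsLeftBraidedGroup (R : H ⊗[k] H) SD.toLinearMap)
  (hB : IsRightBraidedGroup (R : H ⊗[k] H) SB)
  {l m : ℕ} {r r' : Fin l → H} {s s' : Fin m → H}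

include w in
lemma comul_eq_sum (hr : (R : H ⊗[k] H) = ∑ i, r i ⊗ₜ[k] r' i)
    (hs : ((R⁻¹ : (H ⊗[k] H)ˣ) : H ⊗[k] H) = ∑ i, s i ⊗ₜ[k] s' i) {d : D} {h : H} {b : B}
    {n p q : ℕ} {c₁ c₂ : Fin n → D} {h₁ h₂ : Fin p → H} {b₁ b₂ : Fin q → B}
    (hc : copComul R D d = ∑ x, c₁ x ⊗ₜ[k] c₂ x) (hh : comul (R := k) h = ∑ a, h₁ a ⊗ₜ[k] h₂ a)
    (hb : comul (R := k) b = ∑ y, b₁ y ⊗ₜ[k] b₂ y) :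
    comul (R := k) (jD d * (jH h * jB b)) = ∑ x, ∑ i, ∑ a, ∑ y, ∑ j,
      (jD (c₁ x) * (jH (s i * h₁ a) * jB (op (r j) • b₁ y))) ⊗ₜ[k]
        (jD (s' i • c₂ x) * (jH (h₂ a * r' j) * jB (b₂ y))) := by
  rw [Bialgebra.comul_mul, Bialgebra.comul_mul, w.comul_left d hs hc, w.comul_right b hr hb,
    w.comul_mid, hh]
  simp only [map_sum, TensorProduct.map_tmul, Finset.sum_mul]
  simp only [Finset.mul_sum, Algebra.TensorProduct.tmul_mul_tmul, map_mul, mul_assoc,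
    AlgHom.toLinearMap_apply]

include hR hD hB

/-- The antipode reverses the first leg of Δ(dhb), so its D-part stands next to the D-part of the
second leg. These collapse to ε(d), after which the H-parts and then the B-parts become adjacent. No
element of B ever has to pass one of D. -/
lemma mul_antipode_rTensor_comul (hr : (R : H ⊗[k] H) = ∑ i, r i ⊗ₜ[k] r' i)
    (hs : ((R⁻¹ : (H ⊗[k] H)ˣ) : H ⊗[k] H) = ∑ i, s i ⊗ₜ[k] s' i) (v : V) :
    LinearMap.mul' k V ((w.antipode (antipodeLeft s s' SD.symm.toLinearMap jD jH)
      (antipodeRight r r' SB jH jB)).rTensor V (comul (R := k) v)) =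
      counit (R := k) v • 1 := by
  induction v using w.ind with
  | h0 => simp
  | ha x y hx hy => simp only [map_add, hx, hy, add_smul]
  | hP d h b =>
    obtain ⟨n, c₁, c₂, hc⟩ := TensorProduct.exists_sum_tmul_eq (copComul R D d)
    obtain ⟨p, h₁, h₂, hh⟩ := TensorProduct.exists_sum_tmul_eq (comul (R := k) h)
    obtain ⟨q, b₁, b₂, hb⟩ := TensorProduct.exists_sum_tmul_eq (comul (R := k) b)
    have e1 := sum_mul_antipodeLeft_mul (jD := jD) (jH := jH) hR hD hs hc
    have e2 := congrArg jH (HopfAlgebra.mul_antipode_rTensor_comul_apply (R := k) h)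
    have e3 := sum_antipodeRight_mul_mul (jH := jH) (jB := jB) hR hB hr hb
    rw [hh] at e2
    simp only [map_sum, LinearMap.rTensor_tmul, LinearMap.mul'_apply, map_mul,
      Algebra.algebraMap_eq_smul_one, map_smul, map_one] at e2
    rw [w.comul_eq_sum hr hs hc hh hb]
    simp only [map_sum, LinearMap.rTensor_tmul, LinearMap.mul'_apply, w.antipode_apply]
    rw [Bialgebra.counit_mul, Bialgebra.counit_mul, w.counit_left, w.counit_mid, w.counit_right]
    -- On this side D collapses first, so its sums must be innermost, then those of H, then those of
    -- B.
    simp only [Finset.sum_comm (t := (Finset.univ : Finset (Fin p)))]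
    simp only [Finset.sum_comm (t := (Finset.univ : Finset (Fin l)))]
    simp only [Finset.sum_comm (t := (Finset.univ : Finset (Fin q)))]
    have f1 (P Q : V) (a : Fin p) : ∑ x, ∑ i, P * (jH (HopfAlgebra.antipode k (s i * h₁ a)) *
        antipodeLeft s s' SD.symm.toLinearMap jD jH (c₁ x)) * (jD (s' i • c₂ x) * Q) =
        counit (R := k) d • (P * (jH (HopfAlgebra.antipode k (h₁ a)) * Q)) := by
      have := congrArg (fun z ↦ P * (jH (HopfAlgebra.antipode k (h₁ a)) * (z * Q))) e1
      simp only [Finset.sum_mul, Finset.mul_sum, smul_mul_assoc, mul_smul_comm, one_mul] at this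
      rw [← this]
      simp only [HopfAlgebra.antipode_mul_antidistrib, map_mul, mul_assoc]
    have f2 (P Q : V) : ∑ a, P * (jH (HopfAlgebra.antipode k (h₁ a)) * (jH (h₂ a) * Q)) =
        counit (R := k) h • (P * Q) := by
      have := congrArg (fun z ↦ P * (z * Q)) e2
      simp only [Finset.sum_mul, Finset.mul_sum, smul_mul_assoc, mul_smul_comm, one_mul] at this
      rw [← this]
      simp only [mul_assoc]
    simp only [f1]
    simp only [map_mul, mul_assoc, ← Finset.smul_sum, f2, e3]
    rw [← mul_smul, ← mul_smul, mul_assoc]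

/-- Here the second leg is reversed and the collapse runs in the opposite order: B, then H, then D.
-/
lemma mul_antipode_lTensor_comul (hr : (R : H ⊗[k] H) = ∑ i, r i ⊗ₜ[k] r' i)
    (hs : ((R⁻¹ : (H ⊗[k] H)ˣ) : H ⊗[k] H) = ∑ i, s i ⊗ₜ[k] s' i) (v : V) :
    LinearMap.mul' k V ((w.antipode (antipodeLeft s s' SD.symm.toLinearMap jD jH)
      (antipodeRight r r' SB jH jB)).lTensor V (comul (R := k) v)) =
      counit (R := k) v • 1 := by
  induction v using w.ind with
  | h0 => simp
  | ha x y hx hy => simp only [map_add, hx, hy, add_smul]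
  | hP d h b =>
    obtain ⟨n, c₁, c₂, hc⟩ := TensorProduct.exists_sum_tmul_eq (copComul R D d)
    obtain ⟨p, h₁, h₂, hh⟩ := TensorProduct.exists_sum_tmul_eq (comul (R := k) h)
    obtain ⟨q, b₁, b₂, hb⟩ := TensorProduct.exists_sum_tmul_eq (comul (R := k) b)
    have e1 := sum_mul_mul_antipodeLeft (jD := jD) (jH := jH) hR hD hs hc
    have e2 := congrArg jH (HopfAlgebra.mul_antipode_lTensor_comul_apply (R := k) h)
    have e3 := sum_mul_antipodeRight_mul (jH := jH) (jB := jB) hR hB hr hb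
    rw [hh] at e2
    simp only [map_sum, LinearMap.lTensor_tmul, LinearMap.mul'_apply, map_mul,
      Algebra.algebraMap_eq_smul_one, map_smul, map_one] at e2
    rw [w.comul_eq_sum hr hs hc hh hb]
    simp only [map_sum, LinearMap.lTensor_tmul, LinearMap.mul'_apply, w.antipode_apply]
    rw [Bialgebra.counit_mul, Bialgebra.counit_mul, w.counit_left, w.counit_mid, w.counit_right]
    have f1 (P P' Q : V) (a : Fin p) : ∑ y, ∑ j, P * (P' * jB (op (r j) • b₁ y)) *
        (antipodeRight r r' SB jH jB (b₂ y) * (jH (HopfAlgebra.antipode k (h₂ a * r' j)) * Q)) =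
        counit (R := k) b • (P * (P' * (jH (HopfAlgebra.antipode k (h₂ a)) * Q))) := by
      have := congrArg (fun z ↦ P * (P' * (z * (jH (HopfAlgebra.antipode k (h₂ a)) * Q)))) e3
      simp only [Finset.sum_mul, Finset.mul_sum, smul_mul_assoc, mul_smul_comm, one_mul] at this
      rw [← this]
      simp only [HopfAlgebra.antipode_mul_antidistrib, map_mul, mul_assoc]
    have f2 (P Q : V) : ∑ a, P * (jH (h₁ a) * (jH (HopfAlgebra.antipode k (h₂ a)) * Q)) =
        counit (R := k) h • (P * Q) := by
      have := congrArg (fun z ↦ P * (z * Q)) e2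
      simp only [Finset.sum_mul, Finset.mul_sum, smul_mul_assoc, mul_smul_comm, one_mul] at this
      rw [← this]
      simp only [mul_assoc]
    have f3 (x : Fin n) (i : Fin m) := f2 (jD (c₁ x) * jH (s i))
    simp only [mul_assoc] at f3
    simp only [f1]
    simp only [map_mul, mul_assoc, ← Finset.smul_sum, f3, e1]
    rw [← mul_smul, ← mul_smul]
    congr 1
    ring

end

end IsDoubleBialgebra

end Antipode

/-! ### Transport of Hopf structures along a linear isomorphism. -/

section Transport

open Coalgebra

variable {k A V : Type*} [Field k] [AddCommGroup A] [Module k A] [Ring V] [Bialgebra k V]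

/-- Structure maps of a bialgebra with antipode, transported along a linear equivalence. -/
def transportHopf (e : A ≃ₗ[k] V) (S : V →ₗ[k] V) : HopfData k A where
  mul := e.symm.toLinearMap ∘ₗ LinearMap.mul' k V ∘ₗ TensorProduct.map e.toLinearMap e.toLinearMap
  one := e.symm 1
  comul := TensorProduct.map e.symm.toLinearMap e.symm.toLinearMap ∘ₗ comul ∘ₗ e.toLinearMap
  counit := counit ∘ₗ e.toLinearMap
  antipode := e.symm.toLinearMap ∘ₗ S ∘ₗ e.toLinearMap

variable (e : A ≃ₗ[k] V) (S : V →ₗ[k] V)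

lemma transportHopf_mul (a b : A) : (transportHopf e S).mul (a ⊗ₜ b) = e.symm (e a * e b) := rfl

lemma transportHopf_comul {ι : Type*} {a : A} (𝓡 : Repr k (e a) ι) : (transportHopf e S).comul a =
    ∑ i ∈ 𝓡.index, e.symm (𝓡.left i) ⊗ₜ[k] e.symm (𝓡.right i) := by
  change TensorProduct.map _ _ (comul (R := k) (e a)) = _
  rw [← 𝓡.eq]
  simp

lemma transportHopf_isHopfAlgebra
    (hl : ∀ v, LinearMap.mul' k V (S.rTensor V (comul (R := k) v)) = counit (R := k) v • 1)
    (hr : ∀ v, LinearMap.mul' k V (S.lTensor V (comul (R := k) v)) = counit (R := k) v • 1) :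
    (transportHopf e S).IsHopfAlgebra where
  mul_assoc a b c := by simp [transportHopf_mul, mul_assoc]
  one_mul a := by simp [transportHopf_mul, transportHopf]
  mul_one a := by simp [transportHopf_mul, transportHopf]
  coassoc a := by
    have := congrArg (TensorProduct.map e.symm.toLinearMap
      (TensorProduct.map e.symm.toLinearMap e.symm.toLinearMap)) (sum_tmul_tmul_eq (ℛ k (e a))
        (fun i ↦ ℛ k ((ℛ k (e a)).left i)) (fun i ↦ ℛ k ((ℛ k (e a)).right i)))
    have h (v : V) : (transportHopf e S).comul (e.symm v) =
        ∑ i ∈ (ℛ k v).index, e.symm ((ℛ k v).left i) ⊗ₜ[k] e.symm ((ℛ k v).right i) := by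
      change TensorProduct.map _ _ (comul (R := k) (e (e.symm v))) = _
      rw [LinearEquiv.apply_symm_apply]
      nth_rw 1 [← (ℛ k v).eq]
      simp
    rw [transportHopf_comul e S (ℛ k (e a))]
    simpa [h, TensorProduct.sum_tmul, TensorProduct.tmul_sum] using this
  counit_comul a := by
    have := congrArg e.symm (sum_counit_smul_map (ℛ k (e a)) LinearMap.id)
    rw [transportHopf_comul e S (ℛ k (e a))]
    simpa [transportHopf] using this
  comul_counit a := by
    have := congrArg e.symm (sum_counit_right_smul_map (ℛ k (e a)) LinearMap.id)
    rw [transportHopf_comul e S (ℛ k (e a))]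
    simpa [transportHopf] using this
  comul_mul a b := by
    rw [transportHopf_comul e S (ℛ k (e a)), transportHopf_comul e S (ℛ k (e b))]
    change TensorProduct.map _ _ (comul (R := k) (e (e.symm (e a * e b)))) = _
    rw [LinearEquiv.apply_symm_apply, Bialgebra.comul_mul]
    nth_rw 1 [← (ℛ k (e a)).eq, ← (ℛ k (e b)).eq]
    simp [Finset.sum_mul_sum, HopfData.mulTensor, TensorProduct.sum_tmul, TensorProduct.tmul_sum,
      transportHopf_mul]
    exact Finset.sum_comm
  comul_one := by
    simp [transportHopf, Algebra.TensorProduct.one_def]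
  counit_mul a b := by simp [transportHopf]
  counit_one := by simp [transportHopf]
  antipode_left a := by
    have := congrArg e.symm (hl (e a))
    rw [← (ℛ k (e a)).eq] at this
    rw [transportHopf_comul e S (ℛ k (e a))]
    simpa [transportHopf] using this
  antipode_right a := by
    have := congrArg e.symm (hr (e a))
    rw [← (ℛ k (e a)).eq] at this
    rw [transportHopf_comul e S (ℛ k (e a))]
    simpa [transportHopf] using this

lemma isSubHopfAlgebra_transport {A' : Type*} [AddCommGroup A'] [Module k A'] (X : HopfData k A')
    (f : A' →ₗ[k] A) (inj : Function.Injective f)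
    (hm : ∀ a b, e (f (X.mul (a ⊗ₜ b))) = e (f a) * e (f b)) (h1 : e (f X.one) = 1)
    (hc : ∀ a, comul (R := k) (e (f a)) =
      TensorProduct.map (e.toLinearMap ∘ₗ f) (e.toLinearMap ∘ₗ f) (X.comul a))
    (hε : ∀ a, counit (R := k) (e (f a)) = X.counit a)
    (hS : ∀ a, S (e (f a)) = e (f (X.antipode a))) :
    X.IsSubHopfAlgebra (transportHopf e S) f where
  injective := inj
  map_mul a b := by rw [transportHopf_mul, ← hm, LinearEquiv.symm_apply_apply]
  map_one := by rw [← e.symm_apply_apply (f X.one), h1]; rfl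
  map_comul a := by
    change TensorProduct.map _ _ (comul (R := k) (e (f a))) = _
    rw [hc, ← LinearMap.comp_apply, ← TensorProduct.map_comp]
    congr 2 <;> ext <;> simp
  map_counit a := hε a
  map_antipode a := by
    change _ = e.symm (S (e (f a)))
    rw [hS, LinearEquiv.symm_apply_apply]

end Transport

/-! ### The structure maps of the bosonisations as finite sums. -/

section BosonisationFormulas

open Coalgebra MulOpposite

variable {k H B D : Type*} [Field k] [Ring H] [HopfAlgebra k H]
  [Ring B] [Algebra k B] [Coalgebra k B] [Module Hᵐᵒᵖ B] [IsScalarTower k Hᵐᵒᵖ B]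
  [Ring D] [Algebra k D] [Module H D] [IsScalarTower k H D]
  {R : (H ⊗[k] H)ˣ} {SB : B →ₗ[k] B} {Δ : D →ₗ[k] D ⊗[k] D} {ε : D →ₗ[k] k} {T : D →ₗ[k] D}
  {l m n p q : ℕ} {r r' : Fin l → H} {s s' : Fin m → H} {h₁ h₂ : Fin p → H}

lemma leftBosonisation_mul {h : H} (hh : comul (R := k) h = ∑ a, h₁ a ⊗ₜ[k] h₂ a) (c d : D)
    (g : H) : (leftBosonisation (conjR R) Δ ε T).mul ((c ⊗ₜ h) ⊗ₜ (d ⊗ₜ g)) =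
      ∑ a, (c * (h₁ a • d)) ⊗ₜ[k] (h₂ a * g) := by
  simp [leftBosonisation, leftCross, hh, TensorProduct.sum_tmul, TensorProduct.tmul_sum]

lemma leftBosonisation_comul (hs : ((R⁻¹ : (H ⊗[k] H)ˣ) : H ⊗[k] H) = ∑ i, s i ⊗ₜ[k] s' i)
    {c : D} {h : H} (hh : comul (R := k) h = ∑ a, h₁ a ⊗ₜ[k] h₂ a)
    {c₁ c₂ : Fin n → D} (hc : Δ c = ∑ x, c₁ x ⊗ₜ[k] c₂ x) :
    (leftBosonisation (conjR R) Δ ε T).comul (c ⊗ₜ h) = ∑ x, ∑ i, ∑ a,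
      (c₁ x ⊗ₜ[k] (s i * h₁ a)) ⊗ₜ[k] ((s' i • c₂ x) ⊗ₜ[k] h₂ a) := by
  simp [leftBosonisation, conjR, hs, hh, hc, TensorProduct.sum_tmul, TensorProduct.tmul_sum,
    leftMul]
  rw [Finset.sum_comm]
  exact Finset.sum_congr rfl fun x _ ↦ Finset.sum_comm

/-- The index j belongs to the copy of R⁻¹ inside ū. Written out in this way the expression matches
`mid_mul_antipodeLeft` term by term. -/
lemma leftBosonisation_antipode (hs : ((R⁻¹ : (H ⊗[k] H)ˣ) : H ⊗[k] H) = ∑ i, s i ⊗ₜ[k] s' i)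
    {h : H} (hh : comul (R := k) h = ∑ a, h₁ a ⊗ₜ[k] h₂ a) (c : D) :
    (leftBosonisation (conjR R) Δ ε T).antipode (c ⊗ₜ h) = ∑ a, ∑ i, ∑ j,
      (HopfAlgebra.antipode k (h₂ a) • HopfAlgebra.antipode k (s j) • s' j • s' i • T c) ⊗ₜ[k]
        HopfAlgebra.antipode k (s i * h₁ a) := by
  simp [leftBosonisation, leftAntipodeAux, elemU, conjR, hs, hh, TensorProduct.sum_tmul,
    TensorProduct.tmul_sum, leftMul, Finset.sum_smul, Finset.smul_sum, mul_smul]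

lemma rightBosonisation_mul {g : H} (hg : comul (R := k) g = ∑ a, h₁ a ⊗ₜ[k] h₂ a) (h : H)
    (b c : B) : (rightBosonisation (R : H ⊗[k] H) SB).mul ((h ⊗ₜ b) ⊗ₜ (g ⊗ₜ c)) =
      ∑ a, (h * h₁ a) ⊗ₜ[k] ((op (h₂ a) • b) * c) := by
  simp [rightBosonisation, rightCross, hg, TensorProduct.sum_tmul, TensorProduct.tmul_sum]

lemma rightBosonisation_comul (hr : (R : H ⊗[k] H) = ∑ i, r i ⊗ₜ[k] r' i)
    {b : B} {h : H} (hh : comul (R := k) h = ∑ a, h₁ a ⊗ₜ[k] h₂ a)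
    {b₁ b₂ : Fin n → B} (hb : comul (R := k) b = ∑ y, b₁ y ⊗ₜ[k] b₂ y) :
    (rightBosonisation (R : H ⊗[k] H) SB).comul (h ⊗ₜ b) = ∑ a, ∑ y, ∑ i,
      (h₁ a ⊗ₜ[k] (op (r i) • b₁ y)) ⊗ₜ[k] ((h₂ a * r' i) ⊗ₜ[k] b₂ y) := by
  simp [rightBosonisation, hr, hh, hb, TensorProduct.sum_tmul, TensorProduct.tmul_sum,
    rightMul]
  exact Finset.sum_comm

lemma rightBosonisation_antipode (hr : (R : H ⊗[k] H) = ∑ i, r i ⊗ₜ[k] r' i)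
    {h : H} (hh : comul (R := k) h = ∑ a, h₁ a ⊗ₜ[k] h₂ a) (b : B) :
    (rightBosonisation (R : H ⊗[k] H) SB).antipode (h ⊗ₜ b) = ∑ a, ∑ i, ∑ j,
      HopfAlgebra.antipode k (h₂ a * r' i) ⊗ₜ[k]
        (op (HopfAlgebra.antipode k (h₁ a)) • op (HopfAlgebra.antipode k (r' j)) • op (r j) •
          op (r i) • SB b) := by
  simp [rightBosonisation, rightAntipodeAux, elemV, hr, hh, TensorProduct.sum_tmul,
    TensorProduct.tmul_sum, rightMul, Finset.sum_smul, Finset.smul_sum, mul_smul]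

end BosonisationFormulas

/-! ### The antipode agrees with those of the bosonisations. -/

namespace IsDoubleBialgebra

open Coalgebra MulOpposite

variable {k H B D V : Type*} [Field k] [Ring H] [HopfAlgebra k H]
  [Ring B] [Algebra k B] [Coalgebra k B] [Module Hᵐᵒᵖ B] [IsScalarTower k Hᵐᵒᵖ B]
  [Ring D] [Algebra k D] [Coalgebra k D] [Module H D] [IsScalarTower k H D]
  {R : (H ⊗[k] H)ˣ} {SB : B →ₗ[k] B} {SD : D ≃ₗ[k] D} {pair : D →ₗ[k] B →ₗ[k] k}
  [Ring V] [Bialgebra k V] {jD : D →ₐ[k] V} {jH : H →ₐ[k] V} {jB : B →ₐ[k] V}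
  (w : IsDoubleBialgebra R SD pair jD jH jB)

variable (hR : IsQuasitriangular R) (hD : IsLeftBraidedGroup (R : H ⊗[k] H) SD.toLinearMap)
  (hB : IsRightBraidedGroup (R : H ⊗[k] H) SB)
  {l m : ℕ} {r r' : Fin l → H} {s s' : Fin m → H}
  {n p q : ℕ} {h₁ h₂ : Fin p → H}

include w in
lemma mid_mul_left {h : H} (hh : comul (R := k) h = ∑ a, h₁ a ⊗ₜ[k] h₂ a) (d : D) :
    jH h * jD d = ∑ a, jD (h₁ a • d) * jH (h₂ a) := by
  rw [w.hd, hh]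
  simp

include w in
lemma right_mul_mid {h : H} (hh : comul (R := k) h = ∑ a, h₁ a ⊗ₜ[k] h₂ a) (b : B) :
    jB b * jH h = ∑ a, jH (h₁ a) * jB (op (h₂ a) • b) := by
  rw [w.bh, hh]
  simp

-- The product S(h)S(R⁻⁽¹⁾) = S(R⁻⁽¹⁾h) is moved to the right of D. Since S reverses coproducts and
-- Δ(R⁻⁽¹⁾) splits by (Δ ⊗ id)R⁻¹, a second copy of R⁻¹ appears, and it acts on D precisely as the
-- element ū.
include w in
lemma mid_mul_antipodeLeft (hR : IsQuasitriangular R)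
    (hs : ((R⁻¹ : (H ⊗[k] H)ˣ) : H ⊗[k] H) = ∑ i, s i ⊗ₜ[k] s' i)
    {h : H} (hh : comul (R := k) h = ∑ a, h₁ a ⊗ₜ[k] h₂ a) (T : D →ₗ[k] D) (c : D) :
    jH (HopfAlgebra.antipode k h) * antipodeLeft s s' T jD jH c = ∑ a, ∑ i, ∑ j,
      jD (HopfAlgebra.antipode k (h₂ a) • HopfAlgebra.antipode k (s j) • s' j • s' i • T c) *
        jH (HopfAlgebra.antipode k (s i * h₁ a)) := by
  have e1 (i) : jH (HopfAlgebra.antipode k (s i * h)) * jD (s' i • T c) =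
      ∑ a, (LinearMap.mul' k V ∘ₗ (TensorProduct.comm k V V).toLinearMap ∘ₗ
        TensorProduct.map (jH.toLinearMap ∘ₗ HopfAlgebra.antipode k ∘ₗ LinearMap.mulRight k (h₁ a))
        (jD.toLinearMap ∘ₗ (leftAct k H D).flip (s' i • T c) ∘ₗ HopfAlgebra.antipode k ∘ₗ
          LinearMap.mulRight k (h₂ a))) (comul (R := k) (s i)) := by
    rw [w.hd, comul_antipode, Bialgebra.comul_mul, hh, Finset.mul_sum]
    simp only [map_sum]
    refine Finset.sum_congr rfl fun a _ ↦ ?_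
    induction comul (R := k) (s i) with
    | zero => simp
    | add x y hx hy => simp only [add_mul, map_add, hx, hy]
    | tmul x y => simp
  have e2 (a) := congrArg (LinearMap.mul' k V ∘ₗ (TensorProduct.comm k V V).toLinearMap ∘ₗ
        TensorProduct.map (jH.toLinearMap ∘ₗ HopfAlgebra.antipode k ∘ₗ LinearMap.mulRight k (h₁ a))
        (jD.toLinearMap ∘ₗ TensorProduct.lift (leftAct k H D) ∘ₗ TensorProduct.map
          (HopfAlgebra.antipode k ∘ₗ LinearMap.mulRight k (h₂ a))
          ((leftAct k H D).flip (T c)))) (hR.sum_expandLeft_inv hs)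
  have e3 (a) (z : H ⊗[k] H) (x : H) : (LinearMap.mul' k V ∘ₗ
      (TensorProduct.comm k V V).toLinearMap ∘ₗ
        TensorProduct.map (jH.toLinearMap ∘ₗ HopfAlgebra.antipode k ∘ₗ LinearMap.mulRight k (h₁ a))
        (jD.toLinearMap ∘ₗ TensorProduct.lift (leftAct k H D) ∘ₗ TensorProduct.map
          (HopfAlgebra.antipode k ∘ₗ LinearMap.mulRight k (h₂ a))
          ((leftAct k H D).flip (T c)))) (TensorProduct.assoc k H H H (z ⊗ₜ x)) =
      (LinearMap.mul' k V ∘ₗ (TensorProduct.comm k V V).toLinearMap ∘ₗ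
        TensorProduct.map (jH.toLinearMap ∘ₗ HopfAlgebra.antipode k ∘ₗ LinearMap.mulRight k (h₁ a))
        (jD.toLinearMap ∘ₗ (leftAct k H D).flip (x • T c) ∘ₗ HopfAlgebra.antipode k ∘ₗ
          LinearMap.mulRight k (h₂ a))) z := by
    induction z with
    | zero => simp
    | add x y hx hy => simp only [TensorProduct.add_tmul, map_add, hx, hy]
    | tmul x y => simp
  replace e2 (a) := (map_sum _ _ _).symm.trans (e2 a)
  simp only [e3] at e2
  have e4 (i) : jH (HopfAlgebra.antipode k h) * (jH (HopfAlgebra.antipode k (s i)) *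
      jD (s' i • T c)) = jH (HopfAlgebra.antipode k (s i * h)) * jD (s' i • T c) := by
    rw [HopfAlgebra.antipode_mul_antidistrib, map_mul, mul_assoc]
  rw [antipodeLeft_apply, Finset.mul_sum]
  simp only [e4, e1]
  rw [Finset.sum_comm]
  simp only [e2]
  refine Finset.sum_congr rfl fun a _ ↦ ?_
  rw [Finset.sum_comm]
  simp [HopfAlgebra.antipode_mul_antidistrib, mul_smul]

-- The mirror image on B: moving S(hR⁽²⁾) to the left of B splits Δ(R⁽²⁾) by (id ⊗ Δ)R, and the
-- second copy of R forms the element v.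
include w in
lemma antipodeRight_mul_mid (hR : IsQuasitriangular R)
    (hr : (R : H ⊗[k] H) = ∑ i, r i ⊗ₜ[k] r' i)
    {h : H} (hh : comul (R := k) h = ∑ a, h₁ a ⊗ₜ[k] h₂ a) (b : B) :
    antipodeRight r r' SB jH jB b * jH (HopfAlgebra.antipode k h) = ∑ a, ∑ i, ∑ j,
      jH (HopfAlgebra.antipode k (h₂ a * r' i)) *
        jB (op (HopfAlgebra.antipode k (h₁ a)) • op (HopfAlgebra.antipode k (r' j)) • op (r j) •
          op (r i) • SB b) := by
  have e1 (i) : jB (op (r i) • SB b) * jH (HopfAlgebra.antipode k (h * r' i)) =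
      ∑ a, (LinearMap.mul' k V ∘ₗ (TensorProduct.comm k V V).toLinearMap ∘ₗ
        TensorProduct.map (jB.toLinearMap ∘ₗ (rightAct k H B).flip (op (r i) • SB b) ∘ₗ
          HopfAlgebra.antipode k ∘ₗ LinearMap.mulLeft k (h₁ a))
        (jH.toLinearMap ∘ₗ HopfAlgebra.antipode k ∘ₗ LinearMap.mulLeft k (h₂ a)))
        (comul (R := k) (r' i)) := by
    rw [w.bh, comul_antipode, Bialgebra.comul_mul, hh, Finset.sum_mul]
    simp only [map_sum]
    refine Finset.sum_congr rfl fun a _ ↦ ?_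
    induction comul (R := k) (r' i) with
    | zero => simp
    | add x y hx hy => simp only [mul_add, map_add, hx, hy]
    | tmul x y => simp
  have e2 (a) := congrArg ((LinearMap.mul' k V ∘ₗ (TensorProduct.comm k V V).toLinearMap ∘ₗ
        TensorProduct.map (jB.toLinearMap ∘ₗ TensorProduct.lift (rightAct k H B) ∘ₗ
          (TensorProduct.comm k B H).toLinearMap ∘ₗ
          TensorProduct.map ((rightAct k H B).flip (SB b))
          (HopfAlgebra.antipode k ∘ₗ LinearMap.mulLeft k (h₁ a)))
        (jH.toLinearMap ∘ₗ HopfAlgebra.antipode k ∘ₗ LinearMap.mulLeft k (h₂ a))) ∘ₗ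
        (TensorProduct.assoc k H H H).symm.toLinearMap) (hR.sum_expandRight hr)
  have e3 (a) (z : H ⊗[k] H) (x : H) : ((LinearMap.mul' k V ∘ₗ
      (TensorProduct.comm k V V).toLinearMap ∘ₗ
        TensorProduct.map (jB.toLinearMap ∘ₗ TensorProduct.lift (rightAct k H B) ∘ₗ
          (TensorProduct.comm k B H).toLinearMap ∘ₗ
          TensorProduct.map ((rightAct k H B).flip (SB b))
          (HopfAlgebra.antipode k ∘ₗ LinearMap.mulLeft k (h₁ a)))
        (jH.toLinearMap ∘ₗ HopfAlgebra.antipode k ∘ₗ LinearMap.mulLeft k (h₂ a))) ∘ₗ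
        (TensorProduct.assoc k H H H).symm.toLinearMap) (x ⊗ₜ z) =
      (LinearMap.mul' k V ∘ₗ (TensorProduct.comm k V V).toLinearMap ∘ₗ
        TensorProduct.map (jB.toLinearMap ∘ₗ (rightAct k H B).flip (op x • SB b) ∘ₗ
          HopfAlgebra.antipode k ∘ₗ LinearMap.mulLeft k (h₁ a))
        (jH.toLinearMap ∘ₗ HopfAlgebra.antipode k ∘ₗ LinearMap.mulLeft k (h₂ a))) z := by
    induction z with
    | zero => simp
    | add x y hx hy => simp only [TensorProduct.tmul_add, map_add, hx, hy]
    | tmul x y => simp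
  replace e2 (a) := (map_sum _ _ _).symm.trans (e2 a)
  simp only [e3] at e2
  have e4 (i) : jB (op (r i) • SB b) * jH (HopfAlgebra.antipode k (r' i)) *
      jH (HopfAlgebra.antipode k h) = jB (op (r i) • SB b) *
        jH (HopfAlgebra.antipode k (h * r' i)) := by
    rw [HopfAlgebra.antipode_mul_antidistrib, map_mul, mul_assoc]
  rw [antipodeRight_apply, Finset.sum_mul]
  simp only [e4, e1]
  rw [Finset.sum_comm]
  simp only [e2]
  refine Finset.sum_congr rfl fun a _ ↦ ?_
  simp [HopfAlgebra.antipode_mul_antidistrib, mul_smul]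

end IsDoubleBialgebra

/-! ### Existence of the double-bosonisation. -/

section Existence

open Coalgebra MulOpposite

variable {k H B D V : Type*} [Field k] [Ring H] [HopfAlgebra k H]
  [Ring B] [Algebra k B] [Coalgebra k B] [Module Hᵐᵒᵖ B] [IsScalarTower k Hᵐᵒᵖ B]
  [Ring D] [Algebra k D] [Coalgebra k D] [Module H D] [IsScalarTower k H D]
  {R : (H ⊗[k] H)ˣ} {SB : B →ₗ[k] B} {SD : D ≃ₗ[k] D} {pair : D →ₗ[k] B →ₗ[k] k}

lemma inclCH_injective (hB : IsRightBraidedGroup (R : H ⊗[k] H) SB) :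
    Function.Injective (inclCH k D H B) := by
  refine Function.LeftInverse.injective (g := ((TensorProduct.rid k H).toLinearMap ∘ₗ
    (counit (R := k) (A := B)).lTensor H).lTensor D) fun z ↦ ?_
  induction z with
  | zero => simp
  | add x y hx hy => simp only [map_add, hx, hy]
  | tmul c h => simp [inclCH, hB.counit_one]

lemma inclHB_injective (hD : IsLeftBraidedGroup (R : H ⊗[k] H) SD.toLinearMap) :
    Function.Injective (inclHB k D H B) := by
  refine Function.LeftInverse.injective (g := (TensorProduct.lid k (H ⊗[k] B)).toLinearMap ∘ₗ
    (counit (R := k) (A := D)).rTensor (H ⊗[k] B)) fun z ↦ ?_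
  simp [inclHB, hD.counit_one]

lemma IsRightBraidedGroup.antipode_one (hB : IsRightBraidedGroup (R : H ⊗[k] H) SB) :
    SB 1 = 1 := by
  have := hB.antipode_left 1
  simpa [hB.comul_one, hB.counit_one] using this

variable [Ring V]

section

variable [Algebra k V] {jD : D →ₐ[k] V} {jH : H →ₐ[k] V} {jB : B →ₐ[k] V} {l : ℕ}
  {r r' s s' : Fin l → H}

lemma antipodeRight_one (hR : IsQuasitriangular R) (hB : IsRightBraidedGroup (R : H ⊗[k] H) SB)
    (hr : (R : H ⊗[k] H) = ∑ i, r i ⊗ₜ[k] r' i) : antipodeRight r r' SB jH jB 1 = 1 := by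
  have := congrArg (fun h ↦ jH (HopfAlgebra.antipode k h)) (hR.sum_counit_left hr)
  simp only [map_sum, map_smul, HopfAlgebra.antipode_one, map_one] at this
  rw [antipodeRight_apply, hB.antipode_one, ← this]
  simp [hB.act_one, Algebra.algebraMap_eq_smul_one]

lemma antipodeLeft_one (hR : IsQuasitriangular R)
    (hD : IsLeftBraidedGroup (R : H ⊗[k] H) SD.toLinearMap)
    (hs : ((R⁻¹ : (H ⊗[k] H)ˣ) : H ⊗[k] H) = ∑ i, s i ⊗ₜ[k] s' i) :
    antipodeLeft s s' SD.symm.toLinearMap jD jH 1 = 1 := by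
  have := congrArg (fun h ↦ jH (HopfAlgebra.antipode k h)) (hR.sum_inv_counit_right hs)
  have h1 : SD.symm 1 = 1 := by rw [LinearEquiv.symm_apply_eq, hD.antipode_one]
  simp only [map_sum, map_smul, HopfAlgebra.antipode_one, map_one] at this
  rw [antipodeLeft_apply, LinearEquiv.coe_coe, h1, ← this]
  simp [hD.act_one, Algebra.algebraMap_eq_smul_one]

end

variable [Bialgebra k V] {jD : D →ₐ[k] V} {jH : H →ₐ[k] V} {jB : B →ₐ[k] V}

namespace IsDoubleBialgebra

variable (w : IsDoubleBialgebra R SD pair jD jH jB)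

lemma equiv_inclCH (c : D) (h : H) : w.equiv (inclCH k D H B (c ⊗ₜ h)) = jD c * jH h := by
  simp [inclCH]

lemma equiv_inclHB (h : H) (b : B) : w.equiv (inclHB k D H B (h ⊗ₜ b)) = jH h * jB b := by
  simp [inclHB]

variable (hR : IsQuasitriangular R) (hD : IsLeftBraidedGroup (R : H ⊗[k] H) SD.toLinearMap)
  (hB : IsRightBraidedGroup (R : H ⊗[k] H) SB)
  {l m : ℕ} {r r' : Fin l → H} {s s' : Fin m → H}

include hR hB hD

theorem isSubHopfAlgebra_left (hr : (R : H ⊗[k] H) = ∑ i, r i ⊗ₜ[k] r' i)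
    (hs : ((R⁻¹ : (H ⊗[k] H)ˣ) : H ⊗[k] H) = ∑ i, s i ⊗ₜ[k] s' i) :
    (leftBosonisation (conjR R) (copComul R D) counit SD.symm.toLinearMap).IsSubHopfAlgebra
      (transportHopf w.equiv (w.antipode (antipodeLeft s s' SD.symm.toLinearMap jD jH)
        (antipodeRight r r' SB jH jB))) (inclCH k D H B) := by
  -- The restriction to DH is S(ch) = S(h)S(c), because the B-part of the antipode fixes 1.
  have hS (c : D) (h : H) : w.antipode (antipodeLeft s s' SD.symm.toLinearMap jD jH)
      (antipodeRight r r' SB jH jB) (jD c * jH h) =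
      jH (HopfAlgebra.antipode k h) * antipodeLeft s s' SD.symm.toLinearMap jD jH c := by
    have := w.antipode_apply (antipodeLeft s s' SD.symm.toLinearMap jD jH)
      (antipodeRight r r' SB jH jB) c h 1
    rw [map_one, mul_one] at this
    rw [this, antipodeRight_one hR hB hr, one_mul]
  refine isSubHopfAlgebra_transport _ _ _ _ (inclCH_injective hB) (fun a b ↦ ?_) ?_ (fun a ↦ ?_)
    (fun a ↦ ?_) (fun a ↦ ?_)
  · induction a with
    | zero => simp
    | add x y hx hy => simp only [TensorProduct.add_tmul, map_add, add_mul, hx, hy]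
    | tmul c h =>
      induction b with
      | zero => simp
      | add x y hx hy => simp only [TensorProduct.tmul_add, map_add, mul_add, hx, hy]
      | tmul d g =>
        obtain ⟨p, h₁, h₂, hh⟩ := TensorProduct.exists_sum_tmul_eq (comul (R := k) h)
        rw [leftBosonisation_mul hh]
        simp only [map_sum, equiv_inclCH]
        rw [mul_assoc, ← mul_assoc (jH h), w.mid_mul_left hh]
        simp [Finset.sum_mul, Finset.mul_sum, mul_assoc]
  · simp [leftBosonisation, equiv_inclCH]
  · induction a with
    | zero => simp
    | add x y hx hy => simp only [map_add, hx, hy]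
    | tmul c h =>
      obtain ⟨p, h₁, h₂, hh⟩ := TensorProduct.exists_sum_tmul_eq (comul (R := k) h)
      obtain ⟨n, c₁, c₂, hc⟩ := TensorProduct.exists_sum_tmul_eq (copComul R D c)
      rw [leftBosonisation_comul hs hh hc, equiv_inclCH, Bialgebra.comul_mul, w.comul_mid, hh,
        w.comul_left c hs hc]
      simp [Finset.sum_mul, Finset.mul_sum, mul_assoc, equiv_inclCH]
      rw [Finset.sum_comm]
      exact Finset.sum_congr rfl fun x _ ↦ Finset.sum_comm
  · induction a with
    | zero => simp
    | add x y hx hy => simp only [map_add, hx, hy]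
    | tmul c h => simp [equiv_inclCH, w.counit_left, w.counit_mid, leftBosonisation]
  · induction a with
    | zero => simp
    | add x y hx hy => simp only [map_add, hx, hy]
    | tmul c h =>
      obtain ⟨p, h₁, h₂, hh⟩ := TensorProduct.exists_sum_tmul_eq (comul (R := k) h)
      rw [equiv_inclCH, hS, w.mid_mul_antipodeLeft hR hs hh, leftBosonisation_antipode hs hh]
      simp only [map_sum, equiv_inclCH, LinearEquiv.coe_coe]

theorem isSubHopfAlgebra_right (hr : (R : H ⊗[k] H) = ∑ i, r i ⊗ₜ[k] r' i)
    (hs : ((R⁻¹ : (H ⊗[k] H)ˣ) : H ⊗[k] H) = ∑ i, s i ⊗ₜ[k] s' i) :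
    (rightBosonisation (R : H ⊗[k] H) SB).IsSubHopfAlgebra
      (transportHopf w.equiv (w.antipode (antipodeLeft s s' SD.symm.toLinearMap jD jH)
        (antipodeRight r r' SB jH jB))) (inclHB k D H B) := by
  have hS (h : H) (b : B) : w.antipode (antipodeLeft s s' SD.symm.toLinearMap jD jH)
      (antipodeRight r r' SB jH jB) (jH h * jB b) =
      antipodeRight r r' SB jH jB b * jH (HopfAlgebra.antipode k h) := by
    have := w.antipode_apply (antipodeLeft s s' SD.symm.toLinearMap jD jH)
      (antipodeRight r r' SB jH jB) 1 h b
    rw [map_one, one_mul] at this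
    rw [this, antipodeLeft_one hR hD hs, mul_one]
  refine isSubHopfAlgebra_transport _ _ _ _ (inclHB_injective hD) (fun a a' ↦ ?_) ?_ (fun a ↦ ?_)
    (fun a ↦ ?_) (fun a ↦ ?_)
  · induction a with
    | zero => simp
    | add x y hx hy => simp only [TensorProduct.add_tmul, map_add, add_mul, hx, hy]
    | tmul h b =>
      induction a' with
      | zero => simp
      | add x y hx hy => simp only [TensorProduct.tmul_add, map_add, mul_add, hx, hy]
      | tmul g c =>
        obtain ⟨p, h₁, h₂, hh⟩ := TensorProduct.exists_sum_tmul_eq (comul (R := k) g)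
        rw [rightBosonisation_mul hh]
        simp only [map_sum, equiv_inclHB]
        rw [mul_assoc, ← mul_assoc (jB _), w.right_mul_mid hh]
        simp [Finset.sum_mul, Finset.mul_sum, mul_assoc]
  · simp [rightBosonisation, equiv_inclHB]
  · induction a with
    | zero => simp
    | add x y hx hy => simp only [map_add, hx, hy]
    | tmul h b =>
      obtain ⟨p, h₁, h₂, hh⟩ := TensorProduct.exists_sum_tmul_eq (comul (R := k) h)
      obtain ⟨n, b₁, b₂, hb⟩ := TensorProduct.exists_sum_tmul_eq (comul (R := k) b)
      rw [rightBosonisation_comul hr hh hb, equiv_inclHB, Bialgebra.comul_mul, w.comul_mid, hh,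
        w.comul_right b hr hb]
      simp [Finset.sum_mul, Finset.mul_sum, mul_assoc, equiv_inclHB]
      simp only [Finset.sum_comm (t := (Finset.univ : Finset (Fin p)))]
  · induction a with
    | zero => simp
    | add x y hx hy => simp only [map_add, hx, hy]
    | tmul c h => simp [equiv_inclHB, w.counit_right, w.counit_mid, rightBosonisation]
  · induction a with
    | zero => simp
    | add x y hx hy => simp only [map_add, hx, hy]
    | tmul h b =>
      obtain ⟨p, h₁, h₂, hh⟩ := TensorProduct.exists_sum_tmul_eq (comul (R := k) h)
      rw [equiv_inclHB, hS, w.antipodeRight_mul_mid hR hr hh, rightBosonisation_antipode hr hh]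
      simp only [map_sum, equiv_inclHB]

theorem isDoubleBosonisation (hr : (R : H ⊗[k] H) = ∑ i, r i ⊗ₜ[k] r' i)
    (hs : ((R⁻¹ : (H ⊗[k] H)ˣ) : H ⊗[k] H) = ∑ i, s i ⊗ₜ[k] s' i) :
    IsDoubleBosonisation R SD SB pair (transportHopf w.equiv (w.antipode
      (antipodeLeft s s' SD.symm.toLinearMap jD jH) (antipodeRight r r' SB jH jB))) where
  isHopfAlgebra := transportHopf_isHopfAlgebra _ _
    (w.mul_antipode_rTensor_comul hR hD hB hr hs) (w.mul_antipode_lTensor_comul hR hD hB hr hs)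
  isTriangular c h b := by
    simp only [transportHopf_mul, LinearEquiv.apply_symm_apply]
    rw [LinearEquiv.symm_apply_eq]
    simp [mul_assoc]
  left_sub := w.isSubHopfAlgebra_left hR hD hB hr hs
  right_sub := w.isSubHopfAlgebra_right hR hD hB hr hs
  cross b c l m p q r r' s s' c₁ c₂ c₃ b₁ b₂ b₃ hr hs hc hb := by
    rw [transportHopf_mul, LinearEquiv.symm_apply_eq]
    simp only [map_sum, map_smul, equiv_tmul, map_one, one_mul, mul_one]
    exact w.cross b c hr hs hc hb

end IsDoubleBialgebra

end Existence

/-! ### Uniqueness of the double-bosonisation. -/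

section Uniqueness

open WithConv

/-- Provides expressions of the iterated coproducts to which the cross relation can be applied. -/
lemma exists_sum_tmul_tmul_eq {k M N P : Type*} [Field k] [AddCommGroup M] [Module k M]
    [AddCommGroup N] [Module k N] [AddCommGroup P] [Module k P] (z : M ⊗[k] (N ⊗[k] P)) :
    ∃ (n : ℕ) (x : Fin n → M) (y : Fin n → N) (t : Fin n → P),
      z = ∑ i, x i ⊗ₜ[k] (y i ⊗ₜ[k] t i) := by
  obtain ⟨n, x, w, rfl⟩ := TensorProduct.exists_sum_tmul_eq z
  choose m y t h using fun i ↦ TensorProduct.exists_sum_tmul_eq (w i)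
  let e := Fintype.equivFin (Σ i, Fin (m i))
  refine ⟨_, fun j ↦ x (e.symm j).1, fun j ↦ y _ (e.symm j).2, fun j ↦ t _ (e.symm j).2, ?_⟩
  rw [Equiv.sum_comp e.symm (fun p : Σ i, Fin (m i) ↦ x p.1 ⊗ₜ[k] (y _ p.2 ⊗ₜ[k] t _ p.2)),
    Fintype.sum_sigma]
  simp only [h, TensorProduct.tmul_sum]

/-- Both antipodes are inverses of the identity under convolution. Ring and coalgebra instances are
built from the raw data to have the convolution algebra available. -/
lemma antipode_unique {k A : Type*} [Field k] [AddCommGroup A] [Module k A] {X Y : HopfData k A}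
    (hX : X.IsHopfAlgebra) (hY : Y.IsHopfAlgebra) (hm : Y.mul = X.mul) (h1 : Y.one = X.one)
    (hc : Y.comul = X.comul) (hε : Y.counit = X.counit) : X.antipode = Y.antipode := by
  letI ring : Ring A :=
    { (inferInstance : AddCommGroup A) with
      mul := fun u v ↦ X.mul (u ⊗ₜ v)
      one := X.one
      one_mul := hX.one_mul
      mul_one := hX.mul_one
      mul_assoc := hX.mul_assoc
      left_distrib := fun u v x ↦ by
        change X.mul _ = X.mul _ + X.mul _
        rw [TensorProduct.tmul_add, map_add]
      right_distrib := fun u v x ↦ by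
        change X.mul _ = X.mul _ + X.mul _
        rw [TensorProduct.add_tmul, map_add]
      zero_mul := fun u ↦ by
        change X.mul _ = _
        rw [TensorProduct.zero_tmul, map_zero]
      mul_zero := fun u ↦ by
        change X.mul _ = _
        rw [TensorProduct.tmul_zero, map_zero] }
  letI alg : Algebra k A := Algebra.ofModule
    (fun a u v ↦ by
      change X.mul _ = a • X.mul _
      rw [← TensorProduct.smul_tmul', map_smul])
    (fun a u v ↦ by
      change X.mul _ = a • X.mul _
      rw [TensorProduct.tmul_smul, map_smul])
  letI coalg : Coalgebra k A :=
    { comul := X.comul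
      counit := X.counit
      coassoc := LinearMap.ext hX.coassoc
      rTensor_counit_comp_comul := LinearMap.ext fun a ↦ by
        change _ = (1 : k) ⊗ₜ[k] a
        rw [← TensorProduct.lid_symm_apply, LinearEquiv.eq_symm_apply]
        exact hX.counit_comul a
      lTensor_counit_comp_comul := LinearMap.ext fun a ↦ by
        change _ = a ⊗ₜ[k] (1 : k)
        rw [← TensorProduct.rid_symm_apply, LinearEquiv.eq_symm_apply]
        exact hX.comul_counit a }
  have hmul : LinearMap.mul' k A = X.mul := TensorProduct.ext' fun _ _ ↦ rfl
  have hl : toConv X.antipode * toConv LinearMap.id = 1 := by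
    apply WithConv.ext
    ext a
    have := hX.antipode_left a
    rw [← hmul] at this
    exact this.trans (Algebra.algebraMap_eq_smul_one (A := A) _).symm
  have hr : toConv LinearMap.id * toConv Y.antipode = 1 := by
    apply WithConv.ext
    ext a
    have := hY.antipode_right a
    rw [hm, hc, hε, h1, ← hmul] at this
    exact this.trans (Algebra.algebraMap_eq_smul_one (A := A) _).symm
  exact toConv_injective (left_inv_eq_right_inv hl hr)

variable {k H B D : Type*} [Field k] [Ring H] [HopfAlgebra k H]
  [Ring B] [Algebra k B] [Coalgebra k B] [Module Hᵐᵒᵖ B] [IsScalarTower k Hᵐᵒᵖ B]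
  [Ring D] [Algebra k D] [Coalgebra k D] [Module H D] [IsScalarTower k H D]
  {R : (H ⊗[k] H)ˣ} {SB : B →ₗ[k] B} {SD : D ≃ₗ[k] D} {pair : D →ₗ[k] B →ₗ[k] k}
  {U U' : HopfData k (D ⊗[k] (H ⊗[k] B))}

namespace IsDoubleBosonisation

lemma one_eq (hU : IsDoubleBosonisation R SD SB pair U) : U.one = 1 ⊗ₜ (1 ⊗ₜ 1) :=
  hU.left_sub.map_one.symm

lemma mul_left_mid (hU : IsDoubleBosonisation R SD SB pair U) (c : D) (h : H) :
    U.mul ((c ⊗ₜ (1 ⊗ₜ 1)) ⊗ₜ (1 ⊗ₜ (h ⊗ₜ 1))) = c ⊗ₜ (h ⊗ₜ 1) := by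
  have := hU.isTriangular c h 1
  rwa [← hU.one_eq, hU.isHopfAlgebra.mul_one] at this

lemma mul_mid_right (hU : IsDoubleBosonisation R SD SB pair U) (h : H) (b : B) :
    U.mul ((1 ⊗ₜ (h ⊗ₜ 1)) ⊗ₜ (1 ⊗ₜ (1 ⊗ₜ b))) = 1 ⊗ₜ (h ⊗ₜ b) := by
  have := hU.isTriangular 1 h b
  rwa [hU.mul_left_mid] at this

lemma mul_inclCH_right (hU : IsDoubleBosonisation R SD SB pair U) (c : D) (h : H) (b : B) :
    U.mul (inclCH k D H B (c ⊗ₜ h) ⊗ₜ (1 ⊗ₜ (1 ⊗ₜ b))) = c ⊗ₜ (h ⊗ₜ b) := by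
  have := hU.isTriangular c h b
  rwa [hU.mul_left_mid] at this

lemma mul_left_inclHB (hU : IsDoubleBosonisation R SD SB pair U) (c : D) (h : H) (b : B) :
    U.mul ((c ⊗ₜ (1 ⊗ₜ 1)) ⊗ₜ inclHB k D H B (h ⊗ₜ b)) = c ⊗ₜ (h ⊗ₜ b) := by
  have := hU.isTriangular c h b
  rwa [hU.isHopfAlgebra.mul_assoc, hU.mul_mid_right] at this

section

variable (hU : IsDoubleBosonisation R SD SB pair U) (hU' : IsDoubleBosonisation R SD SB pair U')

include hU hU'

/-- Since x(chb) = (x(ch))b, the product is computed inside the bosonisation of D and then by the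
triangular decomposition. -/
lemma mul_inclCH_eq (x : D ⊗[k] H) (z : D ⊗[k] (H ⊗[k] B)) :
    U.mul (inclCH k D H B x ⊗ₜ z) = U'.mul (inclCH k D H B x ⊗ₜ z) := by
  have key (w : D ⊗[k] H) (b : B) : U.mul (inclCH k D H B w ⊗ₜ (1 ⊗ₜ (1 ⊗ₜ b))) =
      U'.mul (inclCH k D H B w ⊗ₜ (1 ⊗ₜ (1 ⊗ₜ b))) := by
    induction w with
    | zero => simp
    | add x y hx hy => simp only [map_add, TensorProduct.add_tmul, hx, hy]
    | tmul c h => rw [hU.mul_inclCH_right, hU'.mul_inclCH_right]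
  induction z with
  | zero => simp
  | add x y hx hy => simp only [map_add, TensorProduct.tmul_add, hx, hy]
  | tmul c z =>
    induction z with
    | zero => simp
    | add x y hx hy => simp only [map_add, TensorProduct.tmul_add, hx, hy]
    | tmul h b =>
      nth_rw 1 [← hU.mul_inclCH_right c h b]
      rw [← hU'.mul_inclCH_right c h b, ← hU.isHopfAlgebra.mul_assoc,
        ← hU'.isHopfAlgebra.mul_assoc, ← hU.left_sub.map_mul, ← hU'.left_sub.map_mul, key]

lemma mul_inclHB_eq (z : D ⊗[k] (H ⊗[k] B)) (y : H ⊗[k] B) :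
    U.mul (z ⊗ₜ inclHB k D H B y) = U'.mul (z ⊗ₜ inclHB k D H B y) := by
  have key (c : D) (w : H ⊗[k] B) : U.mul ((c ⊗ₜ (1 ⊗ₜ 1)) ⊗ₜ inclHB k D H B w) =
      U'.mul ((c ⊗ₜ (1 ⊗ₜ 1)) ⊗ₜ inclHB k D H B w) := by
    induction w with
    | zero => simp
    | add x y hx hy => simp only [map_add, TensorProduct.tmul_add, hx, hy]
    | tmul h b => rw [hU.mul_left_inclHB, hU'.mul_left_inclHB]
  induction z with
  | zero => simp
  | add x y hx hy => simp only [map_add, TensorProduct.add_tmul, hx, hy]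
  | tmul c z =>
    induction z with
    | zero => simp
    | add x y hx hy => simp only [map_add, TensorProduct.tmul_add, TensorProduct.add_tmul, hx, hy]
    | tmul h b =>
      nth_rw 1 [← hU.mul_left_inclHB c h b]
      rw [← hU'.mul_left_inclHB c h b, hU.isHopfAlgebra.mul_assoc,
        hU'.isHopfAlgebra.mul_assoc, ← hU.right_sub.map_mul, ← hU'.right_sub.map_mul, key]

lemma mul_right_left_eq (b : B) (c : D) :
    U.mul ((1 ⊗ₜ (1 ⊗ₜ b)) ⊗ₜ (c ⊗ₜ (1 ⊗ₜ 1))) = U'.mul ((1 ⊗ₜ (1 ⊗ₜ b)) ⊗ₜ (c ⊗ₜ (1 ⊗ₜ 1))) := by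
  obtain ⟨l, r, r', hr⟩ := TensorProduct.exists_sum_tmul_eq (R : H ⊗[k] H)
  obtain ⟨m, s, s', hs⟩ := TensorProduct.exists_sum_tmul_eq ((R⁻¹ : (H ⊗[k] H)ˣ) : H ⊗[k] H)
  obtain ⟨p, c₁, c₂, c₃, hc⟩ :=
    exists_sum_tmul_tmul_eq ((copComul R D).lTensor D (copComul R D c))
  obtain ⟨q, b₁, b₂, b₃, hb⟩ := exists_sum_tmul_tmul_eq
    ((Coalgebra.comul (R := k) (A := B)).lTensor B (Coalgebra.comul (R := k) b))
  rw [hU.cross b c l m p q r r' s s' c₁ c₂ c₃ b₁ b₂ b₃ hr hs hc hb,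
    hU'.cross b c l m p q r r' s s' c₁ c₂ c₃ b₁ b₂ b₃ hr hs hc hb]

/-- By associativity (chb)(c'h'b') = (ch)((bc')(h'b')). The product bc' is given by the cross
relation, right multiplication by HB and left multiplication by DH by the two preceding lemmas. -/
lemma mul_eq : U.mul = U'.mul := by
  refine TensorProduct.ext' fun x y ↦ ?_
  have key (c : D) (h : H) (b : B) (c' : D) (h' : H) (b' : B) :
      U.mul ((c ⊗ₜ (h ⊗ₜ b)) ⊗ₜ (c' ⊗ₜ (h' ⊗ₜ b'))) =
        U'.mul ((c ⊗ₜ (h ⊗ₜ b)) ⊗ₜ (c' ⊗ₜ (h' ⊗ₜ b'))) := by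
    have e {X : HopfData k (D ⊗[k] (H ⊗[k] B))} (hX : IsDoubleBosonisation R SD SB pair X) :
        X.mul ((c ⊗ₜ (h ⊗ₜ b)) ⊗ₜ (c' ⊗ₜ (h' ⊗ₜ b'))) = X.mul (inclCH k D H B (c ⊗ₜ h) ⊗ₜ
          X.mul (X.mul ((1 ⊗ₜ (1 ⊗ₜ b)) ⊗ₜ (c' ⊗ₜ (1 ⊗ₜ 1))) ⊗ₜ inclHB k D H B (h' ⊗ₜ b'))) := by
      rw [hX.isHopfAlgebra.mul_assoc (1 ⊗ₜ (1 ⊗ₜ b)), hX.mul_left_inclHB,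
        ← hX.isHopfAlgebra.mul_assoc, hX.mul_inclCH_right]
    rw [e hU, e hU', hU.mul_inclCH_eq hU', hU.mul_inclHB_eq hU', hU.mul_right_left_eq hU']
  induction x with
  | zero => simp
  | add x y hx hy => simp only [map_add, TensorProduct.add_tmul, hx, hy]
  | tmul c z =>
    induction z with
    | zero => simp
    | add x y hx hy => simp only [map_add, TensorProduct.tmul_add, TensorProduct.add_tmul, hx, hy]
    | tmul h b =>
      induction y with
      | zero => simp
      | add x y hx hy => simp only [map_add, TensorProduct.tmul_add, hx, hy]
      | tmul c' z =>
        induction z with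
        | zero => simp
        | add x y hx hy => simp only [map_add, TensorProduct.tmul_add, hx, hy]
        | tmul h' b' => exact key c h b c' h' b'

lemma comul_eq : U.comul = U'.comul := by
  have hm := hU.mul_eq hU'
  ext c h b
  simp only [TensorProduct.AlgebraTensorModule.curry_apply, TensorProduct.curry_apply,
    LinearMap.coe_restrictScalars]
  have e : inclHB k D H B (1 ⊗ₜ b) = 1 ⊗ₜ (1 ⊗ₜ b) := rfl
  nth_rw 1 [← hU.mul_inclCH_right c h b]
  rw [← hU'.mul_inclCH_right c h b, hU.isHopfAlgebra.comul_mul, hU'.isHopfAlgebra.comul_mul, ← e,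
    hU.left_sub.map_comul, hU'.left_sub.map_comul, hU.right_sub.map_comul,
    hU'.right_sub.map_comul, HopfData.mulTensor, HopfData.mulTensor, hm]

lemma counit_eq : U.counit = U'.counit := by
  ext c h b
  simp only [TensorProduct.AlgebraTensorModule.curry_apply, TensorProduct.curry_apply,
    LinearMap.coe_restrictScalars]
  have e : inclHB k D H B (1 ⊗ₜ b) = 1 ⊗ₜ (1 ⊗ₜ b) := rfl
  nth_rw 1 [← hU.mul_inclCH_right c h b]
  rw [← hU'.mul_inclCH_right c h b, hU.isHopfAlgebra.counit_mul, hU'.isHopfAlgebra.counit_mul, ← e,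
    hU.left_sub.map_counit, hU'.left_sub.map_counit, hU.right_sub.map_counit,
    hU'.right_sub.map_counit]

/-- A double-bosonisation is unique. -/
theorem unique : U = U' := by
  have hm := hU.mul_eq hU'
  have h1 : U.one = U'.one := hU.one_eq.trans hU'.one_eq.symm
  have hc := hU.comul_eq hU'
  have hε := hU.counit_eq hU'
  exact HopfData.ext hm h1 hc hε
    (antipode_unique hU.isHopfAlgebra hU'.isHopfAlgebra hm.symm h1.symm hc.symm hε.symm)

end

end IsDoubleBosonisation

end Uniqueness

end DoubleBosonisation

end

/-! ### The theorem: crossed algebra, bialgebra, twist, antipode, uniqueness. -/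

theorem theorem3p2 {k H B D : Type*} [Field k]
    [Ring H] [HopfAlgebra k H] (R : (TensorProduct k H H)ˣ)
    (hR : DoubleBosonisation.IsQuasitriangular R)
    [Ring B] [Algebra k B] [Coalgebra k B] [Module Hᵐᵒᵖ B] [IsScalarTower k Hᵐᵒᵖ B]
    (SB : B →ₗ[k] B)
    (hB : DoubleBosonisation.IsRightBraidedGroup (R : TensorProduct k H H) SB)
    [Ring D] [Algebra k D] [Coalgebra k D] [Module H D] [IsScalarTower k H D]
    (SD : D ≃ₗ[k] D)
    (hD : DoubleBosonisation.IsLeftBraidedGroup (R : TensorProduct k H H) SD.toLinearMap)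
    (pair : D →ₗ[k] B →ₗ[k] k)
    (hpair : DoubleBosonisation.IsDualPairing H pair) :
    ∃! U : DoubleBosonisation.HopfData k (TensorProduct k D (TensorProduct k H B)),
      DoubleBosonisation.IsDoubleBosonisation R SD SB pair U := by
  obtain ⟨U, _, _, iD, iH, iB, t, bij⟩ := DoubleBosonisation.exists_crossedTriple k H B D
    hD.act_mul hB.act_mul hD.act_one hB.act_one
  obtain ⟨V, _, _, jD, jH, jB, w⟩ := t.exists_crossedBialgebra bij hR hD hB
  obtain ⟨W, _, _, lD, lH, lB, w⟩ := w.exists_doubleBialgebra hR hD hB hpair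
  obtain ⟨l, r, r', hr⟩ := TensorProduct.exists_sum_tmul_eq (R : TensorProduct k H H)
  obtain ⟨m, s, s', hs⟩ := TensorProduct.exists_sum_tmul_eq
    ((R⁻¹ : (TensorProduct k H H)ˣ) : TensorProduct k H H)
  have h := w.isDoubleBosonisation hR hD hB hr hs
  exact ⟨_, h, fun X hX ↦ hX.unique h⟩
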